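/- Let $k$ be a field of characteristic $0$. **Classical data.** Let $\mathcal A$ be the commutative $k$-algebra generated by $a,b,c,d$ with $ad-bc=1$, and let $\mathcal M$ be the $\mathbb Z_2$-graded $k$-algebra generated by the even elements $a,b,c,d$ and odd elements $\theta^0,\theta^1,\theta^2$, with the relations of $\mathcal A$ and $t\theta^i=\theta^i t$ for $t\in\{a,b,c,d\}$, $\theta^i\theta^j=-\theta^j\theta^i$. Put $T=\begin{pmatrix}a&b\\c&d\end{pmatrix}$. Let $\Delta(T)=T\otimes T$, $\epsilon(T)=1$ on $\mathcal A$, and let $\Delta_L:\mathcal M\to\mathcal A\otimes\mathcal M$, $\Delta_R:\mathcal M\to\mathcal M\otimes\mathcal A$ be the algebra homomorphisms that equal $\Delta$ on $\mathcal A$ and satisfy $\Delta_R\theta^i=\theta^i\otimes 1$ and $$\Delta_L\theta^0=(1+2bc)\otimes\theta^0-ac\otimes\theta^1+bd\otimes\theta^2,$$ $$\Delta_L\theta^1=-2ab\otimes\theta^0+a^2\otimes\theta^1-b^2\otimes\theta^2,\qquad \Delta_L\theta^2=2cd\otimes\theta^0-c^2\otimes\theta^1+d^2\otimes\theta^2.$$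 A graded Poisson bracket on $\mathcal M$ is a bilinear map with $\deg\{x,y\}=\deg x+\deg y$, $\{x,y\}=-(-1)^{\deg x\deg y}\{y,x\}$, $\{xy,z\}=x\{y,z\}+(-1)^{\deg y\deg z}\{x,z\}y$ and the super Jacobi identity $$(-1)^{\deg x\deg z}\{\{x,y\},z\}+(-1)^{\deg y\deg z}\{\{z,x\},y\}+(-1)^{\deg x\deg y}\{\{y,z\},x\}=0$$ for homogeneous $x,y,z$; it is extended to $\mathcal M\otimes\mathcal M$ by $\{x\otimes y,z\otimes w\}=(-1)^{\deg y\deg z}(\{x,z\}\otimes yw+xz\otimes\{y,w\})$. It is graded Poisson–Lie if it maps $\mathcal A\times\mathcal A$ to $\mathcal A$ with $\Delta\{f,g\}=\{\Delta f,\Delta g\}$ on $\mathcal A$ and $\Delta_{L,R}\{x,y\}=\{\Delta_{L,R}x,\Delta_{L,R}y\}$ on $\mathcal M$. The brackets of type I and of type II are the graded Poisson brackets with $$\{a,b\}=-ab,\ \{a,c\}=-ac,\ \{b,d\}=-bd,\ \{c,d\}=-cd,\ \{c,b\}=0,\ \{a,d\}=-2bc,$$ $$\{\theta^0,\theta^0\}=-2\theta^1\theta^2,\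 \{\theta^0,\theta^1\}=-2\theta^0\theta^1,\ \{\theta^0,\theta^2\}=2\theta^0\theta^2,\ \{\theta^1,\theta^1\}=\{\theta^1,\theta^2\}=\{\theta^2,\theta^2\}=0$$ and, for $(x,y)\in\{(a,c),(b,d)\}$, * type I: $\{\theta^0,x\}=-2y\theta^1$, $\{\theta^1,x\}=x\theta^1$, $\{\theta^2,x\}=4y\theta^0-x\theta^2$, $\{\theta^0,y\}=0$, $\{\theta^1,y\}=-y\theta^1$, $\{\theta^2,y\}=y\theta^2$; * type II: $\{\theta^0,x\}=0$, $\{\theta^1,x\}=-x\theta^1$, $\{\theta^2,x\}=x\theta^2$, $\{\theta^0,y\}=-2x\theta^2$, $\{\theta^1,y\}=4x\theta^0+y\theta^1$, $\{\theta^2,y\}=-y\theta^2$. **Quantum data.** In $k[[h]]$ let $q=e^{-h}$, $\mu=q-q^{-1}$, $\lambda=q+q^{-1}$. Let $\mathcal A_q$ be the $k[[h]]$-algebra generated by $a,b,c,d$ with $$ab=qba,\quad ac=qca,\quad ad-da=\mu bc,\quad bc=cb,\quad cd=qdc,\quad bd=qdb \qquad(1)$$ and $\det_qT:=ad-qbc=1$.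 Let $\widetilde{\mathcal M}_q$ be the $k[[h]]$-algebra generated by $a,b,c,d,\theta^0,\theta^1,\theta^2$ with the relations (1), the relations $$(\theta^0)^2=\tfrac{q^2\mu}{\lambda}\theta^1\theta^2,\ (\theta^1)^2=(\theta^2)^2=0,\ \theta^1\theta^2=-\theta^2\theta^1,\ \theta^1\theta^0=-q^{-2}\theta^0\theta^1,\ \theta^2\theta^0=-q^2\theta^0\theta^2$$ and, for $(x,y)\in\{(a,c),(b,d)\}$, either * (I) $\theta^0x=x\theta^0+q^2\mu y\theta^1$, $\theta^1x=q^{-1}x\theta^1$, $\theta^2x=qx\theta^2-\mu\lambda y\theta^0$, $\theta^0y=y\theta^0$, $\theta^1y=qy\theta^1$, $\theta^2y=q^{-1}y\theta^2$, or * (II) $\theta^0x=x\theta^0$, $\theta^1x=qx\theta^1$, $\theta^2x=q^{-1}x\theta^2$, $\theta^0y=y\theta^0+\mu x\theta^2$, $\theta^1y=q^{-1}y\theta^1-q^{-2}\mu\lambda x\theta^0$, $\theta^2y=qy\theta^2$, and let $\mathcal M_q$ be its quotient by $\det_qT=1$, graded by $\deg t=0$ for $t\in\{a,b,c,d\}$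 and $\deg\theta^i=1$. **Theorem.** For each of the types I, II: 1. The bracket on $\mathcal M$ of that type exists and is unique, and it is graded Poisson–Lie. 2. There are algebra homomorphisms $\Delta:\mathcal A_q\to\mathcal A_q\otimes\mathcal A_q$, $\epsilon:\mathcal A_q\to k[[h]]$ with $\Delta(T)=T\otimes T$, $\epsilon(T)=1$, and $\Delta_L(q):\mathcal M_q\to\mathcal A_q\otimes\mathcal M_q$, $\Delta_R(q):\mathcal M_q\to\mathcal M_q\otimes\mathcal A_q$, equal to $\Delta$ on $\mathcal A_q$, with $\Delta_R(q)\theta^i=\theta^i\otimes1$ and $$\Delta_L(q)\theta^0=(ad+q^{-1}bc)\otimes\theta^0-q\,ac\otimes\theta^1+bd\otimes\theta^2,$$ $$\Delta_L(q)\theta^1=-\tfrac{\lambda}{q}ba\otimes\theta^0+a^2\otimes\theta^1-\tfrac1q b^2\otimes\theta^2,\qquad \Delta_L(q)\theta^2=\lambda\,dc\otimes\theta^0-q\,c^2\otimes\theta^1+d^2\otimes\theta^2;$$ $(\Delta,\epsilon)$ is a bialgebra structure on $\mathcal A_q$ and $\Delta_L(q),\Delta_R(q)$ make $\mathcal M_q$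 an $\mathcal A_q$-bicomodule. The same holds for the classical $\Delta,\epsilon,\Delta_L,\Delta_R$. 3. With these comultiplications $\mathcal M_q$ is a quantization of $\mathcal M$ with the bracket of that type: $\mathcal M_q$ is a free $k[[h]]$-module; sending generators to generators and $h$ to $0$ induces algebra isomorphisms $\mathcal A_q/h\mathcal A_q\cong\mathcal A$ and $\mathcal M_q/h\mathcal M_q\cong\mathcal M$ which carry $\Delta,\epsilon,\Delta_L(q),\Delta_R(q)$ to $\Delta,\epsilon,\Delta_L,\Delta_R$; and for homogeneous $\hat x,\hat y\in\mathcal M_q$ with images $x,y\in\mathcal M$ the graded commutator $[\hat x,\hat y]=\hat x\hat y-(-1)^{\deg\hat x\deg\hat y}\hat y\hat x$ lies in $h\mathcal M_q$ and $\frac1h[\hat x,\hat y]$ has image $\{x,y\}$. 4. The quantum determinant $\det_qT$ is central in $\widetilde{\mathcal M}_q$ and in $\mathcal M_q$. -/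

import Mathlib

open scoped TensorProduct PowerSeries

noncomputable section

namespace SLForms

/-! ### Generators -/

/-- The entries of the matrix `T = (a b; c d)`. -/
inductive TGen
  | a | b | c | d

/-- The even generators `a, b, c, d` and the odd generators `θ⁰, θ¹, θ²`. -/
inductive Gen
  | t (x : TGen)
  | θ (i : Fin 3)

/-- The `ℤ/2`-degree of a generator. -/
def Gen.deg : Gen → ZMod 2
  | .t _ => 0
  | .θ _ => 1

/-- The Koszul sign `(-1)^(p r)`. -/
def koszul (p r : ZMod 2) : ℤ := if p = 1 ∧ r = 1 then -1 else 1

/-- The component of degree `p` in an algebra generated by elements `g s` of degree `s.deg`: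
the span of all words whose total degree is `p`. -/
def parityPart (R : Type*) {B : Type*} [CommRing R] [Ring B] [Algebra R B] (g : Gen → B)
    (p : ZMod 2) : Submodule R B :=
  Submodule.span R {x | ∃ w : List Gen, (w.map Gen.deg).sum = p ∧ x = (w.map g).prod}

/-- The two types of commutation relations (and of brackets) between the `θ`'s and `a, b, c, d`. -/
inductive Kind
  | I | II

/-! ### The classical algebras -/

section Classical

variable (k : Type*) [Field k]

/-- Commutativity of the matrix entries and `ad - bc = 1`. -/
inductive ARel {B : Type*} [Ring B] (t : TGen → B) : B → B → Prop
  | comm (x y : TGen) : ARel t (t x * t y) (t y * t x)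
  | det : ARel t (t .a * t .d - t .b * t .c) 1

/-- The relations of the external algebra of `SL(2)`. -/
inductive MRel {B : Type*} [Ring B] (t : TGen → B) (θ : Fin 3 → B) : B → B → Prop
  | base {x y : B} : ARel t x y → MRel t θ x y
  | tθ (x : TGen) (i : Fin 3) : MRel t θ (t x * θ i) (θ i * t x)
  | θθ (i j : Fin 3) : MRel t θ (θ i * θ j) (-(θ j * θ i))

/-- The function algebra of `SL(2)` over `k`. -/
def A := RingQuot (ARel (FreeAlgebra.ι k : TGen → FreeAlgebra k TGen))

instance : Ring (A k) := inferInstanceAs (Ring (RingQuot _))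

instance : Algebra k (A k) := inferInstanceAs (Algebra k (RingQuot _))

/-- The external algebra of `SL(2)` over `k`. -/
def M := RingQuot (MRel (fun x => FreeAlgebra.ι k (Gen.t x)) (fun i => FreeAlgebra.ι k (Gen.θ i)))

instance : Ring (M k) := inferInstanceAs (Ring (RingQuot _))

instance : Algebra k (M k) := inferInstanceAs (Algebra k (RingQuot _))

/-- The quotient map onto `A`. -/
def mkA : FreeAlgebra k TGen →ₐ[k] A k := RingQuot.mkAlgHom k _

/-- The quotient map onto `M`. -/
def mkM : FreeAlgebra k Gen →ₐ[k] M k := RingQuot.mkAlgHom k _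

/-- The matrix entries in `A`. -/
def tA (x : TGen) : A k := mkA k (FreeAlgebra.ι k x)

/-- The generators of `M`. -/
def gM (s : Gen) : M k := mkM k (FreeAlgebra.ι k s)

/-- The matrix entries in `M`. -/
def tM (x : TGen) : M k := gM k (.t x)

/-- The right-invariant one-forms in `M`. -/
def θM (i : Fin 3) : M k := gM k (.θ i)

theorem ARel.map {B B' : Type*} [Ring B] [Ring B'] [Algebra k B] [Algebra k B'] (f : B →ₐ[k] B')
    {t : TGen → B} {x y : B} (h : ARel t x y) : ARel (fun s => f (t s)) (f x) (f y) := by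
  cases h with
  | comm x y => simpa using ARel.comm (t := fun s => f (t s)) x y
  | det => simpa using ARel.det (t := fun s => f (t s))

/-- The canonical homomorphism `A → M`. -/
def inclA : A k →ₐ[k] M k :=
  RingQuot.liftAlgHom k ⟨FreeAlgebra.lift k (tM k), fun x y h => by
    have h0 := h.map k (FreeAlgebra.lift k fun s => FreeAlgebra.ι k (Gen.t s))
    simp only [FreeAlgebra.lift_ι_apply] at h0
    have h1 : mkM k _ = mkM k _ :=
      RingQuot.mkAlgHom_rel k (MRel.base (θ := fun i => FreeAlgebra.ι k (Gen.θ i)) h0)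
    have h2 : FreeAlgebra.lift k (tM k) =
        (mkM k).comp (FreeAlgebra.lift k fun s => FreeAlgebra.ι k (Gen.t s)) := by
      ext s; simp [tM, gM]
    rw [h2]; exact h1⟩

end Classical

/-! ### The quantum algebras -/

section Quantum

variable (k : Type*) [Field k] [CharZero k]

/-- The deformation parameter `q = exp(-h)` in `k[[h]]`. -/
def q : k⟦X⟧ := PowerSeries.evalNegHom (PowerSeries.exp k)

/-- `μ = q - 1/q`. -/
def mu : k⟦X⟧ := q k - (q k)⁻¹

/-- `λ = q + 1/q` (its constant term is `2`). -/
def lam : k⟦X⟧ := q k + (q k)⁻¹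

section Relations

variable {B : Type*} [Ring B] [Algebra k⟦X⟧ B] (t : TGen → B) (θ : Fin 3 → B)

/-- The quantum determinant `ad - q bc`. -/
def detq : B := t .a * t .d - q k • (t .b * t .c)

/-- The defining relations of the quantum matrix algebra. -/
inductive GLqRel : B → B → Prop
  | ab : GLqRel (t .a * t .b) (q k • (t .b * t .a))
  | ac : GLqRel (t .a * t .c) (q k • (t .c * t .a))
  | ad : GLqRel (t .a * t .d - t .d * t .a) (mu k • (t .b * t .c))
  | bc : GLqRel (t .b * t .c) (t .c * t .b)
  | cd : GLqRel (t .c * t .d) (q k • (t .d * t .c))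
  | bd : GLqRel (t .b * t .d) (q k • (t .d * t .b))

/-- The relations of the function algebra of `SL_q(2)`. -/
inductive SLqRel : B → B → Prop
  | base {x y : B} : GLqRel k t x y → SLqRel x y
  | det : SLqRel (detq k t) 1

/-- The right-hand side of the relation `θⁱ x = …` for a matrix entry `x`; for a given `x` the three
entries are those for `i = 0, 1, 2`. -/
def crossRhs : Kind → TGen → Fin 3 → B
  | .I, .a => ![t .a * θ 0 + (q k ^ 2 * mu k) • (t .c * θ 1),
                (q k)⁻¹ • (t .a * θ 1),
                q k • (t .a * θ 2) - (mu k * lam k) • (t .c * θ 0)]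
  | .I, .b => ![t .b * θ 0 + (q k ^ 2 * mu k) • (t .d * θ 1),
                (q k)⁻¹ • (t .b * θ 1),
                q k • (t .b * θ 2) - (mu k * lam k) • (t .d * θ 0)]
  | .I, .c => ![t .c * θ 0, q k • (t .c * θ 1), (q k)⁻¹ • (t .c * θ 2)]
  | .I, .d => ![t .d * θ 0, q k • (t .d * θ 1), (q k)⁻¹ • (t .d * θ 2)]
  | .II, .a => ![t .a * θ 0, q k • (t .a * θ 1), (q k)⁻¹ • (t .a * θ 2)]
  | .II, .b => ![t .b * θ 0, q k • (t .b * θ 1), (q k)⁻¹ • (t .b * θ 2)]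
  | .II, .c => ![t .c * θ 0 + mu k • (t .a * θ 2),
                 (q k)⁻¹ • (t .c * θ 1) - (mu k * lam k * (q k ^ 2)⁻¹) • (t .a * θ 0),
                 q k • (t .c * θ 2)]
  | .II, .d => ![t .d * θ 0 + mu k • (t .b * θ 2),
                 (q k)⁻¹ • (t .d * θ 1) - (mu k * lam k * (q k ^ 2)⁻¹) • (t .b * θ 0),
                 q k • (t .d * θ 2)]

/-- The quadratic relations among the `θ`'s. -/
inductive ThetaRel : B → B → Prop
  | sq0 : ThetaRel (θ 0 ^ 2) ((q k ^ 2 * mu k * (lam k)⁻¹) • (θ 1 * θ 2))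
  | sq1 : ThetaRel (θ 1 ^ 2) 0
  | sq2 : ThetaRel (θ 2 ^ 2) 0
  | r12 : ThetaRel (θ 1 * θ 2) (-(θ 2 * θ 1))
  | r10 : ThetaRel (θ 1 * θ 0) (-((q k ^ 2)⁻¹ • (θ 0 * θ 1)))
  | r20 : ThetaRel (θ 2 * θ 0) (-(q k ^ 2 • (θ 0 * θ 2)))

/-- All relations except `det_q = 1`. -/
inductive GLFormsRel (τ : Kind) : B → B → Prop
  | tt {x y : B} : GLqRel k t x y → GLFormsRel τ x y
  | cross (i : Fin 3) (x : TGen) : GLFormsRel τ (θ i * t x) (crossRhs k t θ τ x i)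
  | θθ {x y : B} : ThetaRel k θ x y → GLFormsRel τ x y

/-- All relations. -/
inductive SLFormsRel (τ : Kind) : B → B → Prop
  | base {x y : B} : GLFormsRel k t θ τ x y → SLFormsRel τ x y
  | det : SLFormsRel τ (detq k t) 1

end Relations

/-- The function algebra of `SL_q(2)`, over `k[[h]]`. -/
def Aq := RingQuot (SLqRel k (FreeAlgebra.ι k⟦X⟧ : TGen → FreeAlgebra k⟦X⟧ TGen))

/-- The algebra generated by `SL_q(2)` and the `θ`'s, with cross relations of type `τ`. -/
def Mq (τ : Kind) := RingQuot (SLFormsRel k (fun x => FreeAlgebra.ι k⟦X⟧ (Gen.t x))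
  (fun i => FreeAlgebra.ι k⟦X⟧ (Gen.θ i)) τ)

/-- The same algebra before the quantum determinant is set equal to `1`. -/
def MqGL (τ : Kind) := RingQuot (GLFormsRel k (fun x => FreeAlgebra.ι k⟦X⟧ (Gen.t x))
  (fun i => FreeAlgebra.ι k⟦X⟧ (Gen.θ i)) τ)

instance : Ring (Aq k) := inferInstanceAs (Ring (RingQuot _))

instance : Algebra k⟦X⟧ (Aq k) := inferInstanceAs (Algebra k⟦X⟧ (RingQuot _))

instance (τ : Kind) : Ring (Mq k τ) := inferInstanceAs (Ring (RingQuot _))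

instance (τ : Kind) : Algebra k⟦X⟧ (Mq k τ) := inferInstanceAs (Algebra k⟦X⟧ (RingQuot _))

instance (τ : Kind) : Ring (MqGL k τ) := inferInstanceAs (Ring (RingQuot _))

instance (τ : Kind) : Algebra k⟦X⟧ (MqGL k τ) := inferInstanceAs (Algebra k⟦X⟧ (RingQuot _))

/-- The quotient map onto `Aq`. -/
def mkAq : FreeAlgebra k⟦X⟧ TGen →ₐ[k⟦X⟧] Aq k := RingQuot.mkAlgHom k⟦X⟧ _

/-- The quotient map onto `Mq`. -/
def mkMq (τ : Kind) : FreeAlgebra k⟦X⟧ Gen →ₐ[k⟦X⟧] Mq k τ := RingQuot.mkAlgHom k⟦X⟧ _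

/-- The quotient map onto `MqGL`. -/
def mkMqGL (τ : Kind) : FreeAlgebra k⟦X⟧ Gen →ₐ[k⟦X⟧] MqGL k τ := RingQuot.mkAlgHom k⟦X⟧ _

/-- The matrix entries in `Aq`. -/
def tAq (x : TGen) : Aq k := mkAq k (FreeAlgebra.ι k⟦X⟧ x)

/-- The generators of `Mq`. -/
def gMq (τ : Kind) (s : Gen) : Mq k τ := mkMq k τ (FreeAlgebra.ι k⟦X⟧ s)

/-- The matrix entries in `Mq`. -/
def tMq (τ : Kind) (x : TGen) : Mq k τ := gMq k τ (.t x)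

/-- The one-forms `θ⁰, θ¹, θ²` in `Mq`. -/
def θMq (τ : Kind) (i : Fin 3) : Mq k τ := gMq k τ (.θ i)

/-- The matrix entries in `MqGL`. -/
def tMqGL (τ : Kind) (x : TGen) : MqGL k τ :=
  mkMqGL k τ (FreeAlgebra.ι k⟦X⟧ (Gen.t x))

theorem SLqRel.map {B B' : Type*} [Ring B] [Ring B'] [Algebra k⟦X⟧ B] [Algebra k⟦X⟧ B']
    (f : B →ₐ[k⟦X⟧] B') {t : TGen → B} {x y : B} (h : SLqRel k t x y) :
    SLqRel k (fun s => f (t s)) (f x) (f y) := by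
  cases h with
  | base h =>
    refine .base ?_
    cases h <;> simp only [map_mul, map_sub, map_smul]
    · exact .ab
    · exact .ac
    · exact .ad
    · exact .bc
    · exact .cd
    · exact .bd
  | det => simpa [detq] using SLqRel.det (k := k) (t := fun s => f (t s))

theorem SLqRel.toForms {B : Type*} [Ring B] [Algebra k⟦X⟧ B] {t : TGen → B} (θ : Fin 3 → B)
    (τ : Kind) {x y : B} (h : SLqRel k t x y) : SLFormsRel k t θ τ x y := by
  cases h with
  | base h => exact .base (.tt h)
  | det => exact .det

/-- The canonical homomorphism `Aq → Mq`. -/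
def inclAq (τ : Kind) : Aq k →ₐ[k⟦X⟧] Mq k τ :=
  RingQuot.liftAlgHom k⟦X⟧ ⟨FreeAlgebra.lift k⟦X⟧ (tMq k τ), fun x y h => by
    have h0 := (h.map k (FreeAlgebra.lift k⟦X⟧ fun s => FreeAlgebra.ι k⟦X⟧ (Gen.t s)))
    simp only [FreeAlgebra.lift_ι_apply] at h0
    have h1 : mkMq k τ _ = mkMq k τ _ := RingQuot.mkAlgHom_rel k⟦X⟧
      (h0.toForms k (fun i => FreeAlgebra.ι k⟦X⟧ (Gen.θ i)) τ)
    have h2 : FreeAlgebra.lift k⟦X⟧ (tMq k τ) = (mkMq k τ).comp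
        (FreeAlgebra.lift k⟦X⟧ fun s => FreeAlgebra.ι k⟦X⟧ (Gen.t s)) := by
      ext s; simp [tMq, gMq]
    rw [h2]; exact h1⟩

end Quantum

/-! ### Comultiplications -/

/-- A bialgebra structure `(Δ, ε)` on `A` together with comultiplications
`ΔL : M → A ⊗ M`, `ΔR : M → M ⊗ A`, all of them algebra homomorphisms, which prolong `Δ` along
`incl : A → M` and make `M` an `A`-bicomodule. (As `A` is purely even, `A ⊗ M` and `M ⊗ A` carry the
ordinary tensor product multiplication: all Koszul signs are trivial there.) -/
structure Comultiplications (R A M : Type*) [CommRing R] [Ring A] [Algebra R A] [Ring M]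
    [Algebra R M] (incl : A →ₐ[R] M) where
  Δ : A →ₐ[R] A ⊗[R] A
  ε : A →ₐ[R] R
  ΔL : M →ₐ[R] A ⊗[R] M
  ΔR : M →ₐ[R] M ⊗[R] A
  coassoc : ∀ x : A, TensorProduct.assoc R A A A (Δ.toLinearMap.rTensor A (Δ x)) =
    Δ.toLinearMap.lTensor A (Δ x)
  counit_left : ∀ x : A, TensorProduct.lid R A (ε.toLinearMap.rTensor A (Δ x)) = x
  counit_right : ∀ x : A, TensorProduct.rid R A (ε.toLinearMap.lTensor A (Δ x)) = x
  ΔL_incl : ∀ x : A, ΔL (incl x) = incl.toLinearMap.lTensor A (Δ x)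
  ΔR_incl : ∀ x : A, ΔR (incl x) = incl.toLinearMap.rTensor A (Δ x)
  ΔL_coassoc : ∀ x : M, TensorProduct.assoc R A A M (Δ.toLinearMap.rTensor M (ΔL x)) =
    ΔL.toLinearMap.lTensor A (ΔL x)
  ΔR_coassoc : ∀ x : M, TensorProduct.assoc R M A A (ΔR.toLinearMap.rTensor A (ΔR x)) =
    Δ.toLinearMap.lTensor M (ΔR x)
  ΔL_counit : ∀ x : M, TensorProduct.lid R M (ε.toLinearMap.rTensor M (ΔL x)) = x
  ΔR_counit : ∀ x : M, TensorProduct.rid R M (ε.toLinearMap.lTensor M (ΔR x)) = x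
  ΔL_ΔR : ∀ x : M, TensorProduct.assoc R A M A (ΔL.toLinearMap.rTensor A (ΔR x)) =
    ΔR.toLinearMap.lTensor A (ΔL x)

/-- `Δ(T) = T ⊗ T` and `ε(T) = 1`. -/
structure IsMatrixCoproduct {R A : Type*} [CommRing R] [Ring A] [Algebra R A] (t : TGen → A)
    (Δ : A →ₐ[R] A ⊗[R] A) (ε : A →ₐ[R] R) : Prop where
  Δa : Δ (t .a) = t .a ⊗ₜ t .a + t .b ⊗ₜ t .c
  Δb : Δ (t .b) = t .a ⊗ₜ t .b + t .b ⊗ₜ t .d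
  Δc : Δ (t .c) = t .c ⊗ₜ t .a + t .d ⊗ₜ t .c
  Δd : Δ (t .d) = t .c ⊗ₜ t .b + t .d ⊗ₜ t .d
  εa : ε (t .a) = 1
  εb : ε (t .b) = 0
  εc : ε (t .c) = 0
  εd : ε (t .d) = 1

section

variable {k : Type*} [Field k]

/-- The values of the classical comultiplications on the generators. -/
structure IsClassical (C : Comultiplications k (A k) (M k) (inclA k)) : Prop where
  matrix : IsMatrixCoproduct (tA k) C.Δ C.ε
  right : ∀ i, C.ΔR (θM k i) = θM k i ⊗ₜ 1
  left0 : C.ΔL (θM k 0) = (1 + (2 : k) • (tA k .b * tA k .c)) ⊗ₜ θM k 0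
    - (tA k .a * tA k .c) ⊗ₜ θM k 1 + (tA k .b * tA k .d) ⊗ₜ θM k 2
  left1 : C.ΔL (θM k 1) = -(((2 : k) • (tA k .a * tA k .b)) ⊗ₜ θM k 0)
    + (tA k .a ^ 2) ⊗ₜ θM k 1 - (tA k .b ^ 2) ⊗ₜ θM k 2
  left2 : C.ΔL (θM k 2) = ((2 : k) • (tA k .c * tA k .d)) ⊗ₜ θM k 0
    - (tA k .c ^ 2) ⊗ₜ θM k 1 + (tA k .d ^ 2) ⊗ₜ θM k 2

/-- The values of the quantum comultiplications on the generators. -/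
structure IsQuantum [CharZero k] {τ : Kind}
    (Q : Comultiplications k⟦X⟧ (Aq k) (Mq k τ) (inclAq k τ)) : Prop where
  matrix : IsMatrixCoproduct (tAq k) Q.Δ Q.ε
  right : ∀ i, Q.ΔR (θMq k τ i) = θMq k τ i ⊗ₜ 1
  left0 : Q.ΔL (θMq k τ 0) =
    (tAq k .a * tAq k .d + (q k)⁻¹ • (tAq k .b * tAq k .c)) ⊗ₜ θMq k τ 0
    - (q k • (tAq k .a * tAq k .c)) ⊗ₜ θMq k τ 1 + (tAq k .b * tAq k .d) ⊗ₜ θMq k τ 2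
  left1 : Q.ΔL (θMq k τ 1) =
    -(((lam k * (q k)⁻¹) • (tAq k .b * tAq k .a)) ⊗ₜ θMq k τ 0)
    + (tAq k .a ^ 2) ⊗ₜ θMq k τ 1 - ((q k)⁻¹ • tAq k .b ^ 2) ⊗ₜ θMq k τ 2
  left2 : Q.ΔL (θMq k τ 2) = (lam k • (tAq k .d * tAq k .c)) ⊗ₜ θMq k τ 0
    - (q k • tAq k .c ^ 2) ⊗ₜ θMq k τ 1 + (tAq k .d ^ 2) ⊗ₜ θMq k τ 2

/-! ### Graded Poisson–Lie structures on `M` -/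

/-- A graded Poisson bracket on `M`. -/
structure IsGradedPoisson (br : M k →ₗ[k] M k →ₗ[k] M k) : Prop where
  degree : ∀ p r, ∀ x ∈ parityPart k (gM k) p, ∀ y ∈ parityPart k (gM k) r,
    br x y ∈ parityPart k (gM k) (p + r)
  symm : ∀ p r, ∀ x ∈ parityPart k (gM k) p, ∀ y ∈ parityPart k (gM k) r,
    br x y = -(koszul p r • br y x)
  leibniz : ∀ r s, ∀ x : M k, ∀ y ∈ parityPart k (gM k) r, ∀ z ∈ parityPart k (gM k) s,
    br (x * y) z = x * br y z + koszul r s • (br x z * y)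
  jacobi : ∀ p r s, ∀ x ∈ parityPart k (gM k) p, ∀ y ∈ parityPart k (gM k) r,
    ∀ z ∈ parityPart k (gM k) s,
    koszul p s • br (br x y) z + koszul r s • br (br z x) y + koszul p r • br (br y z) x = 0

/-- `B` is the extension of the bracket `br` to `M ⊗ M`. -/
def IsTensorBracket (br : M k →ₗ[k] M k →ₗ[k] M k)
    (B : M k ⊗[k] M k →ₗ[k] M k ⊗[k] M k →ₗ[k] M k ⊗[k] M k) : Prop :=
  ∀ p r, ∀ x : M k, ∀ y ∈ parityPart k (gM k) p, ∀ z ∈ parityPart k (gM k) r, ∀ w : M k,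
    B (x ⊗ₜ y) (z ⊗ₜ w) = koszul p r • (br x z ⊗ₜ (y * w) + (x * z) ⊗ₜ br y w)

/-- A graded Poisson–Lie structure: a graded Poisson bracket which restricts to a bracket on `A`
compatible with `Δ`, and which is covariant under `ΔL` and `ΔR`. Here `A ⊗ A`, `A ⊗ M` and `M ⊗ A`
are mapped to `M ⊗ M` through `A → M`. -/
structure IsGradedPoissonLie (C : Comultiplications k (A k) (M k) (inclA k))
    (br : M k →ₗ[k] M k →ₗ[k] M k) : Prop where
  poisson : IsGradedPoisson br
  covariant : ∃ B, IsTensorBracket br B ∧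
    (∀ f g : A k, ∃ e : A k, inclA k e = br (inclA k f) (inclA k g) ∧
      TensorProduct.map (inclA k).toLinearMap (inclA k).toLinearMap (C.Δ e) =
        B (TensorProduct.map (inclA k).toLinearMap (inclA k).toLinearMap (C.Δ f))
          (TensorProduct.map (inclA k).toLinearMap (inclA k).toLinearMap (C.Δ g))) ∧
    (∀ x y : M k, (inclA k).toLinearMap.rTensor (M k) (C.ΔL (br x y)) =
      B ((inclA k).toLinearMap.rTensor (M k) (C.ΔL x))
        ((inclA k).toLinearMap.rTensor (M k) (C.ΔL y))) ∧
    (∀ x y : M k, (inclA k).toLinearMap.lTensor (M k) (C.ΔR (br x y)) =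
      B ((inclA k).toLinearMap.lTensor (M k) (C.ΔR x))
        ((inclA k).toLinearMap.lTensor (M k) (C.ΔR y)))

/-- The brackets `{θⁱ, x}` of type I and II with a matrix entry `x`; for a given `x` the three entries
are those for `i = 0, 1, 2`. -/
def crossBracket (k : Type*) [Field k] : Kind → TGen → Fin 3 → M k
  | .I, .a => ![-((2 : k) • (tM k .c * θM k 1)), tM k .a * θM k 1,
                (4 : k) • (tM k .c * θM k 0) - tM k .a * θM k 2]
  | .I, .b => ![-((2 : k) • (tM k .d * θM k 1)), tM k .b * θM k 1,
                (4 : k) • (tM k .d * θM k 0) - tM k .b * θM k 2]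
  | .I, .c => ![0, -(tM k .c * θM k 1), tM k .c * θM k 2]
  | .I, .d => ![0, -(tM k .d * θM k 1), tM k .d * θM k 2]
  | .II, .a => ![0, -(tM k .a * θM k 1), tM k .a * θM k 2]
  | .II, .b => ![0, -(tM k .b * θM k 1), tM k .b * θM k 2]
  | .II, .c => ![-((2 : k) • (tM k .a * θM k 2)),
                 (4 : k) • (tM k .a * θM k 0) + tM k .c * θM k 1, -(tM k .c * θM k 2)]
  | .II, .d => ![-((2 : k) • (tM k .b * θM k 2)),
                 (4 : k) • (tM k .b * θM k 0) + tM k .d * θM k 1, -(tM k .d * θM k 2)]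

/-- The values of the bracket of type `τ` on the generators: the Sklyanin bracket, the brackets
`{θⁱ, x}` and the brackets `{θⁱ, θʲ}`. -/
structure HasBracketValues (τ : Kind) (br : M k →ₗ[k] M k →ₗ[k] M k) : Prop where
  ab : br (tM k .a) (tM k .b) = -(tM k .a * tM k .b)
  ac : br (tM k .a) (tM k .c) = -(tM k .a * tM k .c)
  bd : br (tM k .b) (tM k .d) = -(tM k .b * tM k .d)
  cd : br (tM k .c) (tM k .d) = -(tM k .c * tM k .d)
  cb : br (tM k .c) (tM k .b) = 0
  ad : br (tM k .a) (tM k .d) = -((2 : k) • (tM k .b * tM k .c))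
  cross : ∀ i x, br (θM k i) (tM k x) = crossBracket k τ x i
  θ00 : br (θM k 0) (θM k 0) = -((2 : k) • (θM k 1 * θM k 2))
  θ01 : br (θM k 0) (θM k 1) = -((2 : k) • (θM k 0 * θM k 1))
  θ02 : br (θM k 0) (θM k 2) = (2 : k) • (θM k 0 * θM k 2)
  θ11 : br (θM k 1) (θM k 1) = 0
  θ12 : br (θM k 1) (θM k 2) = 0
  θ22 : br (θM k 2) (θM k 2) = 0

/-! ### Quantization -/

/-- A `k`-algebra `B` is the reduction modulo `h` of a `k[[h]]`-algebra `Bh`: `π` is a surjective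
ring homomorphism, semilinear over `h ↦ 0`, with kernel `h Bh`, so that it induces
`Bh / h Bh ≅ B`. -/
structure IsReduction {Bh B : Type*} [Ring Bh] [Algebra k⟦X⟧ Bh] [Ring B] [Algebra k B]
    (π : Bh →ₛₗ[(PowerSeries.constantCoeff : k⟦X⟧ →+* k)] B) : Prop where
  map_one : π 1 = 1
  map_mul : ∀ x y, π (x * y) = π x * π y
  surjective : Function.Surjective π
  ker : ∀ x, π x = 0 ↔ ∃ y, x = (PowerSeries.X : k⟦X⟧) • y

/-- `Mq` with the comultiplications `Q` is a quantization of `M` with the comultiplications `C` and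
the bracket `br`:
* `Mq` is a free `k[[h]]`-module;
* `Mq / h Mq ≅ M` (and `Aq / h Aq ≅ A`) as algebras, generators corresponding to generators, and
  the comultiplications of `Q` reduce to those of `C`;
* for homogeneous `x, y` in `Mq` the graded commutator `[x, y]` is divisible by `h`, and
  `[x, y] / h` reduces modulo `h` to the bracket of the reductions of `x` and `y`. -/
structure IsQuantization [CharZero k] {τ : Kind}
    (C : Comultiplications k (A k) (M k) (inclA k)) (br : M k →ₗ[k] M k →ₗ[k] M k)
    (Q : Comultiplications k⟦X⟧ (Aq k) (Mq k τ) (inclAq k τ)) : Prop where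
  free : Module.Free k⟦X⟧ (Mq k τ)
  limit : ∃ (πA : Aq k →ₛₗ[(PowerSeries.constantCoeff : k⟦X⟧ →+* k)] A k)
      (π : Mq k τ →ₛₗ[(PowerSeries.constantCoeff : k⟦X⟧ →+* k)] M k),
    IsReduction πA ∧ IsReduction π ∧
    (∀ x, πA (tAq k x) = tA k x) ∧ (∀ s, π (gMq k τ s) = gM k s) ∧
    (∀ x, TensorProduct.map πA πA (Q.Δ x) = C.Δ (πA x)) ∧
    (∀ x, PowerSeries.constantCoeff (Q.ε x) = C.ε (πA x)) ∧
    (∀ x, TensorProduct.map πA π (Q.ΔL x) = C.ΔL (π x)) ∧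
    (∀ x, TensorProduct.map π πA (Q.ΔR x) = C.ΔR (π x)) ∧
    (∀ p r, ∀ x ∈ parityPart k⟦X⟧ (gMq k τ) p, ∀ y ∈ parityPart k⟦X⟧ (gMq k τ) r,
      ∃ w, x * y - koszul p r • (y * x) = (PowerSeries.X : k⟦X⟧) • w ∧ π w = br (π x) (π y))

end

end SLForms

end

noncomputable section

namespace SLForms

set_option linter.unusedSimpArgs false

universe u

/-! ### Relations of quantum matrices and one-forms -/

section

/-! Checking the Jacobi identity and Poisson–Lie covariance directly on the classical brackets is
avoided: the bracket is defined as the semiclassical limit of `Mq`, and its properties are inherited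
from associativity and from the quantum comultiplications. If `Mq` has no `h`-torsion and `Mq / h
Mq` is the supercommutative algebra `M`, then every graded commutator in `Mq` is uniquely divisible
by `h`, and reducing the quotient gives a bilinear bracket on `M`. Graded antisymmetry, the Leibniz
rule and the super Jacobi identity are identities in any associative algebra once multiplied by `h`
or `h²`, which can be cancelled (`Deformation.bracket_symm`, `Deformation.bracket_leibniz`,
`Deformation.bracket_jacobi`). An algebra homomorphism that respects parity carries commutators to
commutators, so the limits of the quantum coactions respect the bracket
(`Deformation.bracket_covariant`). The prescribed values are the linear coefficients in `h` of the
defining relations, with `q = 1 - h + …` and `μ = -2h + …`; they determine the bracket by the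
Leibniz rule and antisymmetry (`HasBracketValues.unique`).

Flatness comes from explicit regular representations. The relations allow every word to be put in a
normal order; operators on the free module with the ordered monomials as basis are shown to satisfy
the same relations, and acting on the vector `1` inverts the map from that module to the algebra.
This gives `Aq` the basis `bⁱ cʲ aⁿ`, `bⁱ cʲ dⁿ` (`Presents.free_fun`) and makes `Mq` a free left
`Aq`-module of rank `8` (`Presents.nonempty_equiv_ext`).

The algebras enter only through their universal property `Presents`. Classical and quantum cases are
treated together over a ring with parameter `q`, the classical case being `q = 1`. Comultiplications
exist because `T ⊗ T` and the transformed `θ`'s satisfy the relations again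
(`exists_comultiplications`), and `Mq / h Mq ≅ M` because both sides solve the same universal
problem among algebras on which `h` acts by zero (`Presents.exists_reduction`). Such identities,
like the centrality of the determinant, are verified by rewriting into normal order and comparing
coefficients, which leaves scalar identities in `q`, `q⁻¹` and `(q + q⁻¹)⁻¹`. -/

/-- Parameters of the deformation over a commutative ring: a unit `q` with inverse `qi`, such that
`q + qi` is invertible with inverse `li`. -/
structure QParam (R : Type*) [CommRing R] where
  q : R
  qi : R
  li : R
  q_mul : q * qi = 1
  l_mul : (q + qi) * li = 1

/-- `μ = q - q⁻¹`. -/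
def QParam.mu {R : Type*} [CommRing R] (P : QParam R) : R := P.q - P.qi

/-- `λ = q + q⁻¹`. -/
def QParam.lam {R : Type*} [CommRing R] (P : QParam R) : R := P.q + P.qi

section Relations

variable {R : Type*} [CommRing R] (P : QParam R) {B : Type*} [Ring B] [Algebra R B]

/-- The relations of quantum `2 × 2` matrices. -/
structure MatRels (t : TGen → B) : Prop where
  ab : t .a * t .b = P.q • (t .b * t .a)
  ac : t .a * t .c = P.q • (t .c * t .a)
  ad : t .a * t .d - t .d * t .a = P.mu • (t .b * t .c)
  bc : t .b * t .c = t .c * t .b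
  cd : t .c * t .d = P.q • (t .d * t .c)
  bd : t .b * t .d = P.q • (t .d * t .b)

/-- The relations of quantum `2 × 2` matrices of quantum determinant `1`. -/
structure SLRels (t : TGen → B) : Prop extends MatRels P t where
  det : t .a * t .d - P.q • (t .b * t .c) = 1

/-- The right-hand side of the relation `θⁱ x = …` for a matrix entry `x`. -/
def crossVal (t : TGen → B) (θ : Fin 3 → B) : Kind → TGen → Fin 3 → B
  | .I, .a => ![t .a * θ 0 + (P.q ^ 2 * P.mu) • (t .c * θ 1), P.qi • (t .a * θ 1),
                P.q • (t .a * θ 2) - (P.mu * P.lam) • (t .c * θ 0)]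
  | .I, .b => ![t .b * θ 0 + (P.q ^ 2 * P.mu) • (t .d * θ 1), P.qi • (t .b * θ 1),
                P.q • (t .b * θ 2) - (P.mu * P.lam) • (t .d * θ 0)]
  | .I, .c => ![t .c * θ 0, P.q • (t .c * θ 1), P.qi • (t .c * θ 2)]
  | .I, .d => ![t .d * θ 0, P.q • (t .d * θ 1), P.qi • (t .d * θ 2)]
  | .II, .a => ![t .a * θ 0, P.q • (t .a * θ 1), P.qi • (t .a * θ 2)]
  | .II, .b => ![t .b * θ 0, P.q • (t .b * θ 1), P.qi • (t .b * θ 2)]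
  | .II, .c => ![t .c * θ 0 + P.mu • (t .a * θ 2),
                 P.qi • (t .c * θ 1) - (P.mu * P.lam * P.qi ^ 2) • (t .a * θ 0),
                 P.q • (t .c * θ 2)]
  | .II, .d => ![t .d * θ 0 + P.mu • (t .b * θ 2),
                 P.qi • (t .d * θ 1) - (P.mu * P.lam * P.qi ^ 2) • (t .b * θ 0),
                 P.q • (t .d * θ 2)]

/-- The quadratic relations among the `θ`'s. -/
structure ThetaRels (θ : Fin 3 → B) : Prop where
  sq0 : θ 0 * θ 0 = (P.q ^ 2 * P.mu * P.li) • (θ 1 * θ 2)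
  sq1 : θ 1 * θ 1 = 0
  sq2 : θ 2 * θ 2 = 0
  r21 : θ 2 * θ 1 = -(θ 1 * θ 2)
  r10 : θ 1 * θ 0 = -(P.qi ^ 2 • (θ 0 * θ 1))
  r20 : θ 2 * θ 0 = -(P.q ^ 2 • (θ 0 * θ 2))

/-- The relations involving the `θ`'s. -/
structure FormsRels (τ : Kind) (t : TGen → B) (θ : Fin 3 → B) : Prop extends
    ThetaRels P θ where
  cross : ∀ i x, θ i * t x = crossVal P t θ τ x i

/-- The relation `x y = z` in a form that rewrites inside right-nested products. -/
theorem mul_mul_of_eq {x y z : B} (h : x * y = z) (w : B) : x * (y * w) = z * w := by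
  rw [← mul_assoc, h]

theorem QParam.eq_qi_smul {V : Type*} [AddCommGroup V] [Module R V] {x y : V} (h : x = P.q • y) :
    y = P.qi • x := by
  rw [h, smul_smul, mul_comm, P.q_mul, one_smul]

theorem MatRels.map {B' : Type*} [Ring B'] [Algebra R B'] (f : B →ₐ[R] B') {t : TGen → B}
    (h : MatRels P t) : MatRels P fun x => f (t x) where
  ab := by simpa using congrArg f h.ab
  ac := by simpa using congrArg f h.ac
  ad := by simpa using congrArg f h.ad
  bc := by simpa using congrArg f h.bc
  cd := by simpa using congrArg f h.cd
  bd := by simpa using congrArg f h.bd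

theorem SLRels.map {B' : Type*} [Ring B'] [Algebra R B'] (f : B →ₐ[R] B') {t : TGen → B}
    (h : SLRels P t) : SLRels P fun x => f (t x) where
  toMatRels := h.toMatRels.map P f
  det := by simpa using congrArg f h.det

theorem ThetaRels.map {B' : Type*} [Ring B'] [Algebra R B'] (f : B →ₐ[R] B') {θ : Fin 3 → B}
    (h : ThetaRels P θ) : ThetaRels P fun i => f (θ i) where
  sq0 := by simpa using congrArg f h.sq0
  sq1 := by simpa using congrArg f h.sq1
  sq2 := by simpa using congrArg f h.sq2
  r21 := by simpa using congrArg f h.r21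
  r10 := by simpa using congrArg f h.r10
  r20 := by simpa using congrArg f h.r20

theorem FormsRels.map {B' : Type*} [Ring B'] [Algebra R B'] (f : B →ₐ[R] B') {τ : Kind}
    {t : TGen → B} {θ : Fin 3 → B} (h : FormsRels P τ t θ) :
    FormsRels P τ (fun x => f (t x)) fun i => f (θ i) where
  toThetaRels := h.toThetaRels.map P f
  cross i x := by
    rw [← map_mul, h.cross]
    cases τ <;> cases x <;> fin_cases i <;> simp [crossVal]

variable {P}

namespace SLRels

variable {t : TGen → B}

theorem db (h : SLRels P t) : t .d * t .b = P.qi • (t .b * t .d) := P.eq_qi_smul h.bd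

theorem dc (h : SLRels P t) : t .d * t .c = P.qi • (t .c * t .d) := P.eq_qi_smul h.cd

theorem ad' (h : SLRels P t) : t .a * t .d = 1 + P.q • (t .b * t .c) := sub_eq_iff_eq_add.1 h.det

theorem da (h : SLRels P t) : t .d * t .a = 1 + P.qi • (t .b * t .c) := by
  have h1 := h.ad
  rw [h.ad'] at h1
  rw [← sub_sub_cancel (1 + P.q • (t .b * t .c)) (t .d * t .a), h1, QParam.mu, sub_smul]
  abel

end SLRels

/-- This is `T ⊗ T` for two commuting copies of the matrix algebra. The rules `R1`–`R7` and
`S1`–`S7` move `b`, then `c`, to the left and contract `ad` and `da`, while `hts` puts `t` before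
`s`. Both sides then become combinations of the same ordered words, so only coefficients need
comparing. -/
theorem SLRels.mul {t s : TGen → B} (ht : SLRels P t) (hs : SLRels P s)
    (hts : ∀ x y, s y * t x = t x * s y) (T : TGen → B)
    (Ta : T .a = t .a * s .a + t .b * s .c) (Tb : T .b = t .a * s .b + t .b * s .d)
    (Tc : T .c = t .c * s .a + t .d * s .c) (Td : T .d = t .c * s .b + t .d * s .d) :
    SLRels P T := by
  have hq := P.q_mul
  have R1 := ht.ab; have R2 := ht.ac; have R3 := ht.db; have R4 := ht.dc
  have R5 := ht.bc.symm; have R6 := ht.ad'; have R7 := ht.da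
  have S1 := hs.ab; have S2 := hs.ac; have S3 := hs.db; have S4 := hs.dc
  have S5 := hs.bc.symm; have S6 := hs.ad'; have S7 := hs.da
  have hts' := fun x y => mul_mul_of_eq (hts x y)
  refine ⟨⟨?_, ?_, ?_, ?_, ?_, ?_⟩, ?_⟩ <;>
  simp only [Ta, Tb, Tc, Td, mul_add, add_mul, mul_assoc, hts, hts', R1, R2, R3, R4, R5, R6, R7,
    mul_mul_of_eq R1, mul_mul_of_eq R2, mul_mul_of_eq R3, mul_mul_of_eq R4, mul_mul_of_eq R5,
    mul_mul_of_eq R6, mul_mul_of_eq R7, S1, S2, S3, S4, S5, S6, S7, mul_mul_of_eq S1,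
    mul_mul_of_eq S2, mul_mul_of_eq S3, mul_mul_of_eq S4, mul_mul_of_eq S5, mul_mul_of_eq S6,
    mul_mul_of_eq S7, smul_mul_assoc, mul_smul_comm, one_mul, mul_one, smul_add] <;>
  match_scalars <;> grind [QParam.mu]

/-- `Θ` is the result of the left coaction on `θ`. -/
structure IsLeftCoaction (P : QParam R) (t : TGen → B) (θ Θ : Fin 3 → B) : Prop where
  e0 : Θ 0 = (t .a * t .d + P.qi • (t .b * t .c)) * θ 0 - (P.q • (t .a * t .c)) * θ 1
    + t .b * t .d * θ 2
  e1 : Θ 1 = -(((P.lam * P.qi) • (t .b * t .a)) * θ 0) + t .a ^ 2 * θ 1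
    - (P.qi • t .b ^ 2) * θ 2
  e2 : Θ 2 = (P.lam • (t .d * t .c)) * θ 0 - (P.q • t .c ^ 2) * θ 1 + t .d ^ 2 * θ 2

/-- The quadratic relations are stable under the coaction on `θ ⊗ θ`. The relations for `θ` leave
only `θ⁰θ¹`, `θ⁰θ²`, `θ¹θ²`, and the coefficients in the matrix entries are compared in normal
order. The invertibility of `q + q⁻¹` enters through the value of `(θ⁰)²`. -/
theorem ThetaRels.coaction {t : TGen → B} {θ Θ : Fin 3 → B} (ht : SLRels P t)
    (hθ : ThetaRels P θ) (hθt : ∀ i x, θ i * t x = t x * θ i)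
    (hΘ : IsLeftCoaction P t θ Θ) : ThetaRels P Θ := by
  have hq := P.q_mul
  have hl := P.l_mul
  have R1 := ht.ab; have R2 := ht.ac; have R3 := ht.db; have R4 := ht.dc
  have R5 := ht.bc.symm; have R6 := ht.ad'; have R7 := ht.da
  obtain ⟨S1, S2, S3, S4, S5, S6⟩ := hθ
  have hθt' := fun i x => mul_mul_of_eq (hθt i x)
  obtain ⟨e0, e1, e2⟩ := hΘ
  refine ⟨?_, ?_, ?_, ?_, ?_, ?_⟩ <;>
  simp only [e0, e1, e2, mul_add, add_mul, mul_sub, sub_mul, neg_mul, mul_neg, mul_assoc, hθt, hθt',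
    pow_two (t _), R1, R2, R3, R4, R5, R6, R7,
    mul_mul_of_eq R1, mul_mul_of_eq R2, mul_mul_of_eq R3, mul_mul_of_eq R4, mul_mul_of_eq R5,
    mul_mul_of_eq R6, mul_mul_of_eq R7, S1, S2, S3, S4, S5, S6, smul_mul_assoc, mul_smul_comm,
    one_mul, mul_one, smul_add, mul_zero, zero_mul] <;>
  match_scalars <;> grind [QParam.mu, QParam.lam]

-- As `t` commutes with both `s` and `θ`, every product separates into a word in `t` times a word in
-- `s` and `θ`. The known cross relations apply to the latter, the normal order of quantum matrices
-- to the former.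
set_option maxHeartbeats 1600000 in
theorem FormsRels.coaction {τ : Kind} {t s T : TGen → B} {θ Θ : Fin 3 → B} (ht : SLRels P t)
    (hθ : FormsRels P τ s θ) (hts : ∀ x y, s y * t x = t x * s y)
    (hθt : ∀ i x, θ i * t x = t x * θ i)
    (Ta : T .a = t .a * s .a + t .b * s .c) (Tb : T .b = t .a * s .b + t .b * s .d)
    (Tc : T .c = t .c * s .a + t .d * s .c) (Td : T .d = t .c * s .b + t .d * s .d)
    (hΘ : IsLeftCoaction P t θ Θ) : FormsRels P τ T Θ := by
  refine ⟨hθ.toThetaRels.coaction ht hθt hΘ, ?_⟩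
  have hq := P.q_mul
  have R1 := ht.ab; have R2 := ht.ac; have R3 := ht.db; have R4 := ht.dc
  have R5 := ht.bc.symm; have R6 := ht.ad'; have R7 := ht.da
  have hts' := fun x y => mul_mul_of_eq (hts x y)
  have hθt' := fun i x => mul_mul_of_eq (hθt i x)
  have hc := hθ.cross
  obtain ⟨e0, e1, e2⟩ := hΘ
  intro i x
  cases τ <;> cases x <;> fin_cases i <;>
  simp only [e0, e1, e2, Ta, Tb, Tc, Td, hc, crossVal, Fin.zero_eta, Fin.mk_one, Fin.reduceFinMk,
    Matrix.cons_val, mul_add, add_mul, mul_sub, sub_mul, neg_mul, mul_neg, mul_assoc, hθt, hθt',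
    hts, hts', pow_two (t _), R1, R2, R3, R4, R5, R6, R7,
    mul_mul_of_eq R1, mul_mul_of_eq R2, mul_mul_of_eq R3, mul_mul_of_eq R4, mul_mul_of_eq R5,
    mul_mul_of_eq R6, mul_mul_of_eq R7, smul_mul_assoc, mul_smul_comm,
    one_mul, mul_one, smul_add, smul_sub] <;>
  match_scalars <;> grind [QParam.mu, QParam.lam]

/-- The cross relations are linear in the matrix entries and have the same form for both columns
`(a, c)` and `(b, d)`. Right multiplication by `s` only forms combinations of columns, with
coefficients commuting with `θ`, so linearity suffices. -/
theorem FormsRels.rightCoaction {τ : Kind} {t s T : TGen → B} {θ : Fin 3 → B}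
    (hθ : FormsRels P τ t θ)
    (hθs : ∀ i x, s x * θ i = θ i * s x)
    (Ta : T .a = t .a * s .a + t .b * s .c) (Tb : T .b = t .a * s .b + t .b * s .d)
    (Tc : T .c = t .c * s .a + t .d * s .c) (Td : T .d = t .c * s .b + t .d * s .d) :
    FormsRels P τ T θ := by
  refine ⟨hθ.toThetaRels, ?_⟩
  have hc := hθ.cross
  have hc' := fun i x => mul_mul_of_eq (hc i x)
  intro i x
  cases τ <;> cases x <;> fin_cases i <;>
  simp only [Ta, Tb, Tc, Td, hc', crossVal, Fin.zero_eta, Fin.mk_one, Fin.reduceFinMk,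
    Matrix.cons_val, mul_add, add_mul, sub_mul, mul_assoc, hθs,
    smul_mul_assoc, smul_add] <;>
  module

end Relations

end

/-! ### Composition of left coactions -/

section

section Relations
variable {R : Type*} [CommRing R] {P : QParam R} {B : Type*} [Ring B] [Algebra R B]

theorem IsLeftCoaction.map {B' : Type*} [Ring B'] [Algebra R B'] (f : B →ₐ[R] B')
    {t : TGen → B} {θ Θ : Fin 3 → B} (h : IsLeftCoaction P t θ Θ) :
    IsLeftCoaction P (fun x => f (t x)) (fun i => f (θ i)) fun i => f (Θ i) where
  e0 := by simpa using congrArg f h.e0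
  e1 := by simpa using congrArg f h.e1
  e2 := by simpa using congrArg f h.e2

theorem IsLeftCoaction.unique {t : TGen → B} {θ Θ Θ' : Fin 3 → B}
    (h : IsLeftCoaction P t θ Θ) (h' : IsLeftCoaction P t θ Θ') : Θ = Θ' := by
  ext i
  fin_cases i
  · exact h.e0.trans h'.e0.symm
  · exact h.e1.trans h'.e1.symm
  · exact h.e2.trans h'.e2.symm

/-- The coefficients of the coaction form a matrix corepresentation: the `3 × 3` matrix built from a
product of commuting quantum matrices is the product of the two `3 × 3` matrices. This is the
coassociativity of `ΔL` on the `θ`'s. -/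
theorem IsLeftCoaction.comp {t s T : TGen → B} {θ Θ Θ' : Fin 3 → B} (ht : SLRels P t)
    (hs : SLRels P s) (hts : ∀ x y, s y * t x = t x * s y)
    (Ta : T .a = t .a * s .a + t .b * s .c) (Tb : T .b = t .a * s .b + t .b * s .d)
    (Tc : T .c = t .c * s .a + t .d * s .c) (Td : T .d = t .c * s .b + t .d * s .d)
    (h' : IsLeftCoaction P s θ Θ') (h : IsLeftCoaction P t Θ' Θ) : IsLeftCoaction P T θ Θ := by
  have hq := P.q_mul
  have R1 := ht.ab; have R2 := ht.ac; have R3 := ht.db; have R4 := ht.dc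
  have R5 := ht.bc.symm; have R6 := ht.ad'; have R7 := ht.da
  have S1 := hs.ab; have S2 := hs.ac; have S3 := hs.db; have S4 := hs.dc
  have S5 := hs.bc.symm; have S6 := hs.ad'; have S7 := hs.da
  have hts' := fun x y => mul_mul_of_eq (hts x y)
  obtain ⟨e0, e1, e2⟩ := h
  obtain ⟨d0, d1, d2⟩ := h'
  refine ⟨?_, ?_, ?_⟩ <;>
  simp only [e0, e1, e2, d0, d1, d2, Ta, Tb, Tc, Td, mul_add, add_mul, mul_sub, sub_mul, neg_mul,
    mul_neg, mul_assoc, hts, hts', pow_two (t _), pow_two (s _), pow_two (_ + _),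
    R1, R2, R3, R4, R5, R6, R7,
    mul_mul_of_eq R1, mul_mul_of_eq R2, mul_mul_of_eq R3, mul_mul_of_eq R4, mul_mul_of_eq R5,
    mul_mul_of_eq R6, mul_mul_of_eq R7, S1, S2, S3, S4, S5, S6, S7, mul_mul_of_eq S1,
    mul_mul_of_eq S2, mul_mul_of_eq S3, mul_mul_of_eq S4, mul_mul_of_eq S5, mul_mul_of_eq S6,
    mul_mul_of_eq S7, smul_mul_assoc, mul_smul_comm, one_mul, mul_one, smul_add, smul_sub] <;>
  match_scalars <;> grind [QParam.mu, QParam.lam]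

end Relations

end

/-! ### Presentations and comultiplications -/

section

section Presentation

/-- The algebra `X` is presented by generators `g` and the relations `Rel`. -/
structure Presents (R : Type u) [CommRing R] {ι : Type}
    (Rel : ∀ (B : Type u) [Ring B] [Algebra R B], (ι → B) → Prop) (X : Type u) [Ring X]
    [Algebra R X] (g : ι → X) : Prop where
  rel : Rel X g
  lift : ∀ (B : Type u) [Ring B] [Algebra R B] (t : ι → B), Rel B t →
    ∃ f : X →ₐ[R] B, ∀ s, f (g s) = t s
  gen : Algebra.adjoin R (Set.range g) = ⊤

variable {R : Type u} [CommRing R]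

theorem Presents.hom_ext {ι : Type}
    {Rel : ∀ (B : Type u) [Ring B] [Algebra R B], (ι → B) → Prop} {X : Type u} [Ring X]
    [Algebra R X] {g : ι → X} (h : Presents R Rel X g) {B : Type*} [Semiring B] [Algebra R B]
    {f₁ f₂ : X →ₐ[R] B} (hf : ∀ s, f₁ (g s) = f₂ (g s)) : f₁ = f₂ :=
  AlgHom.ext_of_adjoin_eq_top h.gen (by rintro _ ⟨s, rfl⟩; exact hf s)

variable (P : QParam R)

/-- The relations of the function algebra. -/
def FunRel (B : Type u) [Ring B] [Algebra R B] (t : TGen → B) : Prop := SLRels P t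

/-- The relations of the external algebra. -/
def ExtRel (τ : Kind) (B : Type u) [Ring B] [Algebra R B] (g : Gen → B) : Prop :=
  SLRels P (fun x => g (.t x)) ∧ FormsRels P τ (fun x => g (.t x)) fun i => g (.θ i)

variable {P} {τ : Kind} {A M : Type u} [Ring A] [Algebra R A] [Ring M] [Algebra R M]
  {t : TGen → A} {g : Gen → M}

/-- `Δ(T) = T ⊗ T` for elements of an arbitrary tensor product. -/
def matTensor {A B : Type*} [Ring A] [Algebra R A] [Ring B] [Algebra R B] (t : TGen → A)
    (s : TGen → B) : TGen → A ⊗[R] B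
  | .a => t .a ⊗ₜ s .a + t .b ⊗ₜ s .c
  | .b => t .a ⊗ₜ s .b + t .b ⊗ₜ s .d
  | .c => t .c ⊗ₜ s .a + t .d ⊗ₜ s .c
  | .d => t .c ⊗ₜ s .b + t .d ⊗ₜ s .d

/-- The counit on the matrix entries. -/
def matOne : TGen → R
  | .a => 1
  | .b => 0
  | .c => 0
  | .d => 1

variable (P) in
/-- The left coaction on the `θ`'s. -/
def thetaTensor (t : TGen → A) (θ : Fin 3 → M) : Fin 3 → A ⊗[R] M :=
  ![(t .a * t .d + P.qi • (t .b * t .c)) ⊗ₜ θ 0 - (P.q • (t .a * t .c)) ⊗ₜ θ 1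
      + (t .b * t .d) ⊗ₜ θ 2,
    -(((P.lam * P.qi) • (t .b * t .a)) ⊗ₜ θ 0) + (t .a ^ 2) ⊗ₜ θ 1
      - (P.qi • t .b ^ 2) ⊗ₜ θ 2,
    (P.lam • (t .d * t .c)) ⊗ₜ θ 0 - (P.q • t .c ^ 2) ⊗ₜ θ 1 + (t .d ^ 2) ⊗ₜ θ 2]

theorem SLRels.matTensor {A B : Type*} [Ring A] [Algebra R A] [Ring B] [Algebra R B]
    {t : TGen → A} {s : TGen → B} (ht : SLRels P t) (hs : SLRels P s) :
    SLRels P (matTensor (R := R) t s) := by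
  refine (ht.map P (Algebra.TensorProduct.includeLeft (S := R) (B := B))).mul
    (hs.map P (Algebra.TensorProduct.includeRight (A := A))) ?_ _ ?_ ?_ ?_ ?_ <;>
  intros <;> simp [SLForms.matTensor]

theorem SLRels.matOne : SLRels P (matOne (R := R)) := by
  constructor
  · constructor <;> simp [SLForms.matOne]
  · simp [SLForms.matOne]

theorem IsLeftCoaction.thetaTensor (t : TGen → A) (θ : Fin 3 → M) :
    IsLeftCoaction P (fun x => Algebra.TensorProduct.includeLeft (R := R) (S := R) (B := M) (t x))
      (fun i => Algebra.TensorProduct.includeRight (R := R) (A := A) (θ i))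
      (thetaTensor P t θ) := by
  constructor <;>
  simp [SLForms.thetaTensor, add_mul, ← TensorProduct.smul_tmul', TensorProduct.add_tmul]

theorem FormsRels.thetaTensor {t : TGen → A} {s : TGen → M} {θ : Fin 3 → M} (ht : SLRels P t)
    (hθ : FormsRels P τ s θ) : FormsRels P τ (matTensor (R := R) t s) (thetaTensor P t θ) := by
  refine FormsRels.coaction (ht.map P (Algebra.TensorProduct.includeLeft (S := R) (B := M)))
    (hθ.map P (Algebra.TensorProduct.includeRight (A := A))) ?_ ?_ ?_ ?_ ?_ ?_
    (IsLeftCoaction.thetaTensor t θ) <;>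
  intros <;> simp [SLForms.matTensor]

theorem FormsRels.tmul_one {t : TGen → M} {s : TGen → A} {θ : Fin 3 → M}
    (hθ : FormsRels P τ t θ) :
    FormsRels P τ (matTensor (R := R) t s) fun i => θ i ⊗ₜ 1 := by
  refine FormsRels.rightCoaction (hθ.map P (Algebra.TensorProduct.includeLeft (S := R) (B := A)))
    (s := fun x => Algebra.TensorProduct.includeRight (A := M) (s x)) ?_ ?_ ?_ ?_ ?_ <;>
  intros <;> simp [SLForms.matTensor]

/-- The universal property supplies the four homomorphisms. Each bicomodule axiom equates two
algebra homomorphisms, so it need only hold on generators. -/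
theorem exists_comultiplications (hA : Presents R (FunRel P) A t)
    (hM : Presents R (ExtRel P τ) M g) (incl : A →ₐ[R] M) (hincl : ∀ x, incl (t x) = g (.t x)) :
    ∃ C : Comultiplications R A M incl, IsMatrixCoproduct t C.Δ C.ε ∧
      (∀ i, C.ΔR (g (.θ i)) = g (.θ i) ⊗ₜ 1) ∧
      ∀ i, C.ΔL (g (.θ i)) = thetaTensor P t (fun i => g (.θ i)) i := by
  have rA : SLRels P t := hA.rel
  have rM : SLRels P (fun x => g (.t x)) := hM.rel.1
  have fM := hM.rel.2
  obtain ⟨Δ, hΔ⟩ := hA.lift _ (matTensor t t) (rA.matTensor rA)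
  obtain ⟨ε, hε⟩ := hA.lift R matOne SLRels.matOne
  obtain ⟨ΔL, hL⟩ := hM.lift (A ⊗[R] M)
    (fun | .t x => matTensor t (fun x => g (.t x)) x
         | .θ i => thetaTensor P t (fun i => g (.θ i)) i)
    ⟨rA.matTensor rM, FormsRels.thetaTensor rA fM⟩
  obtain ⟨ΔR, hR⟩ := hM.lift (M ⊗[R] A)
    (fun | .t x => matTensor (fun x => g (.t x)) t x
         | .θ i => g (.θ i) ⊗ₜ 1)
    ⟨rM.matTensor rA, fM.tmul_one⟩
  have hLt := fun x => hL (.t x)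
  have hLθ := fun i => hL (.θ i)
  have hRt := fun x => hR (.t x)
  have hRθ := fun i => hR (.θ i)
  simp only at hLt hLθ hRt hRθ
  have L0 := hLθ 0; have L1 := hLθ 1; have L2 := hLθ 2
  simp only [thetaTensor, Matrix.cons_val] at L0 L1 L2
  refine ⟨{ Δ := Δ, ε := ε, ΔL := ΔL, ΔR := ΔR, coassoc := ?_, counit_left := ?_,
            counit_right := ?_, ΔL_incl := ?_, ΔR_incl := ?_, ΔL_coassoc := ?_, ΔR_coassoc := ?_,
            ΔL_counit := ?_, ΔR_counit := ?_, ΔL_ΔR := ?_ }, ?_, hRθ, hLθ⟩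
  · have e : ((Algebra.TensorProduct.assoc R R R A A A).toAlgHom.comp
        (Algebra.TensorProduct.map Δ (AlgHom.id R A))).comp Δ =
        (Algebra.TensorProduct.map (AlgHom.id R A) Δ).comp Δ := by
      refine hA.hom_ext fun x => ?_
      cases x <;> simp [hΔ, matTensor, TensorProduct.add_tmul, TensorProduct.tmul_add] <;> abel
    exact fun x => DFunLike.congr_fun e x
  · have e : ((Algebra.TensorProduct.lid R A).toAlgHom.comp
        (Algebra.TensorProduct.map ε (AlgHom.id R A))).comp Δ = AlgHom.id R A := by
      refine hA.hom_ext fun x => ?_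
      cases x <;> simp [hΔ, hε, matTensor, matOne]
    exact fun x => DFunLike.congr_fun e x
  · have e : ((Algebra.TensorProduct.rid R R A).toAlgHom.comp
        (Algebra.TensorProduct.map (AlgHom.id R A) ε)).comp Δ = AlgHom.id R A := by
      refine hA.hom_ext fun x => ?_
      cases x <;> simp [hΔ, hε, matTensor, matOne]
    exact fun x => DFunLike.congr_fun e x
  · have e : ΔL.comp incl = (Algebra.TensorProduct.map (AlgHom.id R A) incl).comp Δ := by
      refine hA.hom_ext fun x => ?_
      cases x <;> simp [hΔ, hincl, hLt, matTensor]
    exact fun x => DFunLike.congr_fun e x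
  · have e : ΔR.comp incl = (Algebra.TensorProduct.map incl (AlgHom.id R A)).comp Δ := by
      refine hA.hom_ext fun x => ?_
      cases x <;> simp [hΔ, hincl, hRt, matTensor]
    exact fun x => DFunLike.congr_fun e x
  · have e : ((Algebra.TensorProduct.assoc R R R A A M).toAlgHom.comp
        (Algebra.TensorProduct.map Δ (AlgHom.id R M))).comp ΔL =
        (Algebra.TensorProduct.map (AlgHom.id R A) ΔL).comp ΔL := by
      refine hM.hom_ext fun s => ?_
      obtain x | i := s
      · cases x <;> simp [hΔ, hLt, matTensor, TensorProduct.add_tmul, TensorProduct.tmul_add] <;>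
          abel
      -- Both sides are the coaction of the same matrix `Δ(T)` on `1 ⊗ 1 ⊗ θ`. Applying `Δ ⊗ id` to
      -- the defining formula gives this directly (`c₁`); applying `id ⊗ ΔL` gives two successive
      -- coactions (`c₃`, then `c₄`), which compose by `IsLeftCoaction.comp`.
      · have c := IsLeftCoaction.thetaTensor (P := P) t fun i => g (.θ i)
        rw [show thetaTensor P t _ = fun i => ΔL (g (.θ i)) from funext fun i => (hLθ i).symm] at c
        have c₁ := c.map ((Algebra.TensorProduct.assoc R R R A A M).toAlgHom.comp
          (Algebra.TensorProduct.map Δ (AlgHom.id R M)))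
        have c₂ := c.map (Algebra.TensorProduct.map (AlgHom.id R A) ΔL)
        have c₃ := c.map (Algebra.TensorProduct.includeRight (R := R) (A := A))
        have c₄ : IsLeftCoaction P (fun x => (t x ⊗ₜ[R] (1 : A ⊗[R] M)))
            (fun i => 1 ⊗ₜ ΔL (g (.θ i)))
            (fun i => Algebra.TensorProduct.map (AlgHom.id R A) ΔL (ΔL (g (.θ i)))) := by
          simpa using c₂
        have r₁ := rA.map P (Algebra.TensorProduct.includeLeft (R := R) (S := R) (B := A ⊗[R] M))
        have r₂ := (rA.map P (Algebra.TensorProduct.includeLeft (R := R) (S := R) (B := M))).map P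
          (Algebra.TensorProduct.includeRight (R := R) (A := A))
        refine congrFun (IsLeftCoaction.unique c₁ (IsLeftCoaction.comp r₁ r₂ ?_ ?_ ?_ ?_ ?_ ?_ c₄))
          i
        · intro x y; simp
        · simp [hΔ, matTensor, TensorProduct.add_tmul]
        · simp [hΔ, matTensor, TensorProduct.add_tmul]
        · simp [hΔ, matTensor, TensorProduct.add_tmul]
        · simp [hΔ, matTensor, TensorProduct.add_tmul]
        · simpa [Algebra.TensorProduct.one_def] using c₃
    exact fun x => DFunLike.congr_fun e x
  · have e : ((Algebra.TensorProduct.assoc R R R M A A).toAlgHom.comp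
        (Algebra.TensorProduct.map ΔR (AlgHom.id R A))).comp ΔR =
        (Algebra.TensorProduct.map (AlgHom.id R M) Δ).comp ΔR := by
      refine hM.hom_ext fun s => ?_
      obtain x | i := s
      · cases x <;> simp [hΔ, hRt, matTensor, TensorProduct.add_tmul, TensorProduct.tmul_add] <;>
          abel
      · simp [hRθ, Algebra.TensorProduct.one_def]
    exact fun x => DFunLike.congr_fun e x
  · have e : ((Algebra.TensorProduct.lid R M).toAlgHom.comp
        (Algebra.TensorProduct.map ε (AlgHom.id R M))).comp ΔL = AlgHom.id R M := by
      refine hM.hom_ext fun s => ?_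
      obtain x | i := s
      · cases x <;> simp [hε, hLt, matTensor, matOne]
      · fin_cases i <;> simp [hε, L0, L1, L2, matOne]
    exact fun x => DFunLike.congr_fun e x
  · have e : ((Algebra.TensorProduct.rid R R M).toAlgHom.comp
        (Algebra.TensorProduct.map (AlgHom.id R M) ε)).comp ΔR = AlgHom.id R M := by
      refine hM.hom_ext fun s => ?_
      obtain x | i := s
      · cases x <;> simp [hε, hRt, matTensor, matOne]
      · simp [hRθ]
    exact fun x => DFunLike.congr_fun e x
  · have e : ((Algebra.TensorProduct.assoc R R R A M A).toAlgHom.comp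
        (Algebra.TensorProduct.map ΔL (AlgHom.id R A))).comp ΔR =
        (Algebra.TensorProduct.map (AlgHom.id R A) ΔR).comp ΔL := by
      refine hM.hom_ext fun s => ?_
      obtain x | i := s
      · cases x <;> simp [hRt, hLt, matTensor, TensorProduct.add_tmul, TensorProduct.tmul_add] <;>
          abel
      · fin_cases i <;> simp [hRθ, L0, L1, L2, TensorProduct.add_tmul, TensorProduct.sub_tmul,
          TensorProduct.neg_tmul]
    exact fun x => DFunLike.congr_fun e x
  · constructor <;> simp [hΔ, hε, matTensor, matOne]

end Presentation

end

/-! ### The algebras as presented algebras -/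

section

theorem presents_ringQuot {R : Type u} [CommRing R] {ι : Type}
    (r : FreeAlgebra R ι → FreeAlgebra R ι → Prop)
    (Rel : ∀ (B : Type u) [Ring B] [Algebra R B], (ι → B) → Prop)
    (h₁ : Rel (RingQuot r) fun s => RingQuot.mkAlgHom R r (FreeAlgebra.ι R s))
    (h₂ : ∀ (B : Type u) [Ring B] [Algebra R B] (t : ι → B), Rel B t → ∀ x y, r x y →
      FreeAlgebra.lift R t x = FreeAlgebra.lift R t y) :
    Presents R Rel (RingQuot r) fun s => RingQuot.mkAlgHom R r (FreeAlgebra.ι R s) where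
  rel := h₁
  lift B _ _ t ht := ⟨RingQuot.liftAlgHom R ⟨FreeAlgebra.lift R t, h₂ B t ht⟩, fun s => by simp⟩
  gen := by
    have : Set.range (fun s => RingQuot.mkAlgHom R r (FreeAlgebra.ι R s)) =
        RingQuot.mkAlgHom R r '' Set.range (FreeAlgebra.ι R) := by
      rw [← Set.range_comp]; rfl
    rw [this, ← AlgHom.map_adjoin, FreeAlgebra.adjoin_range_ι, Algebra.map_top,
      AlgHom.range_eq_top]
    exact RingQuot.mkAlgHom_surjective R r

section Quantum

variable (k : Type u) [Field k] [CharZero k]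

theorem constantCoeff_q : PowerSeries.constantCoeff (q k) = 1 := by
  simp [q, PowerSeries.evalNegHom, PowerSeries.rescale]

theorem q_mul_inv : q k * (q k)⁻¹ = 1 :=
  PowerSeries.mul_inv_cancel _ (by simp [constantCoeff_q])

theorem constantCoeff_q_inv : PowerSeries.constantCoeff (q k)⁻¹ = 1 := by
  simp [constantCoeff_q]

theorem constantCoeff_lam : PowerSeries.constantCoeff (lam k) = 2 := by
  simp [lam, constantCoeff_q]; norm_num

/-- The parameters of the quantum algebras. -/
def qParam : QParam k⟦X⟧ where
  q := q k
  qi := (q k)⁻¹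
  li := (lam k)⁻¹
  q_mul := q_mul_inv k
  l_mul := PowerSeries.mul_inv_cancel (lam k) (by simp [constantCoeff_lam])

/-- The parameters of the classical algebras. -/
def oneParam : QParam k where
  q := 1
  qi := 1
  li := 2⁻¹
  q_mul := one_mul 1
  l_mul := by rw [one_add_one_eq_two]; exact mul_inv_cancel₀ two_ne_zero

/-! ### Inductive relations on words versus systems of equations -/

section Bridge

variable {B : Type*} [Ring B] [Algebra k⟦X⟧ B] {t : TGen → B} {θ : Fin 3 → B} {τ : Kind}

theorem crossRhs_eq (x : TGen) (i : Fin 3) :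
    crossRhs k t θ τ x i = crossVal (qParam k) t θ τ x i := by
  have : (q k ^ 2)⁻¹ = (q k)⁻¹ ^ 2 := by rw [pow_two, pow_two, PowerSeries.mul_inv_rev]
  cases τ <;> cases x <;> simp only [crossRhs, crossVal, this] <;> rfl

theorem glqRel_iff : (∀ x y, GLqRel k t x y → x = y) ↔ MatRels (qParam k) t := by
  constructor
  · intro h
    exact ⟨h _ _ .ab, h _ _ .ac, h _ _ .ad, h _ _ .bc, h _ _ .cd, h _ _ .bd⟩
  · rintro h _ _ (_ | _)
    exacts [h.ab, h.ac, h.ad, h.bc, h.cd, h.bd]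

theorem slqRel_iff : (∀ x y, SLqRel k t x y → x = y) ↔ SLRels (qParam k) t := by
  constructor
  · intro h
    exact ⟨(glqRel_iff k).1 fun _ _ hxy => h _ _ (.base hxy), h _ _ .det⟩
  · rintro h _ _ (hxy | _)
    exacts [(glqRel_iff k).2 h.toMatRels _ _ hxy, h.det]

theorem thetaRel_iff : (∀ x y, ThetaRel k θ x y → x = y) ↔ ThetaRels (qParam k) θ := by
  have e : (q k ^ 2)⁻¹ = (q k)⁻¹ ^ 2 := by rw [pow_two, pow_two, PowerSeries.mul_inv_rev]
  constructor
  · intro h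
    refine ⟨?_, ?_, ?_, ?_, ?_, ?_⟩
    · exact (pow_two (θ 0)).symm.trans (h _ _ .sq0)
    · exact (pow_two (θ 1)).symm.trans (h _ _ .sq1)
    · exact (pow_two (θ 2)).symm.trans (h _ _ .sq2)
    · rw [h _ _ .r12, neg_neg]
    · rw [h _ _ .r10, e]; rfl
    · exact h _ _ .r20
  · rintro h _ _ (_ | _)
    · exact (pow_two (θ 0)).trans h.sq0
    · exact (pow_two (θ 1)).trans h.sq1
    · exact (pow_two (θ 2)).trans h.sq2
    · rw [h.r21, neg_neg]
    · rw [h.r10, e]; rfl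
    · exact h.r20

theorem glFormsRel_iff : (∀ x y, GLFormsRel k t θ τ x y → x = y) ↔
    MatRels (qParam k) t ∧ FormsRels (qParam k) τ t θ := by
  constructor
  · intro h
    exact ⟨(glqRel_iff k).1 fun _ _ hxy => h _ _ (.tt hxy),
      (thetaRel_iff k).1 fun _ _ hxy => h _ _ (.θθ hxy),
      fun i x => (h _ _ (.cross i x)).trans (crossRhs_eq k x i)⟩
  · rintro ⟨h, h'⟩ _ _ (hxy | ⟨i, x⟩ | hxy)
    exacts [(glqRel_iff k).2 h _ _ hxy, (h'.cross i x).trans (crossRhs_eq k x i).symm,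
      (thetaRel_iff k).2 h'.toThetaRels _ _ hxy]

theorem slFormsRel_iff : (∀ x y, SLFormsRel k t θ τ x y → x = y) ↔
    SLRels (qParam k) t ∧ FormsRels (qParam k) τ t θ := by
  constructor
  · intro h
    obtain ⟨h₁, h₂⟩ := (glFormsRel_iff k).1 fun _ _ hxy => h _ _ (.base hxy)
    exact ⟨⟨h₁, h _ _ .det⟩, h₂⟩
  · rintro ⟨h, h'⟩ _ _ (hxy | _)
    exacts [(glFormsRel_iff k).2 ⟨h.toMatRels, h'⟩ _ _ hxy, h.det]

theorem GLqRel.map {B' : Type*} [Ring B'] [Algebra k⟦X⟧ B'] (f : B →ₐ[k⟦X⟧] B') {x y : B}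
    (h : GLqRel k t x y) : GLqRel k (fun s => f (t s)) (f x) (f y) := by
  cases h <;> simp only [map_mul, map_sub, map_smul]
  exacts [.ab, .ac, .ad, .bc, .cd, .bd]

theorem ThetaRel.map {B' : Type*} [Ring B'] [Algebra k⟦X⟧ B'] (f : B →ₐ[k⟦X⟧] B') {x y : B}
    (h : ThetaRel k θ x y) : ThetaRel k (fun s => f (θ s)) (f x) (f y) := by
  cases h <;> simp only [map_mul, map_neg, map_pow, map_smul, map_zero]
  exacts [.sq0, .sq1, .sq2, .r12, .r10, .r20]

theorem GLFormsRel.map {B' : Type*} [Ring B'] [Algebra k⟦X⟧ B'] (f : B →ₐ[k⟦X⟧] B') {x y : B}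
    (h : GLFormsRel k t θ τ x y) :
    GLFormsRel k (fun s => f (t s)) (fun i => f (θ i)) τ (f x) (f y) := by
  cases h with
  | tt h => exact .tt (h.map k f)
  | cross i x =>
    have := GLFormsRel.cross (k := k) (t := fun s => f (t s)) (θ := fun i => f (θ i)) (τ := τ) i x
    rw [map_mul]
    convert this
    cases τ <;> cases x <;> fin_cases i <;> simp [crossRhs]
  | θθ h => exact .θθ (h.map k f)

theorem SLFormsRel.map {B' : Type*} [Ring B'] [Algebra k⟦X⟧ B'] (f : B →ₐ[k⟦X⟧] B') {x y : B}
    (h : SLFormsRel k t θ τ x y) :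
    SLFormsRel k (fun s => f (t s)) (fun i => f (θ i)) τ (f x) (f y) := by
  cases h with
  | base h => exact .base (h.map k f)
  | det => simpa [detq] using SLFormsRel.det (k := k) (t := fun s => f (t s))

/-- The generators of a quotient algebra are images of free generators. Lifting a relation among
them to the free algebra, where it is one of the relations divided out, shows that it holds in the
quotient. -/
theorem GLqRel.exists_of_map {B' : Type*} [Ring B'] [Algebra k⟦X⟧ B'] (f : B →ₐ[k⟦X⟧] B')
    {x y : B'} (h : GLqRel k (fun s => f (t s)) x y) :
    ∃ x₀ y₀, GLqRel k t x₀ y₀ ∧ f x₀ = x ∧ f y₀ = y := by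
  cases h
  · exact ⟨_, _, .ab, by simp, by simp⟩
  · exact ⟨_, _, .ac, by simp, by simp⟩
  · exact ⟨_, _, .ad, by simp, by simp⟩
  · exact ⟨_, _, .bc, by simp, by simp⟩
  · exact ⟨_, _, .cd, by simp, by simp⟩
  · exact ⟨_, _, .bd, by simp, by simp⟩

theorem SLqRel.exists_of_map {B' : Type*} [Ring B'] [Algebra k⟦X⟧ B'] (f : B →ₐ[k⟦X⟧] B')
    {x y : B'} (h : SLqRel k (fun s => f (t s)) x y) :
    ∃ x₀ y₀, SLqRel k t x₀ y₀ ∧ f x₀ = x ∧ f y₀ = y := by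
  cases h with
  | base h =>
    obtain ⟨x₀, y₀, h₀, rfl, rfl⟩ := h.exists_of_map k f
    exact ⟨_, _, .base h₀, rfl, rfl⟩
  | det => exact ⟨_, _, .det, by simp [detq], by simp⟩

theorem ThetaRel.exists_of_map {B' : Type*} [Ring B'] [Algebra k⟦X⟧ B'] (f : B →ₐ[k⟦X⟧] B')
    {x y : B'} (h : ThetaRel k (fun i => f (θ i)) x y) :
    ∃ x₀ y₀, ThetaRel k θ x₀ y₀ ∧ f x₀ = x ∧ f y₀ = y := by
  cases h
  · exact ⟨_, _, .sq0, by simp, by simp⟩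
  · exact ⟨_, _, .sq1, by simp, by simp⟩
  · exact ⟨_, _, .sq2, by simp, by simp⟩
  · exact ⟨_, _, .r12, by simp, by simp⟩
  · exact ⟨_, _, .r10, by simp, by simp⟩
  · exact ⟨_, _, .r20, by simp, by simp⟩

theorem GLFormsRel.exists_of_map {B' : Type*} [Ring B'] [Algebra k⟦X⟧ B'] (f : B →ₐ[k⟦X⟧] B')
    {x y : B'} (h : GLFormsRel k (fun s => f (t s)) (fun i => f (θ i)) τ x y) :
    ∃ x₀ y₀, GLFormsRel k t θ τ x₀ y₀ ∧ f x₀ = x ∧ f y₀ = y := by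
  cases h with
  | tt h =>
    obtain ⟨x₀, y₀, h₀, rfl, rfl⟩ := h.exists_of_map k f
    exact ⟨_, _, .tt h₀, rfl, rfl⟩
  | cross i x =>
    refine ⟨_, _, .cross i x, by simp, ?_⟩
    cases τ <;> cases x <;> fin_cases i <;> simp [crossRhs]
  | θθ h =>
    obtain ⟨x₀, y₀, h₀, rfl, rfl⟩ := h.exists_of_map k f
    exact ⟨_, _, .θθ h₀, rfl, rfl⟩

theorem SLFormsRel.exists_of_map {B' : Type*} [Ring B'] [Algebra k⟦X⟧ B'] (f : B →ₐ[k⟦X⟧] B')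
    {x y : B'} (h : SLFormsRel k (fun s => f (t s)) (fun i => f (θ i)) τ x y) :
    ∃ x₀ y₀, SLFormsRel k t θ τ x₀ y₀ ∧ f x₀ = x ∧ f y₀ = y := by
  cases h with
  | base h =>
    obtain ⟨x₀, y₀, h₀, rfl, rfl⟩ := h.exists_of_map k f
    exact ⟨_, _, .base h₀, rfl, rfl⟩
  | det => exact ⟨_, _, .det, by simp [detq], by simp⟩

end Bridge

theorem presents_Aq : Presents k⟦X⟧ (FunRel (qParam k)) (Aq k) (tAq k) := by
  refine presents_ringQuot _ (FunRel (qParam k)) ?_ ?_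
  · refine (slqRel_iff k).1 fun x y h => ?_
    obtain ⟨x₀, y₀, h₀, rfl, rfl⟩ := h.exists_of_map k (RingQuot.mkAlgHom k⟦X⟧ _)
    exact RingQuot.mkAlgHom_rel k⟦X⟧ h₀
  · intro B _ _ t ht x y h
    have := h.map k (FreeAlgebra.lift k⟦X⟧ t)
    simp only [FreeAlgebra.lift_ι_apply] at this
    exact (slqRel_iff k).2 ht _ _ this

theorem presents_Mq (τ : Kind) : Presents k⟦X⟧ (ExtRel (qParam k) τ) (Mq k τ) (gMq k τ) := by
  refine presents_ringQuot _ (ExtRel (qParam k) τ) ?_ ?_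
  · refine (slFormsRel_iff k).1 fun x y h => ?_
    obtain ⟨x₀, y₀, h₀, rfl, rfl⟩ := h.exists_of_map k (RingQuot.mkAlgHom k⟦X⟧ _)
    exact RingQuot.mkAlgHom_rel k⟦X⟧ h₀
  · intro B _ _ t ht x y h
    have := h.map k (FreeAlgebra.lift k⟦X⟧ t)
    simp only [FreeAlgebra.lift_ι_apply] at this
    exact (slFormsRel_iff k).2 ht _ _ this

theorem presents_MqGL (τ : Kind) : Presents k⟦X⟧
    (fun B _ _ g => MatRels (qParam k) (fun x => (g (Gen.t x) : B)) ∧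
      FormsRels (qParam k) τ (fun x => g (.t x)) fun i => g (.θ i))
    (MqGL k τ) fun s => mkMqGL k τ (FreeAlgebra.ι k⟦X⟧ s) := by
  refine presents_ringQuot _ (fun B _ _ g => MatRels (qParam k) (fun x => (g (Gen.t x) : B)) ∧
      FormsRels (qParam k) τ (fun x => g (.t x)) fun i => g (.θ i)) ?_ ?_
  · refine (glFormsRel_iff k).1 fun x y h => ?_
    obtain ⟨x₀, y₀, h₀, rfl, rfl⟩ := h.exists_of_map k (RingQuot.mkAlgHom k⟦X⟧ _)
    exact RingQuot.mkAlgHom_rel k⟦X⟧ h₀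
  · intro B _ _ t ht x y h
    have := h.map k (FreeAlgebra.lift k⟦X⟧ t)
    simp only [FreeAlgebra.lift_ι_apply] at this
    exact (glFormsRel_iff k).2 ht _ _ this

end Quantum

/-! ### Presentations at `q = 1` -/

section Classical

variable (k : Type u) [Field k] [CharZero k]

section Bridge

variable {B : Type*} [Ring B] [Algebra k B] {t : TGen → B} {θ : Fin 3 → B}

theorem slRels_one_iff : SLRels (oneParam k) t ↔
    (∀ x y, t x * t y = t y * t x) ∧ t .a * t .d - t .b * t .c = 1 := by
  constructor
  · intro h
    have h₁ := h.ab; have h₂ := h.ac; have h₃ := h.ad; have h₄ := h.bc; have h₅ := h.cd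
    have h₆ := h.bd
    simp only [oneParam, QParam.mu, one_smul, sub_self, zero_smul, sub_eq_zero] at h₁ h₂ h₃ h₅ h₆
    refine ⟨fun x y => ?_, by simpa [oneParam] using h.det⟩
    cases x <;> cases y <;> simp only [*]
  · rintro ⟨h, h'⟩
    exact ⟨⟨by simp [oneParam, h .a .b], by simp [oneParam, h .a .c],
      by simp [oneParam, QParam.mu, h .a .d], h _ _, by simp [oneParam, h .c .d],
      by simp [oneParam, h .b .d]⟩, by simpa [oneParam] using h'⟩

/-- At `q = 1` the parameter `μ` vanishes, so both types of cross relations collapse to commutation.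
Hence the classical algebra is presented by the relations of either type. -/
theorem formsRels_one_iff (τ : Kind) : FormsRels (oneParam k) τ t θ ↔
    (∀ x i, t x * θ i = θ i * t x) ∧ ∀ i j, θ i * θ j = -(θ j * θ i) := by
  have key : ∀ x i, crossVal (oneParam k) t θ τ x i = t x * θ i := by
    intro x i
    cases τ <;> cases x <;> fin_cases i <;> simp [crossVal, oneParam, QParam.mu]
  constructor
  · intro h
    have h₁ := h.sq0; have h₂ := h.sq1; have h₃ := h.sq2; have h₄ := h.r21; have h₅ := h.r10
    have h₆ := h.r20
    simp only [oneParam, QParam.mu, one_smul, sub_self, zero_smul, mul_zero, zero_mul, one_pow]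
      at h₁ h₂ h₃ h₄ h₅ h₆
    refine ⟨fun x i => by rw [h.cross, key], fun i j => ?_⟩
    fin_cases i <;> fin_cases j <;> simp [*]
  · rintro ⟨h, h'⟩
    -- Anticommutation with itself gives `2 (θⁱ)² = 0`, and `2` is invertible.
    have sq : ∀ i, θ i * θ i = 0 := fun i => by
      have h₂ : (2 : k) • (θ i * θ i) = 0 := by
        rw [two_smul]; nth_rw 1 [h' i i]; simp
      simpa using h₂
    exact ⟨⟨by simp [sq, oneParam, QParam.mu], sq _, sq _, h' _ _, by simp [oneParam, h' 1 0],
      by simp [oneParam, h' 2 0]⟩, fun i x => by rw [key, h]⟩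

end Bridge

theorem presents_A : Presents k (FunRel (oneParam k)) (A k) (tA k) := by
  refine presents_ringQuot _ (FunRel (oneParam k)) ?_ ?_
  · refine (slRels_one_iff k).2 ⟨fun x y => ?_, ?_⟩
    · simpa using RingQuot.mkAlgHom_rel k (ARel.comm (t := FreeAlgebra.ι k) x y)
    · simpa using RingQuot.mkAlgHom_rel k (ARel.det (t := FreeAlgebra.ι k))
  · intro B _ _ t ht x y h
    obtain ⟨h₁, h₂⟩ := (slRels_one_iff k).1 ht
    cases h with
    | comm x y => simpa using h₁ x y
    | det => simpa using h₂

theorem presents_M (τ : Kind) : Presents k (ExtRel (oneParam k) τ) (M k) (gM k) := by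
  refine presents_ringQuot _ (ExtRel (oneParam k) τ) ?_ ?_
  · refine ⟨(slRels_one_iff k).2 ⟨fun x y => ?_, ?_⟩,
      (formsRels_one_iff k τ).2 ⟨fun x i => ?_, fun i j => ?_⟩⟩
    · simpa using RingQuot.mkAlgHom_rel k (MRel.base (θ := fun i => FreeAlgebra.ι k (Gen.θ i))
        (ARel.comm (t := fun x => FreeAlgebra.ι k (Gen.t x)) x y))
    · simpa using RingQuot.mkAlgHom_rel k (MRel.base (θ := fun i => FreeAlgebra.ι k (Gen.θ i))
        (ARel.det (t := fun x => FreeAlgebra.ι k (Gen.t x))))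
    · simpa using RingQuot.mkAlgHom_rel k (MRel.tθ (t := fun x => FreeAlgebra.ι k (Gen.t x))
        (θ := fun i => FreeAlgebra.ι k (Gen.θ i)) x i)
    · simpa using RingQuot.mkAlgHom_rel k (MRel.θθ (t := fun x => FreeAlgebra.ι k (Gen.t x))
        (θ := fun i => FreeAlgebra.ι k (Gen.θ i)) i j)
  · intro B _ _ t ht x y h
    obtain ⟨h₁, h₂⟩ := (slRels_one_iff k).1 ht.1
    obtain ⟨h₃, h₄⟩ := (formsRels_one_iff k τ).1 ht.2
    cases h with
    | base h =>
      cases h with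
      | comm x y => simpa using h₁ x y
      | det => simpa using h₂
    | tθ x i => simpa using h₃ x i
    | θθ i j => simpa using h₄ i j

end Classical

end

/-! ### Reduction modulo `h` -/

section

section Reduction

/-- The ideal `h B` of a `k[[h]]`-algebra `B`. -/
def hIdeal (k : Type u) [Field k] (B : Type u) [Ring B] [Algebra k⟦X⟧ B] : Ideal B where
  carrier := {x | ∃ y, x = (PowerSeries.X : k⟦X⟧) • y}
  add_mem' := by
    rintro _ _ ⟨x, rfl⟩ ⟨y, rfl⟩
    exact ⟨x + y, (smul_add _ _ _).symm⟩
  zero_mem' := ⟨0, (smul_zero _).symm⟩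
  smul_mem' := by
    rintro c _ ⟨x, rfl⟩
    exact ⟨c * x, by simp⟩

instance (k : Type u) [Field k] (B : Type u) [Ring B] [Algebra k⟦X⟧ B] :
    (hIdeal k B).IsTwoSided where
  mul_mem_of_left := by
    rintro _ y ⟨x, rfl⟩
    exact ⟨x * y, by simp⟩

variable {k : Type u} [Field k] {ι : Type}
  {Rh : ∀ (B : Type u) [Ring B] [Algebra k⟦X⟧ B], (ι → B) → Prop}
  {R₀ : ∀ (B : Type u) [Ring B] [Algebra k B], (ι → B) → Prop}
  {Bh B : Type u} [Ring Bh] [Algebra k⟦X⟧ Bh] [Ring B] [Algebra k B] {gh : ι → Bh} {g : ι → B}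

/-- Algebras presented by relations which agree modulo `h`. -/
theorem Presents.exists_reduction (hh : Presents k⟦X⟧ Rh Bh gh) (h₀ : Presents k R₀ B g)
    (hmap : ∀ (C : Type u) [Ring C] [Algebra k⟦X⟧ C] (f : Bh →ₐ[k⟦X⟧] C), Rh C fun s => f (gh s))
    (compat : ∀ (C : Type u) [Ring C] [Algebra k⟦X⟧ C] [Algebra k C] (t : ι → C),
      (∀ (r : k⟦X⟧) (x : C), r • x = PowerSeries.constantCoeff r • x) → (Rh C t ↔ R₀ C t)) :
    ∃ π : Bh →ₛₗ[(PowerSeries.constantCoeff : k⟦X⟧ →+* k)] B, IsReduction π ∧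
      ∀ s, π (gh s) = g s := by
  obtain ⟨π, hπ1, hπm, hπg⟩ : ∃ π : Bh →ₛₗ[(PowerSeries.constantCoeff : k⟦X⟧ →+* k)] B,
      π 1 = 1 ∧ (∀ x y, π (x * y) = π x * π y) ∧ ∀ s, π (gh s) = g s := by
    -- Viewed over `k[[h]]` through the constant term, `B` satisfies the deformed relations, so the
    -- universal property of `Bh` yields `π`.
    let _ : Algebra k⟦X⟧ B := Algebra.compHom B (PowerSeries.constantCoeff : k⟦X⟧ →+* k)
    obtain ⟨f, hf⟩ := hh.lift B g ((compat B g fun r x => rfl).2 h₀.rel)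
    exact ⟨{ toFun := f, map_add' := map_add f, map_smul' := fun r x => map_smul f r x },
      map_one f, map_mul f, hf⟩
  -- Scalars act on `Bh / h Bh` through their constant term, since the rest is divisible by `h`.
  -- Thus `compat` applies, and the universal property of `B` yields a map `σ` in the opposite
  -- direction.
  have hs : ∀ (r : k⟦X⟧) (x : Bh ⧸ hIdeal k Bh),
      r • x = (PowerSeries.C (PowerSeries.constantCoeff r) : k⟦X⟧) • x := by
    intro r x
    obtain ⟨x, rfl⟩ := (Ideal.Quotient.mkₐ_surjective k⟦X⟧ (hIdeal k Bh)) x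
    rw [← map_smul, ← map_smul]
    refine Ideal.Quotient.eq.2 ?_
    obtain ⟨s, hs⟩ :=
      (PowerSeries.X_dvd_iff (φ := r - PowerSeries.C (PowerSeries.constantCoeff r))).2
      (by simp)
    exact ⟨s • x, by rw [← sub_smul, hs, mul_smul]⟩
  obtain ⟨σ, hσ1, hσm, hσa, hσg, hσs⟩ : ∃ σ : B → Bh ⧸ hIdeal k Bh, σ 1 = 1 ∧
      (∀ x y, σ (x * y) = σ x * σ y) ∧ (∀ x y, σ (x + y) = σ x + σ y) ∧
      (∀ s, σ (g s) = Ideal.Quotient.mkₐ k⟦X⟧ _ (gh s)) ∧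
      ∀ (c : k) x, σ (c • x) = (PowerSeries.C c : k⟦X⟧) • σ x := by
    let _ : Algebra k (Bh ⧸ hIdeal k Bh) :=
      Algebra.compHom (Bh ⧸ hIdeal k Bh) (PowerSeries.C : k →+* k⟦X⟧)
    obtain ⟨f, hf⟩ := h₀.lift (Bh ⧸ hIdeal k Bh) _
      ((compat _ _ hs).1 (hmap _ (Ideal.Quotient.mkₐ k⟦X⟧ (hIdeal k Bh))))
    exact ⟨f, map_one f, map_mul f, map_add f, hf, fun c x => map_smul f c x⟩
  -- Agreement on generators suffices. As `σ ∘ π` is the quotient map, the kernel of `π` lies in `h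
  -- Bh`.
  have hσπ : ∀ x, σ (π x) = Ideal.Quotient.mkₐ k⟦X⟧ (hIdeal k Bh) x := by
    intro x
    have hx : x ∈ Algebra.adjoin k⟦X⟧ (Set.range gh) := by rw [hh.gen]; trivial
    induction hx using Algebra.adjoin_induction with
    | mem x hx => obtain ⟨s, rfl⟩ := hx; rw [hπg, hσg]
    | algebraMap r =>
      rw [Algebra.algebraMap_eq_smul_one, map_smulₛₗ, hπ1, hσs, hσ1, map_smul, map_one, ← hs]
    | add x y _ _ ix iy => rw [map_add, hσa, ix, iy, map_add]
    | mul x y _ _ ix iy => rw [hπm, hσm, ix, iy, map_mul]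
  refine ⟨π, ⟨hπ1, hπm, fun y => ?_, fun x => ⟨fun hx => ?_, ?_⟩⟩, hπg⟩
  · have hy : y ∈ Algebra.adjoin k (Set.range g) := by rw [h₀.gen]; trivial
    induction hy using Algebra.adjoin_induction with
    | mem y hy => obtain ⟨s, rfl⟩ := hy; exact ⟨gh s, hπg s⟩
    | algebraMap c =>
      exact ⟨(PowerSeries.C c : k⟦X⟧) • 1, by
        rw [map_smulₛₗ, hπ1, PowerSeries.constantCoeff_C, Algebra.algebraMap_eq_smul_one]⟩
    | add x y _ _ ix iy =>
      obtain ⟨x, rfl⟩ := ix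
      obtain ⟨y, rfl⟩ := iy
      exact ⟨x + y, map_add _ _ _⟩
    | mul x y _ _ ix iy =>
      obtain ⟨x, rfl⟩ := ix
      obtain ⟨y, rfl⟩ := iy
      exact ⟨x * y, hπm _ _⟩
  · have h := hσπ x
    rw [hx, show σ 0 = 0 by simpa using hσa 0 0] at h
    exact Ideal.Quotient.eq_zero_iff_mem.1 h.symm
  · rintro ⟨y, rfl⟩
    rw [map_smulₛₗ, PowerSeries.constantCoeff_X, zero_smul]

end Reduction

/-! ### The concrete algebras modulo `h` -/

section Concrete

variable (k : Type u) [Field k] [CharZero k]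

section Compat

variable {k} {C : Type*} [Ring C] [Algebra k⟦X⟧ C] [Algebra k C] {t : TGen → C} {θ : Fin 3 → C}

theorem slRels_compat
    (hC : ∀ (r : k⟦X⟧) (x : C), r • x = PowerSeries.constantCoeff r • x) :
    SLRels (qParam k) t ↔ SLRels (oneParam k) t := by
  have e : ∀ x : C, (qParam k).q • x = (oneParam k).q • x := fun x => by
    rw [hC, qParam, constantCoeff_q, oneParam]
  have e' : ∀ x : C, (qParam k).mu • x = (oneParam k).mu • x := fun x => by
    rw [hC]; simp [qParam, QParam.mu, constantCoeff_q, oneParam]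
  constructor
  · rintro ⟨⟨h₁, h₂, h₃, h₄, h₅, h₆⟩, h₇⟩
    simp only [e, e'] at h₁ h₂ h₃ h₅ h₆ h₇
    exact ⟨⟨h₁, h₂, h₃, h₄, h₅, h₆⟩, h₇⟩
  · rintro ⟨⟨h₁, h₂, h₃, h₄, h₅, h₆⟩, h₇⟩
    simp only [← e, ← e'] at h₁ h₂ h₃ h₅ h₆ h₇
    exact ⟨⟨h₁, h₂, h₃, h₄, h₅, h₆⟩, h₇⟩

theorem formsRels_compat {τ : Kind}
    (hC : ∀ (r : k⟦X⟧) (x : C), r • x = PowerSeries.constantCoeff r • x) :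
    FormsRels (qParam k) τ t θ ↔ FormsRels (oneParam k) τ t θ := by
  have e₀ : PowerSeries.constantCoeff (qParam k).q = (oneParam k).q := constantCoeff_q k
  have e₁ : PowerSeries.constantCoeff (qParam k).qi = (oneParam k).qi := constantCoeff_q_inv k
  have e₂ : PowerSeries.constantCoeff (qParam k).mu = (oneParam k).mu := by
    rw [QParam.mu, QParam.mu, map_sub, e₀, e₁]
  have e₃ : PowerSeries.constantCoeff (qParam k).lam = (oneParam k).lam := by
    rw [QParam.lam, QParam.lam, map_add, e₀, e₁]
  have e₄ : PowerSeries.constantCoeff (qParam k).li = (oneParam k).li := by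
    simp [qParam, oneParam, constantCoeff_lam]
  have key : ∀ x i, crossVal (qParam k) t θ τ x i = crossVal (oneParam k) t θ τ x i := by
    intro x i
    cases τ <;> cases x <;> simp only [crossVal, hC, map_mul, map_pow, e₀, e₁, e₂, e₃]
  have hθ : ThetaRels (qParam k) θ ↔ ThetaRels (oneParam k) θ := by
    constructor
    · rintro ⟨h₁, h₂, h₃, h₄, h₅, h₆⟩
      simp only [hC, map_mul, map_pow, e₀, e₁, e₂, e₄] at h₁ h₅ h₆
      exact ⟨h₁, h₂, h₃, h₄, h₅, h₆⟩
    · rintro ⟨h₁, h₂, h₃, h₄, h₅, h₆⟩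
      refine ⟨?_, h₂, h₃, h₄, ?_, ?_⟩ <;>
      simpa only [hC, map_mul, map_pow, e₀, e₁, e₂, e₄]
  exact ⟨fun h => ⟨hθ.1 h.toThetaRels, fun i x => by rw [h.cross, key]⟩,
    fun h => ⟨hθ.2 h.toThetaRels, fun i x => by rw [h.cross, key]⟩⟩

end Compat

theorem exists_reduction_A :
    ∃ π : Aq k →ₛₗ[(PowerSeries.constantCoeff : k⟦X⟧ →+* k)] A k, IsReduction π ∧
      ∀ s, π (tAq k s) = tA k s :=
  (presents_Aq k).exists_reduction (presents_A k)
    (fun _ _ _ f => SLRels.map _ f (presents_Aq k).rel) fun _ _ _ _ _ hC => slRels_compat hC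

theorem exists_reduction_M (τ : Kind) :
    ∃ π : Mq k τ →ₛₗ[(PowerSeries.constantCoeff : k⟦X⟧ →+* k)] M k, IsReduction π ∧
      ∀ s, π (gMq k τ s) = gM k s :=
  (presents_Mq k τ).exists_reduction (presents_M k τ)
    (fun _ _ _ f => ⟨SLRels.map _ f (presents_Mq k τ).rel.1,
      FormsRels.map _ f (presents_Mq k τ).rel.2⟩)
    fun _ _ _ _ _ hC => and_congr (slRels_compat hC) (formsRels_compat hC)

end Concrete

end

/-! ### A basis of the function algebra -/

section

namespace FunModel

variable {R : Type u} [CommRing R] (P : QParam R)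

/-- The free module with a basis of normally ordered monomials `bⁱ cʲ zₙ`, where `zₙ` is `aⁿ` or
`d⁻ⁿ`. -/
abbrev V (R : Type u) [CommRing R] := (ℕ × ℕ × ℤ) →₀ R

/-- The basis vectors of `V`. -/
abbrev e (R : Type u) [CommRing R] (i j : ℕ) (n : ℤ) : V R := Finsupp.single (i, j, n) 1

/-- The coefficient `α` in `a zₙ = (1 + α b c) zₙ₊₁`. -/
def up (n : ℤ) : R := if 0 ≤ n then 0 else P.q

/-- The coefficient `δ` in `d zₙ = (1 + δ b c) zₙ₋₁`. -/
def down (n : ℤ) : R := if n ≤ 0 then 0 else P.qi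

/-- Moving `a` past `b c` costs `q²`, so `a d zₙ = (1 + q² δₙ b c)(1 + αₙ₋₁ b c) zₙ`. This identity
and `up_mul_down` say that the product of brackets is `1 + q b c`: exactly one of the two
corrections is nonzero. The pair `down_up`, `down_mul_up` does the same for `d a zₙ`, with `q⁻¹` in
place of `q`. -/
theorem up_down (n : ℤ) : up P (n - 1) + P.q ^ 2 * down P n = P.q := by
  have := P.q_mul
  unfold up down
  split_ifs <;> first | omega | linear_combination P.q * this | simp

theorem up_mul_down (n : ℤ) : up P (n - 1) * down P n = 0 := by
  unfold up down
  split_ifs <;> first | omega | simp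

theorem down_up (n : ℤ) : down P (n + 1) + P.qi ^ 2 * up P n = P.qi := by
  have := P.q_mul
  unfold up down
  split_ifs <;> first | omega | linear_combination P.qi * this | simp

theorem down_mul_up (n : ℤ) : down P (n + 1) * up P n = 0 := by
  unfold up down
  split_ifs <;> first | omega | simp

/-- Left multiplication by the matrix entries on `V`. -/
def op : TGen → Module.End R (V R)
  | .a => Finsupp.linearCombination R fun m : ℕ × ℕ × ℤ => P.q ^ (m.1 + m.2.1) •
      (e R m.1 m.2.1 (m.2.2 + 1) + up P m.2.2 • e R (m.1 + 1) (m.2.1 + 1) (m.2.2 + 1))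
  | .b => Finsupp.linearCombination R fun m : ℕ × ℕ × ℤ => e R (m.1 + 1) m.2.1 m.2.2
  | .c => Finsupp.linearCombination R fun m : ℕ × ℕ × ℤ => e R m.1 (m.2.1 + 1) m.2.2
  | .d => Finsupp.linearCombination R fun m : ℕ × ℕ × ℤ => P.qi ^ (m.1 + m.2.1) •
      (e R m.1 m.2.1 (m.2.2 - 1) + down P m.2.2 • e R (m.1 + 1) (m.2.1 + 1) (m.2.2 - 1))

theorem op_a (i j : ℕ) (n : ℤ) : op P .a (e R i j n) =
    P.q ^ (i + j) • (e R i j (n + 1) + up P n • e R (i + 1) (j + 1) (n + 1)) := by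
  simp only [op, Finsupp.linearCombination_single, one_smul]

theorem op_b (i j : ℕ) (n : ℤ) : op P .b (e R i j n) = e R (i + 1) j n := by
  simp only [op, Finsupp.linearCombination_single, one_smul]

theorem op_c (i j : ℕ) (n : ℤ) : op P .c (e R i j n) = e R i (j + 1) n := by
  simp only [op, Finsupp.linearCombination_single, one_smul]

theorem op_d (i j : ℕ) (n : ℤ) : op P .d (e R i j n) =
    P.qi ^ (i + j) • (e R i j (n - 1) + down P n • e R (i + 1) (j + 1) (n - 1)) := by
  simp only [op, Finsupp.linearCombination_single, one_smul]

theorem hom_ext {W : Type*} [AddCommGroup W] [Module R W] {f g : V R →ₗ[R] W}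
    (h : ∀ i j n, f (e R i j n) = g (e R i j n)) : f = g :=
  Finsupp.lhom_ext' fun ⟨i, j, n⟩ => LinearMap.ext_ring (h i j n)

theorem q_pow_mul (m : ℕ) : P.q ^ m * P.qi ^ m = 1 := by rw [← mul_pow, P.q_mul, one_pow]

theorem op_ad (i j : ℕ) (n : ℤ) :
    op P .a (op P .d (e R i j n)) = e R i j n + P.q • e R (i + 1) (j + 1) n := by
  have h₁ := P.q_mul; have h₂ := q_pow_mul P (i + j)
  have h₃ := up_down P n; have h₄ := up_mul_down P n
  simp only [op_d, map_smul, map_add, op_a, sub_add_cancel]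
  match_scalars <;> grind

theorem op_da (i j : ℕ) (n : ℤ) :
    op P .d (op P .a (e R i j n)) = e R i j n + P.qi • e R (i + 1) (j + 1) n := by
  have h₁ := P.q_mul; have h₂ := q_pow_mul P (i + j)
  have h₃ := down_up P n; have h₄ := down_mul_up P n
  simp only [op_d, map_smul, map_add, op_a, add_sub_cancel_right]
  match_scalars <;> grind

/-- The model carries a representation of the function algebra. This is what excludes hidden linear
relations between ordered monomials. -/
theorem slRels_op : SLRels P (op P) := by
  have hq := P.q_mul
  refine ⟨⟨?_, ?_, ?_, ?_, ?_, ?_⟩, ?_⟩ <;> refine hom_ext fun i j n => ?_ <;>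
  simp only [Module.End.mul_apply, LinearMap.smul_apply, LinearMap.sub_apply, Module.End.one_apply]
  · simp only [op_a, op_b, map_smul, map_add]
    match_scalars <;> ring
  · simp only [op_a, op_c, map_smul, map_add]
    match_scalars <;> ring
  · rw [op_ad, op_da, op_c, op_b, QParam.mu]
    module
  · simp only [op_b, op_c]
  · simp only [op_d, op_c, map_smul, map_add]
    match_scalars <;> grind
  · simp only [op_d, op_b, map_smul, map_add]
    match_scalars <;> grind
  · rw [op_ad, op_c, op_b]
    module

variable {A : Type u} [Ring A] [Algebra R A] (t : TGen → A)

/-- The elements `aⁿ` and `d⁻ⁿ`. -/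
def z (n : ℤ) : A := if 0 ≤ n then t .a ^ n.toNat else t .d ^ (-n).toNat

/-- The normally ordered monomials in an algebra. -/
def mono : V R →ₗ[R] A :=
  Finsupp.linearCombination R fun m : ℕ × ℕ × ℤ => t .b ^ m.1 * t .c ^ m.2.1 * z t m.2.2

theorem mono_e (i j : ℕ) (n : ℤ) : mono t (e R i j n) = t .b ^ i * t .c ^ j * z t n := by
  simp [mono]

theorem z_natCast (m : ℕ) : z t (m : ℤ) = t .a ^ m := by
  simp [z]

theorem z_neg_natCast (m : ℕ) : z t (-(m : ℤ)) = t .d ^ m := by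
  rw [z]
  split_ifs with h
  -- The exponent `-0` falls under the branch of powers of `a`; both descriptions give `1`.
  · obtain rfl : m = 0 := by omega
    simp
  · simp

variable {P t}

theorem mul_pow_of_qcomm {x y : A} {r : R} (hxy : x * y = r • (y * x)) (i : ℕ) :
    x * y ^ i = r ^ i • (y ^ i * x) := by
  induction i with
  | zero => simp
  | succ i ih =>
    rw [pow_succ, ← mul_assoc, ih, smul_mul_assoc, mul_assoc, hxy, mul_smul_comm, smul_smul,
      ← mul_assoc, pow_succ]

/-- A correction arises only when `n < 0`: then `a` meets a factor `d` and is contracted by `a d = 1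
+ q b c`. Otherwise the power of `a` merely grows. -/
theorem a_mul_z (h : SLRels P t) (n : ℤ) :
    t .a * z t n = z t (n + 1) + up P n • (t .b * t .c * z t (n + 1)) := by
  obtain ⟨m, rfl⟩ | ⟨m, rfl⟩ : (∃ m : ℕ, n = m) ∨ ∃ m : ℕ, n = -((m + 1 : ℕ) : ℤ) := by
    obtain h | h := le_or_gt 0 n
    · exact .inl ⟨n.toNat, by omega⟩
    · exact .inr ⟨(-n - 1).toNat, by omega⟩
  · rw [up, if_pos (by omega), ← Nat.cast_succ, z_natCast, z_natCast, pow_succ']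
    simp
  · rw [up, if_neg (by omega), show -((m + 1 : ℕ) : ℤ) + 1 = -(m : ℤ) by push_cast; ring,
      z_neg_natCast, z_neg_natCast, pow_succ', ← mul_assoc, h.ad', add_mul, one_mul,
      smul_mul_assoc]

theorem d_mul_z (h : SLRels P t) (n : ℤ) :
    t .d * z t n = z t (n - 1) + down P n • (t .b * t .c * z t (n - 1)) := by
  obtain ⟨m, rfl⟩ | ⟨m, rfl⟩ : (∃ m : ℕ, n = -m) ∨ ∃ m : ℕ, n = (m + 1 : ℕ) := by
    obtain h | h := le_or_gt n 0
    · exact .inl ⟨(-n).toNat, by omega⟩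
    · exact .inr ⟨(n - 1).toNat, by omega⟩
  · rw [down, if_pos (by omega), show -(m : ℤ) - 1 = -((m + 1 : ℕ) : ℤ) by push_cast; ring,
      z_neg_natCast, z_neg_natCast, pow_succ']
    simp
  · rw [down, if_neg (by omega), show ((m + 1 : ℕ) : ℤ) - 1 = m by push_cast; ring,
      z_natCast, z_natCast, pow_succ', ← mul_assoc, h.da, add_mul, one_mul, smul_mul_assoc]

theorem bc_pow_mul (h : SLRels P t) (i j : ℕ) (w : A) :
    t .b ^ i * t .c ^ j * (t .b * t .c * w) = t .b ^ (i + 1) * t .c ^ (j + 1) * w := by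
  have := (Commute.pow_left (show Commute (t .c) (t .b) from h.bc.symm) j).eq
  rw [pow_succ, pow_succ]
  simp only [mul_assoc]
  rw [← mul_assoc (t .c ^ j) (t .b), this, mul_assoc]

/-- The monomial map intertwines the model with left multiplication; hence its image is a left
ideal, and it contains `1`. -/
theorem mono_op (h : SLRels P t) (x : TGen) (v : V R) : mono t (op P x v) = t x * mono t v := by
  have key : (mono t).comp (op P x) = (LinearMap.mulLeft R (t x)).comp (mono t) := by
    refine hom_ext fun i j n => ?_
    simp only [LinearMap.comp_apply, LinearMap.mulLeft_apply, mono_e]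
    cases x
    · rw [op_a, map_smul, map_add, map_smul, mono_e, mono_e, ← mul_assoc, ← mul_assoc,
        mul_pow_of_qcomm h.ab, smul_mul_assoc, mul_assoc (t .b ^ i) (t .a), mul_pow_of_qcomm h.ac,
        mul_smul_comm, smul_smul, ← pow_add, smul_mul_assoc, ← mul_assoc, mul_assoc _ (t .a),
        a_mul_z h, mul_add, mul_smul_comm, bc_pow_mul h]
    · rw [op_b, mono_e, pow_succ']; simp only [mul_assoc]
    · have := (Commute.pow_right (show Commute (t .c) (t .b) from h.bc.symm) i).eq
      rw [op_c, mono_e, pow_succ', ← mul_assoc, ← mul_assoc, ← mul_assoc, this]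
    · rw [op_d, map_smul, map_add, map_smul, mono_e, mono_e, ← mul_assoc, ← mul_assoc,
        mul_pow_of_qcomm h.db, smul_mul_assoc, mul_assoc (t .b ^ i) (t .d), mul_pow_of_qcomm h.dc,
        mul_smul_comm, smul_smul, ← pow_add, smul_mul_assoc, ← mul_assoc, mul_assoc _ (t .d),
        d_mul_z h, mul_add, mul_smul_comm, bc_pow_mul h]
  exact LinearMap.congr_fun key v

theorem op_z (n : ℤ) : z (op P) n (e R 0 0 0) = e R 0 0 n := by
  unfold z
  split_ifs with h
  · obtain ⟨m, rfl⟩ := Int.eq_ofNat_of_zero_le h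
    rw [Int.toNat_natCast]
    induction m with
    | zero => simp
    | succ m ih =>
      rw [pow_succ', Module.End.mul_apply, ih (by omega), op_a, up, if_pos (by omega)]
      simp
  · obtain ⟨m, rfl⟩ : ∃ m : ℕ, n = -m := ⟨(-n).toNat, by omega⟩
    rw [neg_neg, Int.toNat_natCast]
    clear h
    induction m with
    | zero => simp
    | succ m ih =>
      rw [pow_succ', Module.End.mul_apply, ih, op_d, down, if_pos (by omega)]
      simp [sub_eq_add_neg, add_comm]

/-- Acting on the vector `1`, an ordered monomial recovers its own basis vector. -/
theorem op_mono (i j : ℕ) (n : ℤ) :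
    (op P .b ^ i * op P .c ^ j * z (op P) n) (e R 0 0 0) = e R i j n := by
  have hb : ∀ i' j', (op P .b ^ i) (e R i' j' n) = e R (i' + i) j' n := by
    intro i' j'
    induction i with
    | zero => simp
    | succ i ih => rw [pow_succ', Module.End.mul_apply, ih, op_b, add_assoc]
  have hc : ∀ i' j', (op P .c ^ j) (e R i' j' n) = e R i' (j' + j) n := by
    intro i' j'
    induction j with
    | zero => simp
    | succ j ih => rw [pow_succ', Module.End.mul_apply, ih, op_c, add_assoc]
  rw [Module.End.mul_apply, Module.End.mul_apply, op_z, hc, hb, zero_add, zero_add]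

end FunModel

open FunModel in
-- The inverse of the monomial map sends `x` to its action on the vector `1` of the model. One
-- composite is the identity by the intertwining property, the other by `op_mono`.
theorem Presents.free_fun {R : Type u} [CommRing R] {P : QParam R} {A : Type u} [Ring A]
    [Algebra R A] {t : TGen → A} (hA : Presents R (FunRel P) A t) : Module.Free R A := by
  have h : SLRels P t := hA.rel
  obtain ⟨ρ, hρ⟩ := hA.lift _ (op P) (slRels_op P)
  have key : ∀ (x : A) (v : V R), mono t (ρ x v) = x * mono t v := by
    intro x
    have hx : x ∈ Algebra.adjoin R (Set.range t) := by rw [hA.gen]; trivial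
    induction hx using Algebra.adjoin_induction with
    | mem x hx => obtain ⟨s, rfl⟩ := hx; intro v; rw [hρ, mono_op h]
    | algebraMap r => intro v; simp [Algebra.algebraMap_eq_smul_one]
    | add x y _ _ ix iy => intro v; simp [ix, iy, add_mul]
    | mul x y _ _ ix iy => intro v; simp [ix, iy, mul_assoc]
  refine Module.Free.of_equiv (LinearEquiv.ofLinearMap (mono t)
    ((LinearMap.applyₗ (R := R) (e R 0 0 0)).comp ρ.toLinearMap) ?_ ?_)
  · ext x
    simpa [mono_e, z] using key x (e R 0 0 0)
  · refine FunModel.hom_ext fun i j n => ?_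
    have hz : ρ (z t n) = z (op P) n := by
      unfold z; split_ifs <;> simp [hρ]
    simp only [LinearMap.comp_apply, mono_e, AlgHom.toLinearMap_apply, map_mul, map_pow, hρ, hz,
      LinearMap.applyₗ_apply_apply, LinearMap.id_apply, op_mono]

end

/-! ### A left basis of the external algebra -/

section

namespace ExtModel

variable {R : Type u} [CommRing R] (P : QParam R) {A : Type u} [Ring A] [Algebra R A]

/-- A linear combination of the eight normally ordered monomials
`1, θ⁰, θ¹, θ², θ⁰θ¹, θ⁰θ², θ¹θ², θ⁰θ¹θ²` with coefficients (on the left) in `A`. -/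
abbrev W (A : Type u) [Ring A] := Fin 8 → A

/-- Right multiplication by an element which commutes with the `θ`'s up to powers of `q`. -/
def diag (x : A) : Module.End A (W A) where
  toFun v := ![v 0 * x, v 1 * x, P.q • (v 2 * x), P.qi • (v 3 * x), P.q • (v 4 * x),
    P.qi • (v 5 * x), v 6 * x, v 7 * x]
  map_add' v w := by
    ext J; fin_cases J <;> simp [add_mul]
  map_smul' f v := by
    ext J; fin_cases J <;> simp [mul_assoc]

/-- Right multiplication by `a, b` for the relations of type I. -/
def triI (x y : A) : Module.End A (W A) where
  -- The off-diagonal entries in degree two come from `θ¹θ²x = xθ¹θ² + μλq⁻¹ yθ⁰θ¹` and `θ⁰θ²x = q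
  -- xθ⁰θ² + qμ yθ¹θ²`. In the latter the contribution `q³μ` is corrected by `-μλ(θ⁰)² = -q²μ²
  -- θ¹θ²`, and `q - μ = q⁻¹`.
  toFun v := ![v 0 * x, v 1 * x - (P.mu * P.lam) • (v 3 * y),
    P.qi • (v 2 * x) + (P.q ^ 2 * P.mu) • (v 1 * y), P.q • (v 3 * x),
    P.qi • (v 4 * x) + (P.mu * P.lam * P.qi) • (v 6 * y), P.q • (v 5 * x),
    v 6 * x + (P.q * P.mu) • (v 5 * y), v 7 * x]
  map_add' v w := by
    ext J; fin_cases J <;> simp [add_mul] <;> abel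
  map_smul' f v := by
    ext J; fin_cases J <;> simp [mul_assoc, mul_add, mul_sub]

/-- Right multiplication by `c, d` for the relations of type II. -/
def triII (y x : A) : Module.End A (W A) where
  toFun v := ![v 0 * y, v 1 * y - (P.mu * P.lam * P.qi ^ 2) • (v 2 * x), P.qi • (v 2 * y),
    P.q • (v 3 * y) + P.mu • (v 1 * x), P.qi • (v 4 * y),
    P.q • (v 5 * y) - (P.mu * P.lam * P.qi) • (v 6 * x),
    v 6 * y - (P.q * P.mu) • (v 4 * x), v 7 * y]
  map_add' v w := by
    ext J; fin_cases J <;> simp [add_mul] <;> abel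
  map_smul' f v := by
    ext J; fin_cases J <;> simp [mul_assoc, mul_add, mul_sub]

/-- Right multiplication by `θ⁰`. -/
def theta0 : Module.End A (W A) where
  -- The coefficients of `θ⁰θ¹` and `θ⁰θ²` disappear: reordering produces `(θ⁰)²`, a multiple of
  -- `θ¹θ²`, which is killed by a further `θ¹` or `θ²`.
  toFun v := ![0, v 0, 0, 0, -(P.qi ^ 2 • v 2), -(P.q ^ 2 • v 3), (P.q ^ 2 * P.mu * P.li) • v 1,
    v 6]
  map_add' v w := by
    ext J; fin_cases J <;> simp [add_comm]
  map_smul' f v := by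
    ext J; fin_cases J <;> simp

/-- Right multiplication by `θ¹`. -/
def theta1 : Module.End A (W A) where
  toFun v := ![0, 0, v 0, 0, v 1, 0, -v 3, -v 5]
  map_add' v w := by
    ext J; fin_cases J <;> simp [add_comm]
  map_smul' f v := by
    ext J; fin_cases J <;> simp

/-- Right multiplication by `θ²`. -/
def theta2 : Module.End A (W A) where
  toFun v := ![0, 0, 0, v 0, 0, v 1, v 2, v 4]
  map_add' v w := by
    ext J; fin_cases J <;> simp
  map_smul' f v := by
    ext J; fin_cases J <;> simp

/-- Right multiplication by the matrix entries. -/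
def opT (t : TGen → A) : Kind → TGen → Module.End A (W A)
  | .I, .a => triI P (t .a) (t .c)
  | .I, .b => triI P (t .b) (t .d)
  | .I, .c => diag P (t .c)
  | .I, .d => diag P (t .d)
  | .II, .a => diag P (t .a)
  | .II, .b => diag P (t .b)
  | .II, .c => triII P (t .c) (t .a)
  | .II, .d => triII P (t .d) (t .b)

/-- Right multiplication by the `θ`'s. -/
def opTheta : Fin 3 → Module.End A (W A) := ![theta0 P, theta1, theta2]

variable {P}

theorem diag_apply (x : A) (v : W A) : diag P x v =
    ![v 0 * x, v 1 * x, P.q • (v 2 * x), P.qi • (v 3 * x), P.q • (v 4 * x),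
      P.qi • (v 5 * x), v 6 * x, v 7 * x] := rfl

theorem triI_apply (x y : A) (v : W A) : triI P x y v =
    ![v 0 * x, v 1 * x - (P.mu * P.lam) • (v 3 * y),
      P.qi • (v 2 * x) + (P.q ^ 2 * P.mu) • (v 1 * y), P.q • (v 3 * x),
      P.qi • (v 4 * x) + (P.mu * P.lam * P.qi) • (v 6 * y), P.q • (v 5 * x),
      v 6 * x + (P.q * P.mu) • (v 5 * y), v 7 * x] := rfl

theorem triII_apply (y x : A) (v : W A) : triII P y x v =
    ![v 0 * y, v 1 * y - (P.mu * P.lam * P.qi ^ 2) • (v 2 * x), P.qi • (v 2 * y),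
      P.q • (v 3 * y) + P.mu • (v 1 * x), P.qi • (v 4 * y),
      P.q • (v 5 * y) - (P.mu * P.lam * P.qi) • (v 6 * x),
      v 6 * y - (P.q * P.mu) • (v 4 * x), v 7 * y] := rfl

theorem theta0_apply (v : W A) : theta0 P v =
    ![0, v 0, 0, 0, -(P.qi ^ 2 • v 2), -(P.q ^ 2 • v 3), (P.q ^ 2 * P.mu * P.li) • v 1, v 6] := rfl

theorem theta1_apply (v : W A) : theta1 v = ![0, 0, v 0, 0, v 1, 0, -v 3, -v 5] := rfl

theorem theta2_apply (v : W A) : theta2 v = ![0, 0, 0, v 0, 0, v 1, v 2, v 4] := rfl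

/-- Right multiplication reverses the order of composition, so the relations are required in the
opposite of the endomorphism algebra. -/
theorem thetaRels_op :
    ThetaRels P fun i => MulOpposite.op (opTheta P i : Module.End A (W A)) := by
  have hq : P.qi * P.q = 1 := (mul_comm _ _).trans P.q_mul
  constructor <;> refine MulOpposite.unop_injective (LinearMap.ext fun v => ?_) <;>
  simp only [opTheta, Matrix.cons_val, MulOpposite.unop_mul, MulOpposite.unop_op,
    Module.End.mul_apply, MulOpposite.unop_smul, MulOpposite.unop_neg, MulOpposite.unop_zero,
    LinearMap.smul_apply, LinearMap.neg_apply, LinearMap.zero_apply, theta0_apply, theta1_apply,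
    theta2_apply] <;> ext J <;> fin_cases J <;> simp [smul_smul, ← mul_pow, P.q_mul, hq]

variable {t : TGen → A}

set_option maxHeartbeats 1600000 in
theorem slRels_op (ht : SLRels P t) (τ : Kind) :
    SLRels P fun x => MulOpposite.op (opT P t τ x) := by
  have hq := P.q_mul
  have R1 := ht.ab; have R2 := ht.ac; have R3 := ht.db; have R4 := ht.dc
  have R5 := ht.bc.symm; have R6 := ht.ad'; have R7 := ht.da
  cases τ <;> refine ⟨⟨?_, ?_, ?_, ?_, ?_, ?_⟩, ?_⟩ <;>
  refine MulOpposite.unop_injective (LinearMap.ext fun v => ?_) <;>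
  simp only [opT, MulOpposite.unop_mul, MulOpposite.unop_op,
    Module.End.mul_apply, MulOpposite.unop_smul, MulOpposite.unop_sub, MulOpposite.unop_one,
    LinearMap.smul_apply, LinearMap.sub_apply, Module.End.one_apply, diag_apply, triI_apply,
    triII_apply] <;> ext J <;> fin_cases J <;>
  simp only [Pi.smul_apply, Pi.sub_apply, Fin.zero_eta, Fin.mk_one, Fin.reduceFinMk,
    Matrix.cons_val, smul_mul_assoc, mul_smul_comm, add_mul, sub_mul, mul_assoc, R1, R2, R3, R4, R5,
    R6, R7, mul_add, mul_one, smul_add, smul_sub] <;>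
  match_scalars <;> grind [QParam.mu, QParam.lam]

set_option maxHeartbeats 1600000 in
theorem formsRels_op (t : TGen → A) (τ : Kind) :
    FormsRels P τ (fun x => MulOpposite.op (opT P t τ x))
      fun i => MulOpposite.op (opTheta P i) := by
  have hq := P.q_mul
  have hl := P.l_mul
  refine ⟨thetaRels_op, fun i x => ?_⟩
  cases τ <;> cases x <;> fin_cases i <;>
  refine MulOpposite.unop_injective (LinearMap.ext fun v => ?_) <;>
  simp only [opT, opTheta, Fin.zero_eta, Fin.mk_one, Fin.reduceFinMk, Matrix.cons_val, crossVal,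
    MulOpposite.unop_mul, MulOpposite.unop_op, MulOpposite.unop_add,
    Module.End.mul_apply, MulOpposite.unop_smul, MulOpposite.unop_sub, LinearMap.add_apply,
    LinearMap.smul_apply, LinearMap.sub_apply, diag_apply, triI_apply, theta0_apply, theta1_apply,
    theta2_apply, triII_apply] <;> ext J <;> fin_cases J <;>
  simp only [Pi.smul_apply, Pi.sub_apply, Pi.add_apply, Fin.zero_eta, Fin.mk_one, Fin.reduceFinMk,
    Matrix.cons_val, smul_mul_assoc, mul_smul_comm, add_mul, sub_mul, zero_mul, neg_mul, smul_add,
    smul_sub, smul_zero, smul_neg] <;>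
  match_scalars <;> grind [QParam.mu, QParam.lam]

variable {M : Type u} [Ring M] [Algebra R M]

/-- The element of the external algebra with given coefficients. -/
def form (incl : A →ₐ[R] M) (θ : Fin 3 → M) : W A →ₗ[R] M where
  toFun v := incl (v 0) + incl (v 1) * θ 0 + incl (v 2) * θ 1 + incl (v 3) * θ 2 +
    incl (v 4) * (θ 0 * θ 1) + incl (v 5) * (θ 0 * θ 2) + incl (v 6) * (θ 1 * θ 2) +
    incl (v 7) * (θ 0 * (θ 1 * θ 2))
  map_add' v w := by simp only [Pi.add_apply, map_add, add_mul]; abel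
  map_smul' r v := by simp [smul_add]

theorem form_apply (incl : A →ₐ[R] M) (θ : Fin 3 → M) (v : W A) : form incl θ v =
    incl (v 0) + incl (v 1) * θ 0 + incl (v 2) * θ 1 + incl (v 3) * θ 2 +
    incl (v 4) * (θ 0 * θ 1) + incl (v 5) * (θ 0 * θ 2) + incl (v 6) * (θ 1 * θ 2) +
    incl (v 7) * (θ 0 * (θ 1 * θ 2)) := rfl

-- Together with `form_opTheta`, this makes `form` a map of right modules, so its image is a right
-- ideal containing `1`.
set_option maxHeartbeats 1600000 in
theorem form_opT {incl : A →ₐ[R] M} {θ : Fin 3 → M} {τ : Kind}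
    (h : FormsRels P τ (fun x => incl (t x)) θ) (x : TGen) (v : W A) :
    form incl θ (opT P t τ x v) = form incl θ v * incl (t x) := by
  have hq := P.q_mul
  have hl := P.l_mul
  obtain ⟨⟨S1, S2, S3, S4, S5, S6⟩, hc⟩ := h
  have hc' := fun i x => mul_mul_of_eq (hc i x)
  cases τ <;> cases x <;>
  simp only [opT, form_apply, diag_apply, triI_apply, triII_apply, Matrix.cons_val, map_add,
    map_sub, map_smul, map_mul, add_mul, sub_mul, mul_assoc, hc, hc', crossVal, mul_add, mul_sub,
    smul_mul_assoc, mul_smul_comm, S1, S2, S3, S4, S5, S6, mul_mul_of_eq S1, mul_mul_of_eq S2,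
    mul_mul_of_eq S3, mul_mul_of_eq S4, mul_mul_of_eq S5, mul_mul_of_eq S6, neg_mul, mul_neg,
    smul_add, smul_sub, smul_neg, mul_zero, zero_mul, smul_zero] <;>
  match_scalars <;> grind [QParam.mu, QParam.lam]

theorem form_opTheta {incl : A →ₐ[R] M} {θ : Fin 3 → M} (h : ThetaRels P θ) (i : Fin 3) (v : W A) :
    form incl θ (opTheta P i v) = form incl θ v * θ i := by
  have hq := P.q_mul
  obtain ⟨S1, S2, S3, S4, S5, S6⟩ := h
  fin_cases i <;>
  simp only [opTheta, form_apply, theta0_apply, theta1_apply, theta2_apply, Fin.zero_eta,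
    Fin.mk_one, Fin.reduceFinMk, Matrix.cons_val, map_neg, map_zero, map_smul, add_mul, mul_assoc,
    smul_mul_assoc, mul_smul_comm, S1, S2, S3, S4, S5, S6, mul_mul_of_eq S1, mul_mul_of_eq S2,
    mul_mul_of_eq S3, mul_mul_of_eq S4, mul_mul_of_eq S5, mul_mul_of_eq S6, neg_mul, mul_neg,
    smul_neg, mul_zero, zero_mul, smul_zero, neg_neg] <;>
  match_scalars <;> grind

end ExtModel

end

/-! ### Freeness -/

section

open ExtModel in
/-- The external algebra is a free left module of rank `8` over the function algebra. -/
theorem Presents.nonempty_equiv_ext {R : Type u} [CommRing R] {P : QParam R} {τ : Kind}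
    {A M : Type u} [Ring A] [Algebra R A] [Ring M] [Algebra R M] {t : TGen → A} {g : Gen → M}
    (hA : Presents R (FunRel P) A t) (hM : Presents R (ExtRel P τ) M g) (incl : A →ₐ[R] M)
    (hincl : ∀ x, incl (t x) = g (.t x)) : Nonempty ((Fin 8 → A) ≃ₗ[R] M) := by
  have rA : SLRels P t := hA.rel
  have fM := hM.rel.2
  simp only [← hincl] at fM
  obtain ⟨ρ, hρ⟩ := hM.lift (Module.End A (W A))ᵐᵒᵖ
    (fun | .t x => MulOpposite.op (opT P t τ x)
         | .θ i => MulOpposite.op (opTheta P i))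
    ⟨ExtModel.slRels_op rA τ, formsRels_op t τ⟩
  have hρt := fun x => hρ (.t x)
  have hρθ := fun i => hρ (.θ i)
  simp only [← hincl] at hρt hρθ
  set θ : Fin 3 → M := fun i => g (.θ i) with hθ
  have key : ∀ (x : M) (v : W A), form incl θ ((ρ x).unop v) = form incl θ v * x := by
    intro x
    have hx : x ∈ Algebra.adjoin R (Set.range g) := by rw [hM.gen]; trivial
    induction hx using Algebra.adjoin_induction with
    | mem x hx =>
      obtain ⟨x | i, rfl⟩ := hx <;> intro v
      · rw [← hincl, hρt]; exact form_opT fM x v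
      · rw [hρθ]; exact form_opTheta fM.toThetaRels i v
    | algebraMap r => intro v; simp [Algebra.algebraMap_eq_smul_one]
    | add x y _ _ ix iy => intro v; simp [ix, iy, mul_add]
    | mul x y _ _ ix iy => intro v; simp [ix, iy, mul_assoc]
  -- On the vector `1`, right and left multiplication by `f` agree. The step for products uses that
  -- all operators are left `A`-linear.
  have hfun : ∀ f : A, (ρ (incl f)).unop ![1, 0, 0, 0, 0, 0, 0, 0] =
      f • ![1, 0, 0, 0, 0, 0, 0, 0] := by
    intro f
    have hf : f ∈ Algebra.adjoin R (Set.range t) := by rw [hA.gen]; trivial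
    induction hf using Algebra.adjoin_induction with
    | mem x hx =>
      obtain ⟨x, rfl⟩ := hx
      rw [hρt]
      cases τ <;> cases x <;> simp [opT, diag_apply, triI_apply, triII_apply]
    | algebraMap r => simp [Algebra.algebraMap_eq_smul_one]
    | add x y _ _ ix iy =>
      simp only [map_add, MulOpposite.unop_add, LinearMap.add_apply, ix, iy, add_smul]
    | mul x y _ _ ix iy =>
      simp only [map_mul, MulOpposite.unop_mul, Module.End.mul_apply, ix, map_smul, iy, smul_smul]
  -- As for the function algebra, the inverse is the action on the vector `1`.
  refine ⟨LinearEquiv.ofLinearMap (form incl θ)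
    { toFun := fun m => (ρ m).unop ![1, 0, 0, 0, 0, 0, 0, 0]
      map_add' := fun x y => by simp
      map_smul' := fun r x => by simp } ?_ ?_⟩
  · ext x
    simpa [form_apply] using key x ![1, 0, 0, 0, 0, 0, 0, 0]
  · refine LinearMap.ext fun v => ?_
    have t0 := hρθ 0; have t1 := hρθ 1; have t2 := hρθ 2
    simp only [opTheta, Matrix.cons_val] at t0 t1 t2
    simp only [LinearMap.comp_apply, LinearMap.coe_mk, AddHom.coe_mk, form_apply, map_add, map_mul,
      MulOpposite.unop_add, MulOpposite.unop_mul, LinearMap.add_apply, Module.End.mul_apply, hfun,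
      map_smul, hθ, t0, t1, t2, MulOpposite.unop_op, theta0_apply, theta1_apply, theta2_apply]
    ext J
    fin_cases J <;> simp

theorem inclA_tA (k : Type u) [Field k] (x : TGen) : inclA k (tA k x) = gM k (.t x) := by
  change RingQuot.liftAlgHom k _ (RingQuot.mkAlgHom k _ _) = _
  simp [tM]

section Quantum

variable (k : Type u) [Field k] [CharZero k] (τ : Kind)

theorem inclAq_tAq (x : TGen) : inclAq k τ (tAq k x) = gMq k τ (.t x) := by
  change RingQuot.liftAlgHom k⟦X⟧ _ (RingQuot.mkAlgHom k⟦X⟧ _ _) = _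
  simp [tMq]

instance : Module.Free k⟦X⟧ (Aq k) := (presents_Aq k).free_fun

instance : Module.Free k⟦X⟧ (Mq k τ) :=
  let ⟨e⟩ := (presents_Aq k).nonempty_equiv_ext (presents_Mq k τ) (inclAq k τ) (inclAq_tAq k τ)
  Module.Free.of_equiv e

end Quantum

end

/-! ### Parity -/

section

section Parity

theorem koszul_add_left (p r s : ZMod 2) : koszul (p + r) s = koszul p s * koszul r s := by
  revert p r s; decide

theorem koszul_add_right (p r s : ZMod 2) : koszul p (r + s) = koszul p r * koszul p s := by
  revert p r s; decide

theorem koszul_comm (p r : ZMod 2) : koszul p r = koszul r p := by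
  revert p r; decide

theorem koszul_mul_self (p r : ZMod 2) : koszul p r * koszul p r = 1 := by
  revert p r; decide

theorem koszul_zero_left (p : ZMod 2) : koszul 0 p = 1 := by
  revert p; decide

theorem koszul_zero_right (p : ZMod 2) : koszul p 0 = 1 := by
  revert p; decide

theorem koszul_one_one : koszul 1 1 = -1 := by decide

theorem zmod_two_cases (p : ZMod 2) : p = 0 ∨ p = 1 := by
  revert p; decide

variable {R B : Type*} [CommRing R] [Ring B] [Algebra R B] {g : Gen → B}

theorem prod_mem_parityPart (w : List Gen) :
    (w.map g).prod ∈ parityPart R g (w.map Gen.deg).sum :=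
  Submodule.subset_span ⟨w, rfl, rfl⟩

theorem gen_mem_parityPart (s : Gen) : g s ∈ parityPart R g s.deg := by
  simpa using prod_mem_parityPart (R := R) (g := g) [s]

theorem one_mem_parityPart : (1 : B) ∈ parityPart R g 0 := by
  simpa using prod_mem_parityPart (R := R) (g := g) []

theorem mul_mem_parityPart {p r : ZMod 2} {x y : B} (hx : x ∈ parityPart R g p)
    (hy : y ∈ parityPart R g r) : x * y ∈ parityPart R g (p + r) := by
  unfold parityPart at hx
  induction hx using Submodule.span_induction with
  | mem x hx =>
    obtain ⟨w, rfl, rfl⟩ := hx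
    unfold parityPart at hy
    induction hy using Submodule.span_induction with
    | mem y hy =>
      obtain ⟨w', rfl, rfl⟩ := hy
      simpa using prod_mem_parityPart (R := R) (g := g) (w ++ w')
    | zero => simp
    | add y z _ _ hy hz => rw [mul_add]; exact add_mem hy hz
    | smul c y _ hy => rw [mul_smul_comm]; exact Submodule.smul_mem _ _ hy
  | zero => simp
  | add x z _ _ hx hz => rw [add_mul]; exact add_mem hx hz
  | smul c x _ hx => rw [smul_mul_assoc]; exact Submodule.smul_mem _ _ hx

/-- Homogeneous elements of degree `0` and `1` span. -/
theorem exists_parity_decomposition (hg : Algebra.adjoin R (Set.range g) = ⊤) (x : B) :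
    ∃ x₀ ∈ parityPart R g 0, ∃ x₁ ∈ parityPart R g 1, x = x₀ + x₁ := by
  have hx : x ∈ Algebra.adjoin R (Set.range g) := by rw [hg]; trivial
  induction hx using Algebra.adjoin_induction with
  | mem x hx =>
    obtain ⟨s, rfl⟩ := hx
    have := gen_mem_parityPart (R := R) (g := g) s
    cases s
    · exact ⟨_, this, 0, zero_mem _, by simp⟩
    · exact ⟨0, zero_mem _, _, this, by simp⟩
  | algebraMap r =>
    refine ⟨_, ?_, 0, zero_mem _, (add_zero _).symm⟩
    rw [Algebra.algebraMap_eq_smul_one]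
    exact Submodule.smul_mem _ _ one_mem_parityPart
  | add x y _ _ ix iy =>
    obtain ⟨x₀, hx₀, x₁, hx₁, rfl⟩ := ix
    obtain ⟨y₀, hy₀, y₁, hy₁, rfl⟩ := iy
    exact ⟨_, add_mem hx₀ hy₀, _, add_mem hx₁ hy₁, by abel⟩
  | mul x y _ _ ix iy =>
    obtain ⟨x₀, hx₀, x₁, hx₁, rfl⟩ := ix
    obtain ⟨y₀, hy₀, y₁, hy₁, rfl⟩ := iy
    refine ⟨x₀ * y₀ + x₁ * y₁, add_mem ?_ ?_, x₀ * y₁ + x₁ * y₀, add_mem ?_ ?_, by noncomm_ring⟩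
    · simpa using mul_mem_parityPart hx₀ hy₀
    · simpa [show (1 : ZMod 2) + 1 = 0 by decide] using mul_mem_parityPart hx₁ hy₁
    · simpa using mul_mem_parityPart hx₀ hy₁
    · simpa using mul_mem_parityPart hx₁ hy₀

theorem supercommute_of_generators
    (hg : ∀ s s' : Gen, g s * g s' = koszul s.deg s'.deg • (g s' * g s))
    {p r : ZMod 2} {x y : B} (hx : x ∈ parityPart R g p) (hy : y ∈ parityPart R g r) :
    x * y = koszul p r • (y * x) := by
  have h₁ : ∀ (s : Gen) (w : List Gen), g s * (w.map g).prod =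
      koszul s.deg (w.map Gen.deg).sum • ((w.map g).prod * g s) := by
    intro s w
    induction w with
    | nil => simp [koszul_zero_right]
    | cons s' w ih =>
      simp only [List.map_cons, List.prod_cons, List.sum_cons, koszul_add_right]
      rw [← mul_assoc, hg, smul_mul_assoc, mul_assoc, ih, mul_smul_comm, smul_smul, mul_assoc]
  have h₂ : ∀ w w' : List Gen, (w.map g).prod * (w'.map g).prod =
      koszul (w.map Gen.deg).sum (w'.map Gen.deg).sum • ((w'.map g).prod * (w.map g).prod) := by
    intro w w'
    induction w with
    | nil => simp [koszul_zero_left]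
    | cons s w ih =>
      simp only [List.map_cons, List.prod_cons, List.sum_cons, koszul_add_left]
      rw [mul_assoc, ih, mul_smul_comm, ← mul_assoc, h₁, smul_mul_assoc, smul_smul, mul_assoc,
        mul_comm (koszul _ _)]
  unfold parityPart at hx
  induction hx using Submodule.span_induction with
  | mem x hx =>
    obtain ⟨w, rfl, rfl⟩ := hx
    unfold parityPart at hy
    induction hy using Submodule.span_induction with
    | mem y hy =>
      obtain ⟨w', rfl, rfl⟩ := hy
      exact h₂ w w'
    | zero => simp
    | add y z _ _ hy hz => rw [mul_add, hy, hz, add_mul, smul_add]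
    | smul c y _ hy => rw [mul_smul_comm, hy, smul_mul_assoc, smul_comm]
  | zero => simp
  | add x z _ _ hx hz => rw [add_mul, hx, hz, mul_add, smul_add]
  | smul c x _ hx => rw [smul_mul_assoc, hx, mul_smul_comm, smul_comm]

/-- A parity automorphism acts by the sign on homogeneous elements. -/
theorem parity_apply {σ : B →ₐ[R] B} (hσ : ∀ s, σ (g s) = koszul s.deg 1 • g s)
    {p : ZMod 2} {x : B} (hx : x ∈ parityPart R g p) : σ x = koszul p 1 • x := by
  unfold parityPart at hx
  induction hx using Submodule.span_induction with
  | mem x hx =>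
    obtain ⟨w, rfl, rfl⟩ := hx
    induction w with
    | nil => simp [koszul_zero_left]
    | cons s w ih =>
      simp only [List.map_cons, List.prod_cons, List.sum_cons, map_mul, hσ, ih, koszul_add_left,
        smul_mul_assoc, mul_smul_comm, smul_smul]
      rw [mul_comm]
  | zero => simp
  | add x y _ _ hx hy => rw [map_add, hx, hy, smul_add]
  | smul c x _ hx => rw [map_smul, hx, smul_comm]

/-- The projection onto the component of degree `p`, for a parity automorphism `σ`. -/
def parityProj [Invertible (2 : R)] (σ : B →ₐ[R] B) (p : ZMod 2) : B →ₗ[R] B :=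
  ⅟(2 : R) • (LinearMap.id + koszul p 1 • σ.toLinearMap)

theorem parityProj_apply [Invertible (2 : R)] (σ : B →ₐ[R] B) (p : ZMod 2) (x : B) :
    parityProj σ p x = ⅟(2 : R) • (x + koszul p 1 • σ x) := rfl

theorem parityProj_add [Invertible (2 : R)] (σ : B →ₐ[R] B) (x : B) :
    parityProj σ 0 x + parityProj σ 1 x = x := by
  rw [parityProj_apply, parityProj_apply, koszul_zero_left, koszul_one_one, ← smul_add]
  rw [show x + (1 : ℤ) • σ x + (x + (-1 : ℤ) • σ x) = (2 : R) • x by rw [two_smul]; abel, smul_smul,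
    invOf_mul_self, one_smul]

theorem parityProj_of_mem [Invertible (2 : R)] {σ : B →ₐ[R] B}
    (hσ : ∀ s, σ (g s) = koszul s.deg 1 • g s) {p : ZMod 2} {x : B}
    (hx : x ∈ parityPart R g p) : parityProj σ p x = x := by
  rw [parityProj_apply, parity_apply hσ hx, smul_smul, koszul_mul_self, one_smul, ← two_smul R,
    smul_smul, invOf_mul_self, one_smul]

theorem parityProj_of_mem_ne [Invertible (2 : R)] {σ : B →ₐ[R] B}
    (hσ : ∀ s, σ (g s) = koszul s.deg 1 • g s) {p r : ZMod 2} (hpr : p ≠ r) {x : B}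
    (hx : x ∈ parityPart R g p) : parityProj σ r x = 0 := by
  have : koszul r 1 * koszul p 1 = -1 := by clear hx; revert p r; decide
  rw [parityProj_apply, parity_apply hσ hx, smul_smul, this]
  simp

theorem parityProj_mem [Invertible (2 : R)] {σ : B →ₐ[R] B}
    (hg : Algebra.adjoin R (Set.range g) = ⊤) (hσ : ∀ s, σ (g s) = koszul s.deg 1 • g s)
    (p : ZMod 2) (x : B) : parityProj σ p x ∈ parityPart R g p := by
  obtain ⟨x₀, h₀, x₁, h₁, rfl⟩ := exists_parity_decomposition hg x
  rw [map_add]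
  obtain rfl | rfl := zmod_two_cases p
  · rwa [parityProj_of_mem hσ h₀, parityProj_of_mem_ne hσ one_ne_zero h₁, add_zero]
  · rwa [parityProj_of_mem hσ h₁, parityProj_of_mem_ne hσ zero_ne_one h₀, zero_add]

/-- The graded commutator. -/
def superComm [Invertible (2 : R)] (σ : B →ₐ[R] B) : B →ₗ[R] B →ₗ[R] B :=
  LinearMap.mul R B - (LinearMap.mul R B).flip.compl₂ (parityProj σ 0)
    - ((LinearMap.mul R B).flip.comp σ.toLinearMap).compl₂ (parityProj σ 1)

theorem superComm_apply [Invertible (2 : R)] (σ : B →ₐ[R] B) (x y : B) :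
    superComm σ x y = x * y - parityProj σ 0 y * x - parityProj σ 1 y * σ x := rfl

/-- The power `σ^p` of a parity automorphism. -/
def parityPow (σ : B →ₐ[R] B) (p : ZMod 2) : B →ₐ[R] B := if p = 1 then σ else AlgHom.id R B

theorem superComm_of_mem_right [Invertible (2 : R)] {σ : B →ₐ[R] B}
    (hσ : ∀ s, σ (g s) = koszul s.deg 1 • g s) {p : ZMod 2} (x : B) {y : B}
    (hy : y ∈ parityPart R g p) : superComm σ x y = x * y - y * parityPow σ p x := by
  rw [superComm_apply]
  obtain rfl | rfl := zmod_two_cases p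
  · rw [parityProj_of_mem hσ hy, parityProj_of_mem_ne hσ zero_ne_one hy]
    simp [parityPow]
  · rw [parityProj_of_mem hσ hy, parityProj_of_mem_ne hσ one_ne_zero hy]
    simp [parityPow]

theorem parityPow_of_mem {σ : B →ₐ[R] B}
    (hσ : ∀ s, σ (g s) = koszul s.deg 1 • g s) {p : ZMod 2} (r : ZMod 2) {x : B}
    (hx : x ∈ parityPart R g p) : parityPow σ r x = koszul p r • x := by
  obtain rfl | rfl := zmod_two_cases r
  · simp [parityPow, koszul_zero_right]
  · simp [parityPow, parity_apply hσ hx]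

theorem superComm_of_mem [Invertible (2 : R)] {σ : B →ₐ[R] B}
    (hσ : ∀ s, σ (g s) = koszul s.deg 1 • g s) {p r : ZMod 2} {x y : B}
    (hx : x ∈ parityPart R g p) (hy : y ∈ parityPart R g r) :
    superComm σ x y = x * y - koszul p r • (y * x) := by
  rw [superComm_of_mem_right hσ x hy, parityPow_of_mem hσ r hx, mul_smul_comm]

end Parity

end

/-! ### The bracket of a deformation -/

section

instance invertibleTwoField (k : Type*) [Field k] [CharZero k] : Invertible (2 : k) :=
  invertibleOfNonzero two_ne_zero

instance invertibleTwoPowerSeries (k : Type*) [Field k] [CharZero k] :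
    Invertible (2 : k⟦X⟧) :=
  (Invertible.map (PowerSeries.C : k →+* k⟦X⟧) 2).copy 2 (map_ofNat _ 2).symm

/-- A flat deformation of a supercommutative algebra. -/
structure Deformation (k : Type*) [Field k] [CharZero k] (Bh B : Type*) [Ring Bh]
    [Algebra k⟦X⟧ Bh] [Ring B] [Algebra k B] where
  gh : Gen → Bh
  g : Gen → B
  gen_h : Algebra.adjoin k⟦X⟧ (Set.range gh) = ⊤
  π : Bh →ₛₗ[(PowerSeries.constantCoeff : k⟦X⟧ →+* k)] B
  red : IsReduction π
  π_gh : ∀ s, π (gh s) = g s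
  σh : Bh →ₐ[k⟦X⟧] Bh
  σh_gh : ∀ s, σh (gh s) = koszul s.deg 1 • gh s
  σ : B →ₐ[k] B
  σ_g : ∀ s, σ (g s) = koszul s.deg 1 • g s
  torsionFree : ∀ x : Bh, (PowerSeries.X : k⟦X⟧) • x = 0 → x = 0
  supercomm : ∀ s s' : Gen, g s * g s' = koszul s.deg s'.deg • (g s' * g s)

namespace Deformation

variable {k : Type*} [Field k] [CharZero k] {Bh B : Type*} [Ring Bh] [Algebra k⟦X⟧ Bh] [Ring B]
  [Algebra k B] (D : Deformation k Bh B)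

local notation "ℏ" => (PowerSeries.X : PowerSeries k)

theorem h_cancel (D : Deformation k Bh B) {x y : Bh} (hxy : ℏ • x = ℏ • y) : x = y :=
  sub_eq_zero.1 (D.torsionFree _ (by rw [smul_sub, hxy, sub_self]))

theorem π_h (x : Bh) : D.π (ℏ • x) = 0 := (D.red.ker _).2 ⟨x, rfl⟩

theorem gen : Algebra.adjoin k (Set.range D.g) = ⊤ := by
  refine Algebra.eq_top_iff.2 fun y => ?_
  obtain ⟨x, rfl⟩ := D.red.surjective y
  have hx : x ∈ Algebra.adjoin k⟦X⟧ (Set.range D.gh) := by rw [D.gen_h]; trivial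
  induction hx using Algebra.adjoin_induction with
  | mem x hx =>
    obtain ⟨s, rfl⟩ := hx
    rw [D.π_gh]; exact Algebra.subset_adjoin ⟨s, rfl⟩
  | algebraMap r =>
    rw [Algebra.algebraMap_eq_smul_one, map_smulₛₗ, D.red.map_one]
    exact Subalgebra.smul_mem _ (one_mem _) _
  | add x y _ _ ix iy => rw [map_add]; exact add_mem ix iy
  | mul x y _ _ ix iy => rw [D.red.map_mul]; exact mul_mem ix iy

theorem π_zsmul (n : ℤ) (x : Bh) : D.π (n • x) = n • D.π x := map_zsmul D.π n x

theorem π_word (w : List Gen) : D.π (w.map D.gh).prod = (w.map D.g).prod := by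
  induction w with
  | nil => simpa using D.red.map_one
  | cons s w ih => rw [List.map_cons, List.prod_cons, D.red.map_mul, ih, D.π_gh]; rfl

theorem π_mem {p : ZMod 2} {x : Bh} (hx : x ∈ parityPart k⟦X⟧ D.gh p) :
    D.π x ∈ parityPart k D.g p := by
  unfold parityPart at hx
  induction hx using Submodule.span_induction with
  | mem x hx =>
    obtain ⟨w, rfl, rfl⟩ := hx
    rw [π_word]; exact prod_mem_parityPart w
  | zero => simp
  | add x y _ _ hx hy => rw [map_add]; exact add_mem hx hy
  | smul c x _ hx => rw [map_smulₛₗ]; exact Submodule.smul_mem _ _ hx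

theorem exists_lift_mem {p : ZMod 2} {x : B} (hx : x ∈ parityPart k D.g p) :
    ∃ y ∈ parityPart k⟦X⟧ D.gh p, D.π y = x := by
  unfold parityPart at hx
  induction hx using Submodule.span_induction with
  | mem x hx =>
    obtain ⟨w, rfl, rfl⟩ := hx
    exact ⟨_, prod_mem_parityPart w, D.π_word w⟩
  | zero => exact ⟨0, zero_mem _, map_zero _⟩
  | add x y _ _ hx hy =>
    obtain ⟨x, hx, rfl⟩ := hx
    obtain ⟨y, hy, rfl⟩ := hy
    exact ⟨x + y, add_mem hx hy, map_add _ _ _⟩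
  | smul c x _ hx =>
    obtain ⟨x, hx, rfl⟩ := hx
    exact ⟨(PowerSeries.C c : k⟦X⟧) • x, Submodule.smul_mem _ _ hx, by
      rw [map_smulₛₗ, PowerSeries.constantCoeff_C]⟩

/-- The reduction is supercommutative, so graded commutators vanish modulo `h`. -/
theorem π_superComm (x y : Bh) : D.π (superComm D.σh x y) = 0 := by
  obtain ⟨x₀, hx₀, x₁, hx₁, rfl⟩ := exists_parity_decomposition D.gen_h x
  obtain ⟨y₀, hy₀, y₁, hy₁, rfl⟩ := exists_parity_decomposition D.gen_h y
  have key : ∀ {p r : ZMod 2} {x y : Bh}, x ∈ parityPart k⟦X⟧ D.gh p →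
      y ∈ parityPart k⟦X⟧ D.gh r → D.π (superComm D.σh x y) = 0 := by
    intro p r x y hx hy
    rw [superComm_of_mem D.σh_gh hx hy, map_sub, π_zsmul, D.red.map_mul, D.red.map_mul,
      supercommute_of_generators D.supercomm (D.π_mem hx) (D.π_mem hy), sub_self]
  simp only [map_add, LinearMap.add_apply, key hx₀ hy₀, key hx₀ hy₁, key hx₁ hy₀, key hx₁ hy₁,
    add_zero]

theorem exists_divided (x y : Bh) : ∃ w, superComm D.σh x y = ℏ • w :=
  (D.red.ker _).1 (D.π_superComm x y)

/-- The graded commutator divided by `h`, as a plain function. -/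
def divFun (x y : Bh) : Bh := (D.exists_divided x y).choose

theorem h_divFun (x y : Bh) : ℏ • D.divFun x y = superComm D.σh x y :=
  (D.exists_divided x y).choose_spec.symm

/-- The graded commutator divided by `h`. -/
def divComm : Bh →ₗ[k⟦X⟧] Bh →ₗ[k⟦X⟧] Bh :=
  LinearMap.mk₂ k⟦X⟧ D.divFun
    (fun x x' y => D.h_cancel <| by
      simp only [smul_add, h_divFun, map_add, LinearMap.add_apply])
    (fun c x y => D.h_cancel <| by
      rw [smul_comm]
      simp only [h_divFun, map_smul, LinearMap.smul_apply])
    (fun x y y' => D.h_cancel <| by simp only [smul_add, h_divFun, map_add])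
    (fun c x y => D.h_cancel <| by
      rw [smul_comm]
      simp only [h_divFun, map_smul])

theorem h_divComm (x y : Bh) : ℏ • D.divComm x y = superComm D.σh x y := D.h_divFun x y

/-- By bilinearity, changing an argument by a multiple of `h` changes the divided commutator by a
multiple of `h`. The limit therefore depends only on the reductions. -/
theorem π_divComm_congr {x x' y y' : Bh} (hx : D.π x = D.π x') (hy : D.π y = D.π y') :
    D.π (D.divComm x y) = D.π (D.divComm x' y') := by
  obtain ⟨u, hu⟩ := (D.red.ker (x - x')).1 (by rw [map_sub, hx, sub_self])
  obtain ⟨v, hv⟩ := (D.red.ker (y - y')).1 (by rw [map_sub, hy, sub_self])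
  obtain rfl : x = x' + ℏ • u := by rw [← hu]; abel
  obtain rfl : y = y' + ℏ • v := by rw [← hv]; abel
  simp only [map_add, map_smul, LinearMap.add_apply, LinearMap.smul_apply, π_h, add_zero]

/-- The semiclassical limit of the graded commutator. -/
def bracket : B →ₗ[k] B →ₗ[k] B :=
  -- The chosen section need not be linear; independence of the lifts restores bilinearity.
  let s := Function.surjInv D.red.surjective
  have hs : ∀ x, D.π (s x) = x := Function.surjInv_eq D.red.surjective
  LinearMap.mk₂ k (fun x y => D.π (D.divComm (s x) (s y)))
    (fun x x' y => by
      rw [← map_add, ← LinearMap.add_apply, ← map_add]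
      exact D.π_divComm_congr (by simp only [map_add, hs]) rfl)
    (fun c x y => by
      have : D.π (D.divComm (s (c • x)) (s y)) =
          D.π (D.divComm ((PowerSeries.C c : k⟦X⟧) • s x) (s y)) :=
        D.π_divComm_congr (by rw [map_smulₛₗ, hs, hs, PowerSeries.constantCoeff_C]) rfl
      rw [this, map_smul, LinearMap.smul_apply, map_smulₛₗ, PowerSeries.constantCoeff_C])
    (fun x y y' => by
      rw [← map_add, ← map_add]
      exact D.π_divComm_congr rfl (by simp only [map_add, hs]))
    (fun c x y => by
      have : D.π (D.divComm (s x) (s (c • y))) =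
          D.π (D.divComm (s x) ((PowerSeries.C c : k⟦X⟧) • s y)) :=
        D.π_divComm_congr rfl (by rw [map_smulₛₗ, hs, hs, PowerSeries.constantCoeff_C])
      rw [this, map_smul, map_smulₛₗ, PowerSeries.constantCoeff_C])

theorem bracket_π (x y : Bh) : D.bracket (D.π x) (D.π y) = D.π (D.divComm x y) :=
  D.π_divComm_congr (Function.surjInv_eq D.red.surjective _)
    (Function.surjInv_eq D.red.surjective _)

/-- The parity projections are linear over `k[[h]]`, and `h` can be cancelled. Hence divided
commutators stay homogeneous. -/
theorem mem_of_h_smul_mem {p : ZMod 2} {x : Bh} (hx : ℏ • x ∈ parityPart k⟦X⟧ D.gh p) :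
    x ∈ parityPart k⟦X⟧ D.gh p := by
  have h₁ := parityProj_of_mem D.σh_gh hx
  rw [map_smul] at h₁
  rw [← D.h_cancel h₁]
  exact parityProj_mem D.gen_h D.σh_gh p x

theorem divComm_mem {p r : ZMod 2} {x y : Bh} (hx : x ∈ parityPart k⟦X⟧ D.gh p)
    (hy : y ∈ parityPart k⟦X⟧ D.gh r) : D.divComm x y ∈ parityPart k⟦X⟧ D.gh (p + r) := by
  refine D.mem_of_h_smul_mem ?_
  rw [h_divComm, superComm_of_mem D.σh_gh hx hy]
  refine sub_mem (mul_mem_parityPart hx hy) (zsmul_mem ?_ _)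
  rw [add_comm]
  exact mul_mem_parityPart hy hx

theorem bracket_mem {p r : ZMod 2} {x y : B} (hx : x ∈ parityPart k D.g p)
    (hy : y ∈ parityPart k D.g r) : D.bracket x y ∈ parityPart k D.g (p + r) := by
  obtain ⟨x, hx', rfl⟩ := D.exists_lift_mem hx
  obtain ⟨y, hy', rfl⟩ := D.exists_lift_mem hy
  rw [bracket_π]
  exact D.π_mem (D.divComm_mem hx' hy')

theorem bracket_symm {p r : ZMod 2} {x y : B} (hx : x ∈ parityPart k D.g p)
    (hy : y ∈ parityPart k D.g r) : D.bracket x y = -(koszul p r • D.bracket y x) := by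
  obtain ⟨x, hx', rfl⟩ := D.exists_lift_mem hx
  obtain ⟨y, hy', rfl⟩ := D.exists_lift_mem hy
  rw [bracket_π, bracket_π, ← π_zsmul, ← map_neg]
  congr 1
  apply D.h_cancel
  rw [smul_neg, smul_comm, h_divComm, h_divComm, superComm_of_mem D.σh_gh hx' hy',
    superComm_of_mem D.σh_gh hy' hx', smul_sub, smul_smul, koszul_comm r p, koszul_mul_self]
  simp

theorem bracket_leibniz {r s : ZMod 2} (x : B) {y z : B} (hy : y ∈ parityPart k D.g r)
    (hz : z ∈ parityPart k D.g s) :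
    D.bracket (x * y) z = x * D.bracket y z + koszul r s • (D.bracket x z * y) := by
  obtain ⟨x, rfl⟩ := D.red.surjective x
  obtain ⟨y, hy', rfl⟩ := D.exists_lift_mem hy
  obtain ⟨z, hz', rfl⟩ := D.exists_lift_mem hz
  rw [← D.red.map_mul, bracket_π, bracket_π, bracket_π, ← D.red.map_mul, ← D.red.map_mul,
    ← π_zsmul, ← map_add]
  congr 1
  apply D.h_cancel
  rw [smul_add, smul_comm ℏ (koszul r s), ← mul_smul_comm, ← smul_mul_assoc, h_divComm, h_divComm,
    h_divComm, superComm_of_mem_right D.σh_gh _ hz', superComm_of_mem_right D.σh_gh _ hz',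
    superComm_of_mem_right D.σh_gh _ hz', map_mul, parityPow_of_mem D.σh_gh s hy']
  simp only [mul_sub, sub_mul, smul_sub, mul_smul_comm, mul_assoc]
  abel

theorem bracket_jacobi {p r s : ZMod 2} {x y z : B} (hx : x ∈ parityPart k D.g p)
    (hy : y ∈ parityPart k D.g r) (hz : z ∈ parityPart k D.g s) :
    koszul p s • D.bracket (D.bracket x y) z + koszul r s • D.bracket (D.bracket z x) y +
      koszul p r • D.bracket (D.bracket y z) x = 0 := by
  obtain ⟨x, hx', rfl⟩ := D.exists_lift_mem hx
  obtain ⟨y, hy', rfl⟩ := D.exists_lift_mem hy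
  obtain ⟨z, hz', rfl⟩ := D.exists_lift_mem hz
  simp only [bracket_π, ← π_zsmul, ← map_add]
  convert map_zero D.π
  -- A nested divided commutator has been divided by `h` twice. After two cancellations only the
  -- Jacobi identity of an associative superalgebra remains, and it is checked for each choice of
  -- parities.
  apply D.h_cancel
  apply D.h_cancel
  have key : ∀ {p r s : ZMod 2} {x y z : Bh}, x ∈ parityPart k⟦X⟧ D.gh p →
      y ∈ parityPart k⟦X⟧ D.gh r → z ∈ parityPart k⟦X⟧ D.gh s →
      ℏ • ℏ • D.divComm (D.divComm x y) z = (x * y - koszul p r • (y * x)) * z -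
        koszul (p + r) s • (z * (x * y - koszul p r • (y * x))) := by
    intro p r s x y z hx hy hz
    have h₁ : superComm D.σh x y ∈ parityPart k⟦X⟧ D.gh (p + r) := by
      rw [← h_divComm]
      exact Submodule.smul_mem _ _ (D.divComm_mem hx hy)
    rw [h_divComm, ← LinearMap.smul_apply, ← map_smul, h_divComm, superComm_of_mem D.σh_gh h₁ hz,
      superComm_of_mem D.σh_gh hx hy]
  simp only [smul_add, smul_comm ℏ (koszul _ _), smul_zero, key hx' hy' hz', key hz' hx' hy',
    key hy' hz' hx']
  clear hx hy hz hx' hy' hz' key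
  have h11 : (1 : ZMod 2) + 1 = 0 := by decide
  obtain rfl | rfl := zmod_two_cases p <;> obtain rfl | rfl := zmod_two_cases r <;>
  obtain rfl | rfl := zmod_two_cases s <;>
  simp only [koszul_zero_left, koszul_zero_right, koszul_one_one, zero_add, add_zero, h11,
    one_smul, neg_smul] <;> noncomm_ring

/-- The graded commutator of homogeneous elements determines their bracket. -/
theorem bracket_eq {p r : ZMod 2} {x y w : Bh} (hx : x ∈ parityPart k⟦X⟧ D.gh p)
    (hy : y ∈ parityPart k⟦X⟧ D.gh r) (hw : x * y - koszul p r • (y * x) = ℏ • w) :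
    D.bracket (D.π x) (D.π y) = D.π w := by
  rw [bracket_π]
  congr 1
  apply D.h_cancel
  rw [h_divComm, superComm_of_mem D.σh_gh hx hy, hw]

theorem exists_divided_comm {p r : ZMod 2} {x y : Bh} (hx : x ∈ parityPart k⟦X⟧ D.gh p)
    (hy : y ∈ parityPart k⟦X⟧ D.gh r) :
    ∃ w, x * y - koszul p r • (y * x) = ℏ • w ∧ D.π w = D.bracket (D.π x) (D.π y) :=
  ⟨D.divComm x y, by rw [h_divComm, superComm_of_mem D.σh_gh hx hy], (D.bracket_π x y).symm⟩

/-- If `r = h s`, the constant term of `s` is the linear coefficient of `r`. Two terms are allowed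
because the triangular cross relations have two. -/
theorem bracket_eq_coeff {p r : ZMod 2} {x y z₁ z₂ : Bh} {r₁ r₂ : k⟦X⟧}
    (hx : x ∈ parityPart k⟦X⟧ D.gh p) (hy : y ∈ parityPart k⟦X⟧ D.gh r)
    (h₁ : PowerSeries.constantCoeff r₁ = 0) (h₂ : PowerSeries.constantCoeff r₂ = 0)
    (h : x * y - koszul p r • (y * x) = r₁ • z₁ + r₂ • z₂) :
    D.bracket (D.π x) (D.π y) =
      PowerSeries.coeff 1 r₁ • D.π z₁ + PowerSeries.coeff 1 r₂ • D.π z₂ := by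
  obtain ⟨s₁, rfl⟩ := PowerSeries.X_dvd_iff.2 h₁
  obtain ⟨s₂, rfl⟩ := PowerSeries.X_dvd_iff.2 h₂
  rw [D.bracket_eq hx hy (w := s₁ • z₁ + s₂ • z₂) (by rw [h, smul_add, mul_smul, mul_smul]),
    map_add, map_smulₛₗ, map_smulₛₗ]
  have e (s : k⟦X⟧) : PowerSeries.coeff 1 (PowerSeries.X * s) = PowerSeries.constantCoeff s := by
    rw [← zero_add 1, PowerSeries.coeff_succ_X_mul, PowerSeries.coeff_zero_eq_constantCoeff_apply]
  rw [e, e]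

end Deformation

end

/-! ### The bracket on the tensor square -/

section

namespace Deformation

variable {k : Type*} [Field k] [CharZero k] {Bh B : Type*} [Ring Bh] [Algebra k⟦X⟧ Bh] [Ring B]
  [Algebra k B] (D : Deformation k Bh B)

local notation "ℏ" => (PowerSeries.X : PowerSeries k)

/-- The part of the bracket on `B ⊗ B` in which the second factor of the first argument has degree
`p` and the first factor of the second argument has degree `r`, without the sign. -/
def tensorBracketPart (p r : ZMod 2) : B ⊗[k] B →ₗ[k] B ⊗[k] B →ₗ[k] B ⊗[k] B :=
  TensorProduct.map₂ (D.bracket.compl₂ (parityProj D.σ r)) (LinearMap.mul k B ∘ₗ parityProj D.σ p) +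
  TensorProduct.map₂ ((LinearMap.mul k B).compl₂ (parityProj D.σ r))
    (D.bracket ∘ₗ parityProj D.σ p)

/-- The extension of the bracket to `B ⊗ B`. -/
def tensorBracket : B ⊗[k] B →ₗ[k] B ⊗[k] B →ₗ[k] B ⊗[k] B :=
  D.tensorBracketPart 0 0 + D.tensorBracketPart 0 1 + D.tensorBracketPart 1 0 -
    D.tensorBracketPart 1 1

theorem tensorBracketPart_tmul (p r : ZMod 2) (x y z w : B) :
    D.tensorBracketPart p r (x ⊗ₜ y) (z ⊗ₜ w) =
      D.bracket x (parityProj D.σ r z) ⊗ₜ (parityProj D.σ p y * w) +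
      (x * parityProj D.σ r z) ⊗ₜ D.bracket (parityProj D.σ p y) w := rfl

theorem tensorBracket_tmul (x y z w : B) : D.tensorBracket (x ⊗ₜ y) (z ⊗ₜ w) =
    D.tensorBracketPart 0 0 (x ⊗ₜ y) (z ⊗ₜ w) + D.tensorBracketPart 0 1 (x ⊗ₜ y) (z ⊗ₜ w) +
    D.tensorBracketPart 1 0 (x ⊗ₜ y) (z ⊗ₜ w) - D.tensorBracketPart 1 1 (x ⊗ₜ y) (z ⊗ₜ w) := rfl

/-- On homogeneous arguments only one of the four parts survives the projections, and its sign in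
`tensorBracket` is the Koszul sign. -/
theorem tensorBracket_of_mem {p r : ZMod 2} (x : B) {y z : B} (hy : y ∈ parityPart k D.g p)
    (hz : z ∈ parityPart k D.g r) (w : B) : D.tensorBracket (x ⊗ₜ y) (z ⊗ₜ w) =
      koszul p r • (D.bracket x z ⊗ₜ (y * w) + (x * z) ⊗ₜ D.bracket y w) := by
  have hP : ∀ {p : ZMod 2} {x : B}, x ∈ parityPart k D.g p → ∀ r,
      parityProj D.σ r x = if p = r then x else 0 := by
    intro p x hx r
    split_ifs with h
    · exact h ▸ parityProj_of_mem D.σ_g hx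
    · exact parityProj_of_mem_ne D.σ_g h hx
  simp only [tensorBracket_tmul, tensorBracketPart_tmul, hP hy, hP hz]
  obtain rfl | rfl := zmod_two_cases p <;> obtain rfl | rfl := zmod_two_cases r <;>
  simp [koszul_zero_left, koszul_zero_right, koszul_one_one, -neg_add_rev, -smul_add]

theorem tensorBracket_of_even_right (x y : B) {z : B} (hz : z ∈ parityPart k D.g 0) (w : B) :
    D.tensorBracket (x ⊗ₜ y) (z ⊗ₜ w) =
      D.bracket x z ⊗ₜ (y * w) + (x * z) ⊗ₜ D.bracket y w := by
  have h₀ := D.tensorBracket_of_mem x (parityProj_mem D.gen D.σ_g 0 y) hz w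
  have h₁ := D.tensorBracket_of_mem x (parityProj_mem D.gen D.σ_g 1 y) hz w
  rw [koszul_zero_right, one_smul] at h₀ h₁
  nth_rw 1 2 3 [← parityProj_add D.σ y]
  rw [TensorProduct.tmul_add, map_add, LinearMap.add_apply, h₀, h₁, add_mul, map_add,
    LinearMap.add_apply, TensorProduct.tmul_add, TensorProduct.tmul_add]
  abel

theorem tensorBracket_of_even_left (x : B) {y : B} (hy : y ∈ parityPart k D.g 0) (z w : B) :
    D.tensorBracket (x ⊗ₜ y) (z ⊗ₜ w) =
      D.bracket x z ⊗ₜ (y * w) + (x * z) ⊗ₜ D.bracket y w := by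
  have h₀ := D.tensorBracket_of_mem x hy (parityProj_mem D.gen D.σ_g 0 z) w
  have h₁ := D.tensorBracket_of_mem x hy (parityProj_mem D.gen D.σ_g 1 z) w
  rw [koszul_zero_left, one_smul] at h₀ h₁
  nth_rw 1 2 3 [← parityProj_add D.σ z]
  rw [TensorProduct.add_tmul, map_add, h₀, h₁, mul_add, map_add,
    TensorProduct.add_tmul, TensorProduct.add_tmul]
  abel

/-- The parity automorphism of `Bh ⊗ Bh`. -/
abbrev σσ : Bh ⊗[k⟦X⟧] Bh →ₐ[k⟦X⟧] Bh ⊗[k⟦X⟧] Bh := Algebra.TensorProduct.map D.σh D.σh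

/-- The reduction map of `Bh ⊗ Bh`. -/
abbrev ππ : Bh ⊗[k⟦X⟧] Bh →ₛₗ[(PowerSeries.constantCoeff : k⟦X⟧ →+* k)] B ⊗[k] B :=
  TensorProduct.map D.π D.π

/-- The graded commutator of `u` and `v` quantizes the bracket of their reductions. -/
def TensorQuantizes (u v : Bh ⊗[k⟦X⟧] Bh) : Prop :=
  ∃ W, superComm D.σσ u v = ℏ • W ∧ D.ππ W = D.tensorBracket (D.ππ u) (D.ππ v)

variable {D} in
theorem TensorQuantizes.add_left {u u' v : Bh ⊗[k⟦X⟧] Bh} (h : D.TensorQuantizes u v)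
    (h' : D.TensorQuantizes u' v) : D.TensorQuantizes (u + u') v := by
  obtain ⟨W, h₁, h₂⟩ := h
  obtain ⟨W', h₁', h₂'⟩ := h'
  exact ⟨W + W', by simp only [map_add, LinearMap.add_apply, h₁, h₁', smul_add],
    by simp only [map_add, LinearMap.add_apply, h₂, h₂']⟩

variable {D} in
theorem TensorQuantizes.add_right {u v v' : Bh ⊗[k⟦X⟧] Bh} (h : D.TensorQuantizes u v)
    (h' : D.TensorQuantizes u v') : D.TensorQuantizes u (v + v') := by
  obtain ⟨W, h₁, h₂⟩ := h
  obtain ⟨W', h₁', h₂'⟩ := h'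
  exact ⟨W + W', by simp only [map_add, h₁, h₁', smul_add], by simp only [map_add, h₂, h₂']⟩

theorem tensorQuantizes_zero_left (v : Bh ⊗[k⟦X⟧] Bh) : D.TensorQuantizes 0 v :=
  ⟨0, by simp, by simp⟩

theorem tensorQuantizes_zero_right (u : Bh ⊗[k⟦X⟧] Bh) : D.TensorQuantizes u 0 :=
  ⟨0, by simp, by simp⟩

theorem even_comm {x y : Bh} (hx : x ∈ parityPart k⟦X⟧ D.gh 0) (hy : y ∈ parityPart k⟦X⟧ D.gh 0) :
    D.π x * D.π y = D.π y * D.π x := by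
  simpa [koszul_zero_left] using
    supercommute_of_generators D.supercomm (D.π_mem hx) (D.π_mem hy)

theorem superComm_of_even {x y : Bh} (hx : x ∈ parityPart k⟦X⟧ D.gh 0)
    (hy : y ∈ parityPart k⟦X⟧ D.gh 0) : x * y = y * x + ℏ • D.divComm x y := by
  rw [h_divComm, superComm_of_mem D.σh_gh hx hy, koszul_zero_left, one_smul]
  abel

theorem σh_of_even {x : Bh} (hx : x ∈ parityPart k⟦X⟧ D.gh 0) : D.σh x = x := by
  rw [parity_apply D.σh_gh hx, koszul_zero_left, one_smul]

/-- For even `f, f'` no sign appears, and the graded commutator is `[f, f'] ⊗ m m' + f' f ⊗ [m,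
m']`. Each term is divisible by `h`, and the order of `f` and `f'` no longer matters in the limit.
-/
theorem tensorQuantizes_even_left {f f' : Bh} (hf : f ∈ parityPart k⟦X⟧ D.gh 0)
    (hf' : f' ∈ parityPart k⟦X⟧ D.gh 0) (m m' : Bh) :
    D.TensorQuantizes (f ⊗ₜ m) (f' ⊗ₜ m') := by
  have hp : ∀ p, parityProj D.σσ p (f' ⊗ₜ m') = f' ⊗ₜ parityProj D.σh p m' := by
    intro p
    simp only [parityProj_apply, Algebra.TensorProduct.map_tmul, D.σh_of_even hf']
    obtain rfl | rfl := zmod_two_cases p <;>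
    simp [TensorProduct.tmul_add, TensorProduct.tmul_smul, koszul_zero_left, koszul_one_one,
      TensorProduct.tmul_neg]
  refine ⟨D.divComm f f' ⊗ₜ (m * m') + (f' * f) ⊗ₜ D.divComm m m', ?_, ?_⟩
  · rw [superComm_apply, hp, hp, Algebra.TensorProduct.map_tmul, D.σh_of_even hf]
    simp only [Algebra.TensorProduct.tmul_mul_tmul]
    rw [smul_add, ← TensorProduct.tmul_smul ℏ (f' * f), h_divComm, superComm_apply,
      D.superComm_of_even hf hf',
      TensorProduct.add_tmul, ← TensorProduct.smul_tmul', TensorProduct.tmul_sub,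
      TensorProduct.tmul_sub]
    abel
  · rw [map_add, TensorProduct.map_tmul, TensorProduct.map_tmul, TensorProduct.map_tmul,
      TensorProduct.map_tmul, D.tensorBracket_of_even_right _ _ (D.π_mem hf'), bracket_π, bracket_π,
      D.red.map_mul, D.red.map_mul, D.even_comm hf hf']

theorem tensorQuantizes_even_right {f f' : Bh} (hf : f ∈ parityPart k⟦X⟧ D.gh 0)
    (hf' : f' ∈ parityPart k⟦X⟧ D.gh 0) (m m' : Bh) :
    D.TensorQuantizes (m ⊗ₜ f) (m' ⊗ₜ f') := by
  have hp : ∀ p, parityProj D.σσ p (m' ⊗ₜ f') = parityProj D.σh p m' ⊗ₜ f' := by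
    intro p
    simp only [parityProj_apply, Algebra.TensorProduct.map_tmul, D.σh_of_even hf']
    obtain rfl | rfl := zmod_two_cases p <;>
    simp [TensorProduct.add_tmul, ← TensorProduct.smul_tmul', koszul_zero_left, koszul_one_one,
      TensorProduct.neg_tmul]
  refine ⟨D.divComm m m' ⊗ₜ (f' * f) + (m * m') ⊗ₜ D.divComm f f', ?_, ?_⟩
  · rw [superComm_apply, hp, hp, Algebra.TensorProduct.map_tmul, D.σh_of_even hf]
    simp only [Algebra.TensorProduct.tmul_mul_tmul]
    rw [smul_add, TensorProduct.smul_tmul' ℏ (D.divComm m m'), h_divComm, superComm_apply,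
      D.superComm_of_even hf hf',
      TensorProduct.tmul_add, TensorProduct.tmul_smul, TensorProduct.sub_tmul,
      TensorProduct.sub_tmul]
    abel
  · rw [map_add, TensorProduct.map_tmul, TensorProduct.map_tmul, TensorProduct.map_tmul,
      TensorProduct.map_tmul, D.tensorBracket_of_even_left _ (D.π_mem hf), bracket_π, bracket_π,
      D.red.map_mul, D.red.map_mul, D.even_comm hf hf']

section

variable {A : Type*} [AddCommGroup A] [Module k⟦X⟧ A] {ι : A →ₗ[k⟦X⟧] Bh}

theorem tensorQuantizes_rTensor (hι : ∀ f, ι f ∈ parityPart k⟦X⟧ D.gh 0)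
    (u v : A ⊗[k⟦X⟧] Bh) :
    D.TensorQuantizes (ι.rTensor Bh u) (ι.rTensor Bh v) := by
  induction u using TensorProduct.induction_on with
  | zero => simpa using D.tensorQuantizes_zero_left _
  | add u u' hu hu' => rw [map_add]; exact hu.add_left hu'
  | tmul f m =>
    induction v using TensorProduct.induction_on with
    | zero => simpa using D.tensorQuantizes_zero_right _
    | add v v' hv hv' => rw [map_add]; exact hv.add_right hv'
    | tmul f' m' => exact D.tensorQuantizes_even_left (hι f) (hι f') m m'

theorem tensorQuantizes_lTensor (hι : ∀ f, ι f ∈ parityPart k⟦X⟧ D.gh 0)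
    (u v : Bh ⊗[k⟦X⟧] A) :
    D.TensorQuantizes (ι.lTensor Bh u) (ι.lTensor Bh v) := by
  induction u using TensorProduct.induction_on with
  | zero => simpa using D.tensorQuantizes_zero_left _
  | add u u' hu hu' => rw [map_add]; exact hu.add_left hu'
  | tmul f m =>
    induction v using TensorProduct.induction_on with
    | zero => simpa using D.tensorQuantizes_zero_right _
    | add v v' hv hv' => rw [map_add]; exact hv.add_right hv'
    | tmul f' m' => exact D.tensorQuantizes_even_right (hι m) (hι m') f f'

end

/-- A comultiplication of the deformed algebra reduces to a map compatible with the brackets. -/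
theorem bracket_covariant
    (htf : ∀ u : Bh ⊗[k⟦X⟧] Bh, ℏ • u = 0 → u = 0)
    (F : Bh →ₐ[k⟦X⟧] Bh ⊗[k⟦X⟧] Bh) (hσ : ∀ x, F (D.σh x) = D.σσ (F x)) (E : B → B ⊗[k] B)
    (hE : ∀ x, D.ππ (F x) = E (D.π x)) (hF : ∀ x y, D.TensorQuantizes (F x) (F y)) (x y : B) :
    E (D.bracket x y) = D.tensorBracket (E x) (E y) := by
  obtain ⟨x, rfl⟩ := D.red.surjective x
  obtain ⟨y, rfl⟩ := D.red.surjective y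
  obtain ⟨W, h₁, h₂⟩ := hF x y
  have hp : ∀ p z, F (parityProj D.σh p z) = parityProj D.σσ p (F z) := by
    intro p z
    simp only [parityProj_apply, map_smul, map_add, map_zsmul, hσ]
  -- Both sides become the graded commutator of `F x` and `F y` after multiplication by `h`, which
  -- is injective on the tensor square.
  have h₃ : F (D.divComm x y) = W := by
    refine sub_eq_zero.1 (htf _ ?_)
    rw [smul_sub, ← map_smul, h_divComm, ← h₁, superComm_apply, superComm_apply, map_sub, map_sub,
      map_mul, map_mul, map_mul, hp, hp, hσ, sub_self]
  rw [bracket_π, ← hE, ← hE, ← hE, h₃, h₂]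

end Deformation

end

/-! ### Central determinant, parity automorphisms, uniqueness of the bracket -/

section

/-! ### Centrality of the quantum determinant -/

section DetCentral

variable {R : Type*} [CommRing R] {P : QParam R} {B : Type*} [Ring B] [Algebra R B]
  {t : TGen → B} {θ : Fin 3 → B} {τ : Kind}

theorem MatRels.det_commute (ht : MatRels P t) (x : TGen) :
    Commute (t .a * t .d - P.q • (t .b * t .c)) (t x) := by
  have hq := P.q_mul
  have R1 := ht.ab; have R2 := ht.ac; have R3 := P.eq_qi_smul ht.bd
  have R4 := P.eq_qi_smul ht.cd; have R5 := ht.bc.symm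
  -- The determinant is not yet `1`, so `a d` is left in place and only `d a` is reordered.
  have R6 : t .d * t .a = t .a * t .d - P.mu • (t .b * t .c) := by rw [← ht.ad]; abel
  rw [commute_iff_eq]
  cases x <;>
  simp only [mul_sub, sub_mul, mul_assoc, R1, R2, R3, R4, R5, R6,
    mul_mul_of_eq R1, mul_mul_of_eq R2, mul_mul_of_eq R3, mul_mul_of_eq R4, mul_mul_of_eq R5,
    mul_mul_of_eq R6, smul_mul_assoc, mul_smul_comm, smul_sub] <;>
  match_scalars <;> grind [QParam.mu]

theorem FormsRels.det_commute (ht : MatRels P t) (h : FormsRels P τ t θ) (i : Fin 3) :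
    Commute (t .a * t .d - P.q • (t .b * t .c)) (θ i) := by
  have hq := P.q_mul
  have R1 := ht.ab; have R2 := ht.ac; have R3 := P.eq_qi_smul ht.bd
  have R4 := P.eq_qi_smul ht.cd; have R5 := ht.bc.symm
  have R6 : t .d * t .a = t .a * t .d - P.mu • (t .b * t .c) := by rw [← ht.ad]; abel
  have hc := h.cross
  have hc' := fun i x => mul_mul_of_eq (hc i x)
  rw [commute_iff_eq]
  cases τ <;> fin_cases i <;>
  simp only [Fin.zero_eta, Fin.mk_one, Fin.reduceFinMk, mul_sub, sub_mul, mul_add, add_mul,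
    mul_assoc, hc, hc', crossVal, Matrix.cons_val, R1, R2, R3, R4, R5, R6,
    mul_mul_of_eq R1, mul_mul_of_eq R2, mul_mul_of_eq R3, mul_mul_of_eq R4, mul_mul_of_eq R5,
    mul_mul_of_eq R6, smul_mul_assoc, mul_smul_comm, smul_sub, smul_add] <;>
  match_scalars <;> grind [QParam.mu, QParam.lam]

end DetCentral

theorem detq_central_MqGL (k : Type u) [Field k] [CharZero k] (τ : Kind) (x : MqGL k τ) :
    Commute (detq k (tMqGL k τ)) x := by
  have hp := presents_MqGL k τ
  have hx : x ∈ Algebra.adjoin k⟦X⟧ (Set.range fun s => mkMqGL k τ (FreeAlgebra.ι k⟦X⟧ s)) := by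
    rw [hp.gen]; trivial
  induction hx using Algebra.adjoin_induction with
  | mem x hx =>
    obtain ⟨x | i, rfl⟩ := hx
    · exact hp.rel.1.det_commute x
    · exact hp.rel.2.det_commute hp.rel.1 i
  | algebraMap r => exact (Algebra.commutes r _).symm
  | add x y _ _ ix iy => exact ix.add_right iy
  | mul x y _ _ ix iy => exact ix.mul_right iy

theorem detq_central_Mq (k : Type u) [Field k] [CharZero k] (τ : Kind) (x : Mq k τ) :
    Commute (detq k (tMq k τ)) x := by
  have : detq k (tMq k τ) = 1 := (presents_Mq k τ).rel.1.det
  rw [this]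
  exact Commute.one_left x

/-! ### The parity automorphism -/

section ParityAut

variable {R : Type u} [CommRing R] {P : QParam R} {τ : Kind} {M : Type u} [Ring M] [Algebra R M]
  {g : Gen → M}

/-- Every defining relation is homogeneous in the `θ`'s, so `θ ↦ -θ` respects it. -/
theorem Presents.exists_parity (hM : Presents R (ExtRel P τ) M g) :
    ∃ σ : M →ₐ[R] M, ∀ s, σ (g s) = koszul s.deg 1 • g s := by
  refine hM.lift M (fun s => koszul s.deg 1 • g s) ⟨?_, ?_⟩
  · simpa [Gen.deg, koszul_zero_left] using hM.rel.1
  · obtain ⟨⟨h₁, h₂, h₃, h₄, h₅, h₆⟩, hc⟩ := hM.rel.2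
    simp only [Gen.deg, koszul_zero_left, koszul_one_one, one_smul, neg_smul]
    refine ⟨⟨?_, ?_, ?_, ?_, ?_, ?_⟩, fun i x => ?_⟩
    · simpa using h₁
    · simpa using h₂
    · simpa using h₃
    · simpa using h₄
    · simpa using h₅
    · simpa using h₆
    · rw [neg_mul, hc]
      cases τ <;> cases x <;> fin_cases i <;> simp [crossVal] <;> abel

end ParityAut

/-! ### Uniqueness of a bracket with given values on generators -/

section Unique

variable {k : Type u} [Field k]

theorem IsGradedPoisson.one_left {br : M k →ₗ[k] M k →ₗ[k] M k} (h : IsGradedPoisson br)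
    {s : ZMod 2} {z : M k} (hz : z ∈ parityPart k (gM k) s) : br 1 z = 0 := by
  have := h.leibniz 0 s 1 1 one_mem_parityPart z hz
  rw [koszul_zero_left, one_smul, mul_one, one_mul, mul_one] at this
  simpa using this

/-- The Leibniz rule peels off one letter of the word at a time. -/
theorem IsGradedPoisson.ext_left {br br' : M k →ₗ[k] M k →ₗ[k] M k} (h : IsGradedPoisson br)
    (h' : IsGradedPoisson br') {s : ZMod 2} {z : M k} (hz : z ∈ parityPart k (gM k) s)
    (hg : ∀ s, br (gM k s) z = br' (gM k s) z) (w : List Gen) :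
    br (w.map (gM k)).prod z = br' (w.map (gM k)).prod z := by
  induction w with
  | nil => simp [h.one_left hz, h'.one_left hz]
  | cons s w ih =>
    rw [List.map_cons, List.prod_cons, h.leibniz _ _ _ _ (prod_mem_parityPart w) _ hz,
      h'.leibniz _ _ _ _ (prod_mem_parityPart w) _ hz, ih, hg]

theorem span_words {R B : Type*} [CommRing R] [Ring B] [Algebra R B] {g : Gen → B}
    (hg : Algebra.adjoin R (Set.range g) = ⊤) :
    Submodule.span R (Set.range fun w : List Gen => (w.map g).prod) = ⊤ := by
  refine Submodule.eq_top_iff'.2 fun x => ?_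
  have hle : ∀ p, parityPart R g p ≤
      Submodule.span R (Set.range fun w : List Gen => (w.map g).prod) := by
    intro p
    refine Submodule.span_mono ?_
    rintro _ ⟨w, -, rfl⟩
    exact ⟨w, rfl⟩
  obtain ⟨x₀, h₀, x₁, h₁, rfl⟩ := exists_parity_decomposition hg x
  exact add_mem (hle _ h₀) (hle _ h₁)

theorem adjoin_gM : Algebra.adjoin k (Set.range (gM k)) = ⊤ := by
  have : Set.range (gM k) = mkM k '' Set.range (FreeAlgebra.ι k) := by
    rw [← Set.range_comp]; rfl
  rw [this, ← AlgHom.map_adjoin, FreeAlgebra.adjoin_range_ι, Algebra.map_top, AlgHom.range_eq_top]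
  exact RingQuot.mkAlgHom_surjective k _

/-- A graded Poisson bracket is determined by its values on the generators. -/
theorem IsGradedPoisson.ext {br br' : M k →ₗ[k] M k →ₗ[k] M k} (h : IsGradedPoisson br)
    (h' : IsGradedPoisson br') (hg : ∀ s s', br (gM k s) (gM k s') = br' (gM k s) (gM k s')) :
    br = br' := by
  have h₁ : ∀ (w : List Gen) (s : Gen),
      br (w.map (gM k)).prod (gM k s) = br' (w.map (gM k)).prod (gM k s) := fun w s =>
    h.ext_left h' (gen_mem_parityPart s) (fun s' => hg s' s) w
  have h₂ : ∀ w w' : List Gen, br (w.map (gM k)).prod (w'.map (gM k)).prod =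
      br' (w.map (gM k)).prod (w'.map (gM k)).prod := by
    intro w w'
    refine h.ext_left h' (prod_mem_parityPart w') (fun s => ?_) w
    rw [h.symm _ _ _ (gen_mem_parityPart s) _ (prod_mem_parityPart w'),
      h'.symm _ _ _ (gen_mem_parityPart s) _ (prod_mem_parityPart w'), h₁]
  have hspan := span_words (adjoin_gM (k := k))
  refine LinearMap.ext_on_range hspan fun w => LinearMap.ext_on_range hspan fun w' => h₂ w w'

theorem IsGradedPoisson.swap {br br' : M k →ₗ[k] M k →ₗ[k] M k} (h : IsGradedPoisson br)
    (h' : IsGradedPoisson br') {s s' : Gen}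
    (hs : br (gM k s) (gM k s') = br' (gM k s) (gM k s')) :
    br (gM k s') (gM k s) = br' (gM k s') (gM k s) := by
  rw [h.symm _ _ _ (gen_mem_parityPart s') _ (gen_mem_parityPart s),
    h'.symm _ _ _ (gen_mem_parityPart s') _ (gen_mem_parityPart s), hs]

theorem IsGradedPoisson.even_self [CharZero k] {br : M k →ₗ[k] M k →ₗ[k] M k}
    (h : IsGradedPoisson br)
    (x : TGen) : br (gM k (.t x)) (gM k (.t x)) = 0 := by
  have := h.symm _ _ _ (gen_mem_parityPart (.t x)) _ (gen_mem_parityPart (.t x))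
  rw [Gen.deg, koszul_zero_left, one_smul] at this
  have h₂ : (2 : k) • br (gM k (.t x)) (gM k (.t x)) = 0 := by
    rw [two_smul]; nth_rw 1 [this]; simp
  simpa using h₂

theorem HasBracketValues.unique [CharZero k] {τ : Kind} {br br' : M k →ₗ[k] M k →ₗ[k] M k}
    (h : IsGradedPoisson br) (h' : IsGradedPoisson br') (hv : HasBracketValues τ br)
    (hv' : HasBracketValues τ br') : br = br' := by
  refine h.ext h' fun s s' => ?_
  have c : ∀ i x, br (gM k (.θ i)) (gM k (.t x)) = br' (gM k (.θ i)) (gM k (.t x)) :=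
    fun i x => (hv.cross i x).trans (hv'.cross i x).symm
  have ab := hv.ab.trans hv'.ab.symm
  have ac := hv.ac.trans hv'.ac.symm
  have bd := hv.bd.trans hv'.bd.symm
  have cd := hv.cd.trans hv'.cd.symm
  have cb := hv.cb.trans hv'.cb.symm
  have ad := hv.ad.trans hv'.ad.symm
  have e01 := hv.θ01.trans hv'.θ01.symm
  have e02 := hv.θ02.trans hv'.θ02.symm
  have e12 := hv.θ12.trans hv'.θ12.symm
  have e (x : TGen) : br (gM k (.t x)) (gM k (.t x)) = br' (gM k (.t x)) (gM k (.t x)) := by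
    rw [h.even_self, h'.even_self]
  obtain x | i := s <;> obtain x' | i' := s'
  · cases x <;> cases x'
    -- Half of the pairs are prescribed and their reversals follow by antisymmetry; `{x, x} = 0` for
    -- even `x`.
    exacts [e _, ab, ac, ad, h.swap h' ab, e _, h.swap h' cb, bd, h.swap h' ac, cb, e _, cd,
      h.swap h' ad, h.swap h' bd, h.swap h' cd, e _]
  · exact h.swap h' (c i' x)
  · exact c i x'
  · fin_cases i <;> fin_cases i'
    exacts [hv.θ00.trans hv'.θ00.symm, e01, e02, h.swap h' e01, hv.θ11.trans hv'.θ11.symm, e12,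
      h.swap h' e02, h.swap h' e12, hv.θ22.trans hv'.θ22.symm]

end Unique

end

/-! ### The brackets of type I and II -/

section

theorem X_smul_eq_zero (k : Type*) [Field k] {V : Type*} [AddCommGroup V] [Module k⟦X⟧ V]
    [Module.Free k⟦X⟧ V] {x : V}
    (h : (PowerSeries.X : k⟦X⟧) • x = 0) : x = 0 :=
  (smul_eq_zero.1 h).resolve_left PowerSeries.X_ne_zero

variable (k : Type u) [Field k] [CharZero k] (τ : Kind)

theorem supercomm_gM (s s' : Gen) :
    gM k s * gM k s' = koszul s.deg s'.deg • (gM k s' * gM k s) := by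
  obtain ⟨h₁, -⟩ := (slRels_one_iff k).1 (presents_M k .I).rel.1
  obtain ⟨h₂, h₃⟩ := (formsRels_one_iff k .I).1 (presents_M k .I).rel.2
  obtain x | i := s <;> obtain x' | i' := s' <;>
  simp only [Gen.deg, koszul_zero_left, koszul_zero_right, koszul_one_one, one_smul, neg_smul]
  exacts [h₁ _ _, h₂ _ _, (h₂ _ _).symm, h₃ _ _]

/-- `Mq` as a deformation of `M`. -/
def deformation : Deformation k (Mq k τ) (M k) where
  gh := gMq k τ
  g := gM k
  gen_h := (presents_Mq k τ).gen
  π := (exists_reduction_M k τ).choose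
  red := (exists_reduction_M k τ).choose_spec.1
  π_gh := (exists_reduction_M k τ).choose_spec.2
  σh := (presents_Mq k τ).exists_parity.choose
  σh_gh := (presents_Mq k τ).exists_parity.choose_spec
  σ := (presents_M k τ).exists_parity.choose
  σ_g := (presents_M k τ).exists_parity.choose_spec
  torsionFree _ := X_smul_eq_zero k
  supercomm := supercomm_gM k

theorem isGradedPoisson_bracket : IsGradedPoisson (deformation k τ).bracket where
  degree _ _ _ hx _ hy := (deformation k τ).bracket_mem hx hy
  symm _ _ _ hx _ hy := (deformation k τ).bracket_symm hx hy
  leibniz _ _ x _ hy _ hz := (deformation k τ).bracket_leibniz x hy hz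
  jacobi _ _ _ _ hx _ hy _ hz := (deformation k τ).bracket_jacobi hx hy hz

theorem coeff_one_q : PowerSeries.coeff 1 (q k) = -1 := by
  simp [q, PowerSeries.evalNegHom, PowerSeries.coeff_exp]

theorem coeff_one_q_inv : PowerSeries.coeff 1 (q k)⁻¹ = 1 := by
  have h := congrArg (PowerSeries.coeff 1) (q_mul_inv k)
  rw [PowerSeries.coeff_one_mul, constantCoeff_q, constantCoeff_q_inv, coeff_one_q,
    PowerSeries.coeff_one] at h
  simp at h
  linear_combination h

theorem constantCoeff_mu : PowerSeries.constantCoeff (mu k) = 0 := by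
  simp [mu, constantCoeff_q]

theorem coeff_one_mu : PowerSeries.coeff 1 (mu k) = -2 := by
  rw [mu, map_sub, coeff_one_q, coeff_one_q_inv]; norm_num

variable {k τ}

theorem π_gMq (s : Gen) : (deformation k τ).π (gMq k τ s) = gM k s := (deformation k τ).π_gh s

theorem bracket_gen (s s' : Gen) {z : Mq k τ} {r : k⟦X⟧}
    (h₀ : PowerSeries.constantCoeff r = 0)
    (h : gMq k τ s * gMq k τ s' - koszul s.deg s'.deg • (gMq k τ s' * gMq k τ s) = r • z) :
    (deformation k τ).bracket (gM k s) (gM k s') =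
      PowerSeries.coeff 1 r • (deformation k τ).π z := by
  rw [← π_gMq (τ := τ) s, ← π_gMq (τ := τ) s']
  exact ((deformation k τ).bracket_eq_coeff (gen_mem_parityPart s) (gen_mem_parityPart s') h₀
    (z₁ := z) (r₂ := 0) (z₂ := 0) (map_zero _) (h.trans (by simp))).trans (by simp)

theorem π_mul_gen (s s' : Gen) : (deformation k τ).π (gMq k τ s * gMq k τ s') =
    gM k s * gM k s' := by
  rw [(deformation k τ).red.map_mul, π_gMq, π_gMq]

/-- All cross relations have this shape with `r ≡ 1` and `r' ≡ 0` modulo `h`. As `θⁱ x` and `x θⁱ`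
agree in the limit, the bracket is read off from the linear coefficients. -/
theorem bracket_cross (i j : Fin 3) (x y : TGen) {r r' : k⟦X⟧}
    (h₁ : PowerSeries.constantCoeff r = 1) (h₀ : PowerSeries.constantCoeff r' = 0)
    (h : θMq k τ i * tMq k τ x = r • (tMq k τ x * θMq k τ i) + r' • (tMq k τ y * θMq k τ j)) :
    (deformation k τ).bracket (θM k i) (tM k x) =
      PowerSeries.coeff 1 r • (tM k x * θM k i) + PowerSeries.coeff 1 r' • (tM k y * θM k j) := by
  have h₂ : gMq k τ (.θ i) * gMq k τ (.t x) -
      koszul (Gen.θ i).deg (Gen.t x).deg • (gMq k τ (.t x) * gMq k τ (.θ i)) =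
      (r - 1) • (tMq k τ x * θMq k τ i) + r' • (tMq k τ y * θMq k τ j) := by
    rw [Gen.deg, Gen.deg, koszul_zero_right, one_smul, sub_smul, one_smul]
    exact (congrArg (· - _) h).trans (by simp only [tMq, θMq]; abel)
  have := (deformation k τ).bracket_eq_coeff (gen_mem_parityPart (.θ i))
    (gen_mem_parityPart (.t x)) (by simp [h₁]) h₀ h₂
  rw [(deformation k τ).π_gh, (deformation k τ).π_gh] at this
  refine this.trans ?_
  rw [tMq, θMq, tMq, θMq, π_mul_gen, π_mul_gen, map_sub, PowerSeries.coeff_one, if_neg one_ne_zero,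
    sub_zero]
  rfl

theorem bracket_cross_diag (i : Fin 3) (x : TGen) {r : k⟦X⟧}
    (h₁ : PowerSeries.constantCoeff r = 1)
    (h : θMq k τ i * tMq k τ x = r • (tMq k τ x * θMq k τ i)) :
    (deformation k τ).bracket (θM k i) (tM k x) = PowerSeries.coeff 1 r • (tM k x * θM k i) := by
  have := bracket_cross (τ := τ) i i x x (r' := 0) h₁ (map_zero _) (by rw [h]; simp)
  simpa using this

variable (k τ)

theorem bracket_crossBracket (i : Fin 3) (x : TGen) :
    (deformation k τ).bracket (θM k i) (tM k x) = crossBracket k τ x i := by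
  have hc := (presents_Mq k τ).rel.2.cross
  have hq := constantCoeff_q k; have hqi := constantCoeff_q_inv k; have hmu := constantCoeff_mu k
  have cq := coeff_one_q k; have cqi := coeff_one_q_inv k; have cmu := coeff_one_mu k
  have hlam := constantCoeff_lam k
  -- The cross relations fall into seven shapes: diagonal with factor `1`, `q` or `q⁻¹`, two
  -- triangular ones of type I and two of type II.
  have d1 : ∀ i x, θMq k τ i * tMq k τ x = tMq k τ x * θMq k τ i →
      (deformation k τ).bracket (θM k i) (tM k x) = 0 := fun i x h => by
    rw [bracket_cross_diag i x (r := 1) (map_one _) (by rw [h, one_smul]), PowerSeries.coeff_one,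
      if_neg one_ne_zero, zero_smul]
  have dq : ∀ i x, θMq k τ i * tMq k τ x = q k • (tMq k τ x * θMq k τ i) →
      (deformation k τ).bracket (θM k i) (tM k x) = -(tM k x * θM k i) := fun i x h => by
    rw [bracket_cross_diag i x hq h, cq, neg_smul, one_smul]
  have dqi : ∀ i x, θMq k τ i * tMq k τ x = (q k)⁻¹ • (tMq k τ x * θMq k τ i) →
      (deformation k τ).bracket (θM k i) (tM k x) = tM k x * θM k i := fun i x h => by
    rw [bracket_cross_diag i x hqi h, cqi, one_smul]
  have o0 : ∀ x y, θMq k τ 0 * tMq k τ x =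
      tMq k τ x * θMq k τ 0 + (q k ^ 2 * mu k) • (tMq k τ y * θMq k τ 1) →
      (deformation k τ).bracket (θM k 0) (tM k x) = -((2 : k) • (tM k y * θM k 1)) :=
    fun x y h => by
      rw [bracket_cross 0 1 x y (r := 1) (r' := q k ^ 2 * mu k) (map_one _) (by simp [hmu])
        (by rw [h, one_smul])]
      simp [PowerSeries.coeff_one, PowerSeries.coeff_one_mul, hq, hmu, cmu]
  -- Since `μ = -2h + …` and `λ = 2 + …`, the linear coefficient of `-μλ` is `4`.
  have o2 : ∀ x y, θMq k τ 2 * tMq k τ x =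
      q k • (tMq k τ x * θMq k τ 2) - (mu k * lam k) • (tMq k τ y * θMq k τ 0) →
      (deformation k τ).bracket (θM k 2) (tM k x) =
        (4 : k) • (tM k y * θM k 0) - tM k x * θM k 2 := fun x y h => by
      rw [bracket_cross 2 0 x y (r' := -(mu k * lam k)) hq (by simp [hmu])
        (by rw [h, neg_smul, sub_eq_add_neg]), map_neg, PowerSeries.coeff_one_mul, hmu, cmu, hlam,
        cq]
      module
  have p0 : ∀ x y, θMq k τ 0 * tMq k τ x =
      tMq k τ x * θMq k τ 0 + mu k • (tMq k τ y * θMq k τ 2) →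
      (deformation k τ).bracket (θM k 0) (tM k x) = -((2 : k) • (tM k y * θM k 2)) :=
    fun x y h => by
      rw [bracket_cross 0 2 x y (r := 1) (map_one _) hmu (by rw [h, one_smul])]
      simp [PowerSeries.coeff_one, cmu]
  have p1 : ∀ x y, θMq k τ 1 * tMq k τ x = (q k)⁻¹ • (tMq k τ x * θMq k τ 1) -
      (mu k * lam k * (q k)⁻¹ ^ 2) • (tMq k τ y * θMq k τ 0) →
      (deformation k τ).bracket (θM k 1) (tM k x) =
        (4 : k) • (tM k y * θM k 0) + tM k x * θM k 1 := fun x y h => by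
      rw [bracket_cross 1 0 x y (r' := -(mu k * lam k * (q k)⁻¹ ^ 2)) hqi (by simp [hmu])
        (by rw [h, neg_smul, sub_eq_add_neg]), map_neg, PowerSeries.coeff_one_mul,
        PowerSeries.coeff_one_mul, map_mul, map_pow, hmu, cmu, hlam, cqi, hqi]
      module
  cases τ <;> cases x <;> fin_cases i
  exacts [o0 .a .c (hc 0 .a), dqi 1 .a (hc 1 .a), o2 .a .c (hc 2 .a),
    o0 .b .d (hc 0 .b), dqi 1 .b (hc 1 .b), o2 .b .d (hc 2 .b),
    d1 0 .c (hc 0 .c), dq 1 .c (hc 1 .c), dqi 2 .c (hc 2 .c),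
    d1 0 .d (hc 0 .d), dq 1 .d (hc 1 .d), dqi 2 .d (hc 2 .d),
    d1 0 .a (hc 0 .a), dq 1 .a (hc 1 .a), dqi 2 .a (hc 2 .a),
    d1 0 .b (hc 0 .b), dq 1 .b (hc 1 .b), dqi 2 .b (hc 2 .b),
    p0 .c .a (hc 0 .c), p1 .c .a (hc 1 .c), dq 2 .c (hc 2 .c),
    p0 .d .b (hc 0 .d), p1 .d .b (hc 1 .d), dq 2 .d (hc 2 .d)]

theorem hasBracketValues : HasBracketValues τ (deformation k τ).bracket := by
  obtain ⟨rA, ⟨S1, S2, S3, S4, S5, S6⟩, -⟩ := (presents_Mq k τ).rel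
  have hq := constantCoeff_q k; have hqi := constantCoeff_q_inv k; have hmu := constantCoeff_mu k
  have cq := coeff_one_q k; have cqi := coeff_one_q_inv k; have cmu := coeff_one_mu k
  have hlam := constantCoeff_lam k
  have hm := fun x y => supercomm_gM k (.t x) (.t y)
  simp only [Gen.deg, koszul_zero_left, one_smul] at hm
  have tt : ∀ x y, gMq k τ (.t x) * gMq k τ (.t y) = q k • (gMq k τ (.t y) * gMq k τ (.t x)) →
      (deformation k τ).bracket (tM k x) (tM k y) = -(tM k x * tM k y) := fun x y h => by
    refine (bracket_gen (.t x) (.t y) (r := q k - 1) (z := gMq k τ (.t y) * gMq k τ (.t x))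
      (by simp [hq]) ?_).trans ?_
    · rw [Gen.deg, Gen.deg, koszul_zero_left, one_smul, h, sub_smul, one_smul]
    · rw [π_mul_gen, hm y x]; simp [cq, tM, PowerSeries.coeff_one]
  have zero : ∀ s s', gMq k τ s * gMq k τ s' -
      koszul s.deg s'.deg • (gMq k τ s' * gMq k τ s) = 0 →
      (deformation k τ).bracket (gM k s) (gM k s') = 0 := fun s s' h => by
    rw [bracket_gen s s' (r := 0) (z := 0) (map_zero _) (by rw [h, zero_smul])]; simp
  have kθ : ∀ i j, koszul (Gen.θ i).deg (Gen.θ j).deg = -1 := fun _ _ => rfl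
  refine ⟨tt _ _ rA.ab, tt _ _ rA.ac, tt _ _ rA.bd, tt _ _ rA.cd, ?_, ?_,
    bracket_crossBracket k τ, ?_, ?_, ?_, ?_, ?_, ?_⟩
  · refine zero (.t .c) (.t .b) ?_
    rw [Gen.deg, Gen.deg, koszul_zero_left, one_smul, rA.bc, sub_self]
  · refine (bracket_gen (.t .a) (.t .d) (r := mu k) (z := gMq k τ (.t .b) * gMq k τ (.t .c))
      hmu ?_).trans ?_
    · rw [Gen.deg, Gen.deg, koszul_zero_left, one_smul]; exact rA.ad
    · rw [π_mul_gen, cmu, neg_smul]; rfl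
  · refine (bracket_gen (.θ 0) (.θ 0) (r := 2 * (q k ^ 2 * mu k * (lam k)⁻¹))
      (z := gMq k τ (.θ 1) * gMq k τ (.θ 2)) (by simp [hmu]) ?_).trans ?_
    · rw [kθ, neg_smul, one_smul, sub_neg_eq_add, mul_smul, two_smul]
      exact congrArg₂ (· + ·) S1 S1
    -- For odd elements the graded commutator is the anticommutator, here `2(θ⁰)²`; its linear
    -- coefficient is `2 · (-2) / 2`.
    · have e : PowerSeries.coeff 1 (2 * (q k ^ 2 * mu k * (lam k)⁻¹)) = (-2 : k) := by
        rw [two_mul, map_add, PowerSeries.coeff_one_mul, PowerSeries.coeff_one_mul, map_mul,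
          map_pow PowerSeries.constantCoeff, hmu, hq, cmu, PowerSeries.constantCoeff_inv, hlam]
        ring
      rw [π_mul_gen, e, neg_smul]; rfl
  · refine (bracket_gen (.θ 0) (.θ 1) (r := 1 - (q k)⁻¹ ^ 2)
      (z := gMq k τ (.θ 0) * gMq k τ (.θ 1)) (by simp [hqi]) ?_).trans ?_
    · rw [kθ, neg_smul, one_smul, sub_neg_eq_add, S5, sub_smul, one_smul, sub_eq_add_neg]; rfl
    · have e : PowerSeries.coeff 1 (1 - (q k)⁻¹ ^ 2) = (-2 : k) := by
        rw [pow_two, map_sub, PowerSeries.coeff_one_mul, hqi, cqi, PowerSeries.coeff_one,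
          if_neg one_ne_zero]
        norm_num
      rw [π_mul_gen, e, neg_smul]; rfl
  · refine (bracket_gen (.θ 0) (.θ 2) (r := 1 - q k ^ 2)
      (z := gMq k τ (.θ 0) * gMq k τ (.θ 2)) (by simp [hq]) ?_).trans ?_
    · rw [kθ, neg_smul, one_smul, sub_neg_eq_add, S6, sub_smul, one_smul, sub_eq_add_neg]; rfl
    · have e : PowerSeries.coeff 1 (1 - q k ^ 2) = (2 : k) := by
        rw [pow_two, map_sub, PowerSeries.coeff_one_mul, hq, cq, PowerSeries.coeff_one,
          if_neg one_ne_zero]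
        norm_num
      rw [π_mul_gen, e]; rfl
  · exact zero (.θ 1) (.θ 1) (by rw [S2, smul_zero, sub_zero])
  · exact zero (.θ 1) (.θ 2) (by rw [S4, kθ]; simp)
  · exact zero (.θ 2) (.θ 2) (by rw [S3, smul_zero, sub_zero])

end

/-! ### The classical limit -/

section

/-- Reduction is semilinear over `h ↦ 0`, so the maps compared in the limit are not algebra
homomorphisms over one ring. Additivity, multiplicativity and agreement on scalars are enough. -/
theorem fun_ext_of_adjoin {R X Y ι : Type*} [CommRing R] [Ring X] [Algebra R X] [Semiring Y]
    {g : ι → X} (hg : Algebra.adjoin R (Set.range g) = ⊤) {F G : X → Y}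
    (hgen : ∀ s, F (g s) = G (g s)) (halg : ∀ r, F (algebraMap R X r) = G (algebraMap R X r))
    (hFa : ∀ x y, F (x + y) = F x + F y) (hGa : ∀ x y, G (x + y) = G x + G y)
    (hFm : ∀ x y, F (x * y) = F x * F y) (hGm : ∀ x y, G (x * y) = G x * G y) (x : X) :
    F x = G x := by
  have hx : x ∈ Algebra.adjoin R (Set.range g) := by rw [hg]; trivial
  induction hx using Algebra.adjoin_induction with
  | mem x hx => obtain ⟨s, rfl⟩ := hx; exact hgen s
  | algebraMap r => exact halg r
  | add x y _ _ ix iy => rw [hFa, hGa, ix, iy]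
  | mul x y _ _ ix iy => rw [hFm, hGm, ix, iy]

/-! ### Reduction modulo `h` on tensor products -/

section TensorReduction

variable {k : Type*} [Field k] {A₁ A₂ B₁ B₂ : Type*} [Ring A₁] [Ring A₂] [Ring B₁] [Ring B₂]
  [Algebra k⟦X⟧ A₁] [Algebra k⟦X⟧ A₂] [Algebra k B₁] [Algebra k B₂]
  {f : A₁ →ₛₗ[(PowerSeries.constantCoeff : k⟦X⟧ →+* k)] B₁}
  {f' : A₂ →ₛₗ[(PowerSeries.constantCoeff : k⟦X⟧ →+* k)] B₂}

theorem IsReduction.tensor_mul (hf : IsReduction f) (hf' : IsReduction f')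
    (u v : A₁ ⊗[k⟦X⟧] A₂) : TensorProduct.map f f' (u * v) =
      TensorProduct.map f f' u * TensorProduct.map f f' v := by
  induction u using TensorProduct.induction_on with
  | zero => simp
  | add u u' hu hu' => rw [add_mul, map_add, hu, hu', map_add, add_mul]
  | tmul x y =>
    induction v using TensorProduct.induction_on with
    | zero => simp
    | add v v' hv hv' => rw [mul_add, map_add, hv, hv', map_add, mul_add]
    | tmul x' y' => simp [hf.map_mul, hf'.map_mul]

theorem IsReduction.tensor_one (hf : IsReduction f) (hf' : IsReduction f') :
    TensorProduct.map f f' 1 = 1 := by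
  rw [Algebra.TensorProduct.one_def, TensorProduct.map_tmul, hf.map_one, hf'.map_one,
    Algebra.TensorProduct.one_def]

theorem IsReduction.map_algebraMap (hf : IsReduction f) (r : k⟦X⟧) :
    f (algebraMap _ _ r) = algebraMap k _ (PowerSeries.constantCoeff r) := by
  rw [Algebra.algebraMap_eq_smul_one, map_smulₛₗ, hf.map_one, Algebra.algebraMap_eq_smul_one]

theorem IsReduction.tensor_algebraMap (hf : IsReduction f) (hf' : IsReduction f') (r : k⟦X⟧) :
    TensorProduct.map f f' (algebraMap _ _ r) =
      algebraMap k _ (PowerSeries.constantCoeff r) := by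
  rw [Algebra.algebraMap_eq_smul_one, map_smulₛₗ, hf.tensor_one hf',
    Algebra.algebraMap_eq_smul_one]

end TensorReduction

section Limit

variable (k : Type u) [Field k] [CharZero k] (τ : Kind)

/-- The reduction `Aq → A`. -/
def redA : Aq k →ₛₗ[(PowerSeries.constantCoeff : k⟦X⟧ →+* k)] A k :=
  (exists_reduction_A k).choose

theorem isReduction_redA : IsReduction (redA k) := (exists_reduction_A k).choose_spec.1

theorem redA_tAq (x : TGen) : redA k (tAq k x) = tA k x := (exists_reduction_A k).choose_spec.2 x

/-- The reduction `Mq → M`. -/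
abbrev redM : Mq k τ →ₛₗ[(PowerSeries.constantCoeff : k⟦X⟧ →+* k)] M k := (deformation k τ).π

theorem isReduction_redM : IsReduction (redM k τ) := (deformation k τ).red

variable {k τ}

theorem redM_inclAq (x : Aq k) : redM k τ (inclAq k τ x) = inclA k (redA k x) := by
  refine fun_ext_of_adjoin (presents_Aq k).gen (F := fun x => redM k τ (inclAq k τ x))
    (G := fun x => inclA k (redA k x)) (fun s => ?_) (fun r => ?_) ?_ ?_ ?_ ?_ x
  · simp only [inclAq_tAq, redA_tAq, inclA_tA, π_gMq]
  · simp only [AlgHom.commutes, (isReduction_redM k τ).map_algebraMap,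
      (isReduction_redA k).map_algebraMap]
  · simp
  · simp
  · simp [(isReduction_redM k τ).map_mul]
  · simp [(isReduction_redA k).map_mul]

theorem inclAq_even (x : Aq k) : inclAq k τ x ∈ parityPart k⟦X⟧ (gMq k τ) 0 := by
  have hx : x ∈ Algebra.adjoin k⟦X⟧ (Set.range (tAq k)) := by rw [(presents_Aq k).gen]; trivial
  induction hx using Algebra.adjoin_induction with
  | mem x hx =>
    obtain ⟨s, rfl⟩ := hx
    rw [inclAq_tAq]; exact gen_mem_parityPart (.t s)
  | algebraMap r =>
    rw [AlgHom.commutes, Algebra.algebraMap_eq_smul_one]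
    exact Submodule.smul_mem _ _ one_mem_parityPart
  | add x y _ _ ix iy => rw [map_add]; exact add_mem ix iy
  | mul x y _ _ ix iy => rw [map_mul]; simpa using mul_mem_parityPart ix iy

theorem map_lTensor_incl (u : Aq k ⊗[k⟦X⟧] Aq k) :
    TensorProduct.map (redA k) (redM k τ) ((inclAq k τ).toLinearMap.lTensor (Aq k) u) =
      (inclA k).toLinearMap.lTensor (A k) (TensorProduct.map (redA k) (redA k) u) := by
  induction u using TensorProduct.induction_on with
  | zero => simp
  | add u v hu hv => simp only [map_add, hu, hv]
  | tmul x y => simp [redM_inclAq]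

theorem map_rTensor_incl (u : Aq k ⊗[k⟦X⟧] Aq k) :
    TensorProduct.map (redM k τ) (redA k) ((inclAq k τ).toLinearMap.rTensor (Aq k) u) =
      (inclA k).toLinearMap.rTensor (A k) (TensorProduct.map (redA k) (redA k) u) := by
  induction u using TensorProduct.induction_on with
  | zero => simp
  | add u v hu hv => simp only [map_add, hu, hv]
  | tmul x y => simp [redM_inclAq]

theorem ππ_rTensor (u : Aq k ⊗[k⟦X⟧] Mq k τ) :
    (deformation k τ).ππ ((inclAq k τ).toLinearMap.rTensor (Mq k τ) u) =
      (inclA k).toLinearMap.rTensor (M k) (TensorProduct.map (redA k) (redM k τ) u) := by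
  induction u using TensorProduct.induction_on with
  | zero => simp
  | add u v hu hv => simp only [map_add, hu, hv]
  | tmul x y => simp [redM_inclAq]

theorem ππ_lTensor (u : Mq k τ ⊗[k⟦X⟧] Aq k) :
    (deformation k τ).ππ ((inclAq k τ).toLinearMap.lTensor (Mq k τ) u) =
      (inclA k).toLinearMap.lTensor (M k) (TensorProduct.map (redM k τ) (redA k) u) := by
  induction u using TensorProduct.induction_on with
  | zero => simp
  | add u v hu hv => simp only [map_add, hu, hv]
  | tmul x y => simp [redM_inclAq]

variable {C : Comultiplications k (A k) (M k) (inclA k)}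
  {Q : Comultiplications k⟦X⟧ (Aq k) (Mq k τ) (inclAq k τ)}

theorem limit_Δ (hC : IsClassical C) (hQ : IsQuantum Q) (x : Aq k) :
    TensorProduct.map (redA k) (redA k) (Q.Δ x) = C.Δ (redA k x) := by
  have hA := isReduction_redA k
  refine fun_ext_of_adjoin (presents_Aq k).gen
    (F := fun x => TensorProduct.map (redA k) (redA k) (Q.Δ x))
    (G := fun x => C.Δ (redA k x)) (fun s => ?_) (fun r => ?_) ?_ ?_ ?_ ?_ x
  · obtain ⟨a, b, c, d, -, -, -, -⟩ := hQ.matrix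
    obtain ⟨a', b', c', d', -, -, -, -⟩ := hC.matrix
    cases s <;> simp [redA_tAq, a, b, c, d, a', b', c', d']
  · simp only [AlgHom.commutes, hA.tensor_algebraMap hA, hA.map_algebraMap]
  · simp
  · simp
  · simp [hA.tensor_mul hA]
  · simp [hA.map_mul]

theorem limit_ε (hC : IsClassical C) (hQ : IsQuantum Q) (x : Aq k) :
    PowerSeries.constantCoeff (Q.ε x) = C.ε (redA k x) := by
  have hA := isReduction_redA k
  refine fun_ext_of_adjoin (presents_Aq k).gen
    (F := fun x => PowerSeries.constantCoeff (Q.ε x))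
    (G := fun x => C.ε (redA k x)) (fun s => ?_) (fun r => ?_) ?_ ?_ ?_ ?_ x
  · obtain ⟨-, -, -, -, a, b, c, d⟩ := hQ.matrix
    obtain ⟨-, -, -, -, a', b', c', d'⟩ := hC.matrix
    cases s <;> simp [redA_tAq, a, b, c, d, a', b', c', d']
  · simp only [AlgHom.commutes, hA.map_algebraMap]; rfl
  · simp
  · simp
  · simp
  · simp [hA.map_mul]

theorem limit_ΔL (hC : IsClassical C) (hQ : IsQuantum Q) (x : Mq k τ) :
    TensorProduct.map (redA k) (redM k τ) (Q.ΔL x) = C.ΔL (redM k τ x) := by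
  have hA := isReduction_redA k
  have hM := isReduction_redM k τ
  refine fun_ext_of_adjoin (presents_Mq k τ).gen
    (F := fun x => TensorProduct.map (redA k) (redM k τ) (Q.ΔL x))
    (G := fun x => C.ΔL (redM k τ x)) (fun s => ?_) (fun r => ?_) ?_ ?_ ?_ ?_ x
  · obtain x | i := s
    -- On matrix entries the coaction is `Δ`, whose limit is already known.
    · simp only [← inclAq_tAq, Q.ΔL_incl, map_lTensor_incl, limit_Δ hC hQ, redM_inclAq, C.ΔL_incl]
    · have hdet : tA k .a * tA k .d = 1 + tA k .b * tA k .c :=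
        sub_eq_iff_eq_add.1 ((slRels_one_iff k).1 (presents_A k).rel).2
      have hcomm := ((slRels_one_iff k).1 (presents_A k).rel).1
      have ht := redA_tAq k
      have hθ : ∀ i, redM k τ (θMq k τ i) = θM k i := fun i => π_gMq (.θ i)
      have hlam := constantCoeff_lam k
      have hq := constantCoeff_q k
      have h0 := hQ.left0; have h1 := hQ.left1; have h2 := hQ.left2
      have h0' := hC.left0; have h1' := hC.left1; have h2' := hC.left2
      change TensorProduct.map (redA k) (redM k τ) (Q.ΔL (θMq k τ i)) =
        C.ΔL (redM k τ (θMq k τ i))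
      rw [hθ]
      fin_cases i <;>
      simp only [Fin.zero_eta, Fin.mk_one, Fin.reduceFinMk, h0, h1, h2, h0', h1', h2', map_add,
        map_sub, map_neg, TensorProduct.map_tmul, hθ, map_smulₛₗ, pow_two (tAq k _), hA.map_mul, ht,
        hlam, hq, constantCoeff_q_inv, map_mul, one_smul, mul_one, hdet, pow_two (tA k _),
        hcomm .b .a, hcomm .d .c, two_smul, add_assoc]
  · simp only [AlgHom.commutes, hA.tensor_algebraMap hM, hM.map_algebraMap]
  · simp
  · simp
  · simp [hA.tensor_mul hM]
  · simp [hM.map_mul]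

theorem limit_ΔR (hC : IsClassical C) (hQ : IsQuantum Q) (x : Mq k τ) :
    TensorProduct.map (redM k τ) (redA k) (Q.ΔR x) = C.ΔR (redM k τ x) := by
  have hA := isReduction_redA k
  have hM := isReduction_redM k τ
  refine fun_ext_of_adjoin (presents_Mq k τ).gen
    (F := fun x => TensorProduct.map (redM k τ) (redA k) (Q.ΔR x))
    (G := fun x => C.ΔR (redM k τ x)) (fun s => ?_) (fun r => ?_) ?_ ?_ ?_ ?_ x
  · obtain x | i := s
    · simp only [← inclAq_tAq, Q.ΔR_incl, map_rTensor_incl, limit_Δ hC hQ, redM_inclAq, C.ΔR_incl]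
    · have hθ : ∀ i, redM k τ (θMq k τ i) = θM k i := fun i => π_gMq (.θ i)
      change TensorProduct.map (redM k τ) (redA k) (Q.ΔR (θMq k τ i)) =
        C.ΔR (redM k τ (θMq k τ i))
      rw [hθ, hQ.right, hC.right, TensorProduct.map_tmul, hθ, hA.map_one]
  · simp only [AlgHom.commutes, hM.tensor_algebraMap hA, hM.map_algebraMap]
  · simp
  · simp
  · simp [hM.tensor_mul hA]
  · simp [hM.map_mul]

end Limit

/-! ### The bracket restricts to the function algebra -/

section PoissonLie

variable {k : Type u} [Field k] [CharZero k] {τ : Kind}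
  {C : Comultiplications k (A k) (M k) (inclA k)}
  {Q : Comultiplications k⟦X⟧ (Aq k) (Mq k τ) (inclAq k τ)}

/-- As `A` is commutative, commutators are divisible by `h` already inside `Aq`, so the divided
commutator of lifts can be taken there. -/
theorem exists_bracket_A (f g : A k) :
    ∃ e : A k, inclA k e = (deformation k τ).bracket (inclA k f) (inclA k g) := by
  obtain ⟨f, rfl⟩ := (isReduction_redA k).surjective f
  obtain ⟨g, rfl⟩ := (isReduction_redA k).surjective g
  have hcomm : ∀ x y : A k, x * y = y * x := by
    have h := ((slRels_one_iff k).1 (presents_A k).rel).1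
    have key : Algebra.adjoin k (Set.range (tA k)) ≤ Subalgebra.center k (A k) := by
      have : ∀ x, tA k x ∈ Subalgebra.center k (A k) := by
        intro x
        refine Subalgebra.mem_center_iff.2 fun y => ?_
        have hy : y ∈ Algebra.adjoin k (Set.range (tA k)) := by rw [(presents_A k).gen]; trivial
        induction hy using Algebra.adjoin_induction with
        | mem y hy => obtain ⟨s, rfl⟩ := hy; exact h s x
        | algebraMap r => exact Algebra.commutes r _
        | add x y _ _ ix iy => rw [add_mul, mul_add, ix, iy]
        | mul x' y _ _ ix iy => rw [mul_assoc, iy, ← mul_assoc, ix, mul_assoc]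
      refine Algebra.adjoin_le ?_
      rintro _ ⟨x, rfl⟩
      exact this x
    rw [(presents_A k).gen] at key
    intro x y
    exact (Subalgebra.mem_center_iff.1 (key (x := y) trivial) x)
  obtain ⟨e, he⟩ := ((isReduction_redA k).ker (f * g - g * f)).1
    (by rw [map_sub, (isReduction_redA k).map_mul, (isReduction_redA k).map_mul, hcomm, sub_self])
  refine ⟨redA k e, ?_⟩
  rw [← redM_inclAq (τ := τ), ← redM_inclAq (τ := τ), ← redM_inclAq (τ := τ)]
  refine ((deformation k τ).bracket_eq (inclAq_even f) (inclAq_even g) ?_).symm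
  rw [koszul_zero_left, one_smul, ← map_mul, ← map_mul, ← map_sub, he, map_smul]

end PoissonLie

end

/-! ### Covariance and existence of the comultiplications -/

section

section Covariance

variable {k : Type u} [Field k] [CharZero k] {τ : Kind}
  {C : Comultiplications k (A k) (M k) (inclA k)}
  {Q : Comultiplications k⟦X⟧ (Aq k) (Mq k τ) (inclAq k τ)}

theorem σh_inclAq (x : Aq k) : (deformation k τ).σh (inclAq k τ x) = inclAq k τ x :=
  (deformation k τ).σh_of_even (inclAq_even x)

theorem σh_θMq (i : Fin 3) : (deformation k τ).σh (θMq k τ i) = -θMq k τ i := by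
  refine ((deformation k τ).σh_gh (.θ i)).trans ?_
  rw [Gen.deg, koszul_one_one, neg_smul, one_smul]
  rfl

/-- The coaction sends each `θ` to a combination of terms `f ⊗ θ`, and `Aq` is even; parity is
therefore carried by the second factor alone. -/
theorem ΔL_σh (hQ : IsQuantum Q) (x : Mq k τ) :
    Q.ΔL ((deformation k τ).σh x) =
      Algebra.TensorProduct.map (AlgHom.id k⟦X⟧ (Aq k)) (deformation k τ).σh (Q.ΔL x) := by
  refine DFunLike.congr_fun (f := Q.ΔL.comp (deformation k τ).σh)
    (g := (Algebra.TensorProduct.map (AlgHom.id k⟦X⟧ (Aq k)) (deformation k τ).σh).comp Q.ΔL)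
    ((presents_Mq k τ).hom_ext ?_) x
  rintro (x | i)
  · simp only [AlgHom.comp_apply, ← inclAq_tAq, σh_inclAq, Q.ΔL_incl]
    generalize Q.Δ (tAq k x) = u
    induction u using TensorProduct.induction_on with
    | zero => simp
    | add u v hu hv => rw [map_add, map_add, ← hu, ← hv]
    | tmul x y => simp [σh_inclAq]
  · change Q.ΔL ((deformation k τ).σh (θMq k τ i)) =
      Algebra.TensorProduct.map (AlgHom.id k⟦X⟧ (Aq k)) (deformation k τ).σh (Q.ΔL (θMq k τ i))
    rw [σh_θMq, map_neg]
    have h0 := hQ.left0; have h1 := hQ.left1; have h2 := hQ.left2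
    fin_cases i <;>
    simp only [Fin.zero_eta, Fin.mk_one, Fin.reduceFinMk, h0, h1, h2, map_add, map_sub, map_neg,
      Algebra.TensorProduct.map_tmul, σh_θMq, TensorProduct.tmul_neg, AlgHom.id_apply] <;> abel

theorem ΔR_σh (hQ : IsQuantum Q) (x : Mq k τ) :
    Q.ΔR ((deformation k τ).σh x) =
      Algebra.TensorProduct.map (deformation k τ).σh (AlgHom.id k⟦X⟧ (Aq k)) (Q.ΔR x) := by
  refine DFunLike.congr_fun (f := Q.ΔR.comp (deformation k τ).σh)
    (g := (Algebra.TensorProduct.map (deformation k τ).σh (AlgHom.id k⟦X⟧ (Aq k))).comp Q.ΔR)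
    ((presents_Mq k τ).hom_ext ?_) x
  rintro (x | i)
  · simp only [AlgHom.comp_apply, ← inclAq_tAq, σh_inclAq, Q.ΔR_incl]
    generalize Q.Δ (tAq k x) = u
    induction u using TensorProduct.induction_on with
    | zero => simp
    | add u v hu hv => rw [map_add, map_add, ← hu, ← hv]
    | tmul x y => simp [σh_inclAq]
  · change Q.ΔR ((deformation k τ).σh (θMq k τ i)) =
      Algebra.TensorProduct.map (deformation k τ).σh (AlgHom.id k⟦X⟧ (Aq k)) (Q.ΔR (θMq k τ i))
    rw [σh_θMq, map_neg, hQ.right, Algebra.TensorProduct.map_tmul, σh_θMq, TensorProduct.neg_tmul,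
      AlgHom.id_apply]

/-- The general covariance statement is applied to `ΔL` followed by `Aq ⊗ Mq → Mq ⊗ Mq`. The target
has no `h`-torsion, being a tensor product of free modules. -/
theorem bracket_covariant_left (hC : IsClassical C) (hQ : IsQuantum Q) (x y : M k) :
    (inclA k).toLinearMap.rTensor (M k) (C.ΔL ((deformation k τ).bracket x y)) =
      (deformation k τ).tensorBracket ((inclA k).toLinearMap.rTensor (M k) (C.ΔL x))
        ((inclA k).toLinearMap.rTensor (M k) (C.ΔL y)) := by
  refine (deformation k τ).bracket_covariant (fun _ => X_smul_eq_zero k)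
    ((Algebra.TensorProduct.map (inclAq k τ) (AlgHom.id _ _)).comp Q.ΔL) (fun x => ?_)
    (fun x => (inclA k).toLinearMap.rTensor (M k) (C.ΔL x)) (fun x => ?_)
    (fun x y => (deformation k τ).tensorQuantizes_rTensor (ι := (inclAq k τ).toLinearMap)
      inclAq_even (Q.ΔL x) (Q.ΔL y)) x y
  · rw [AlgHom.comp_apply, AlgHom.comp_apply, ΔL_σh hQ]
    generalize Q.ΔL x = u
    induction u using TensorProduct.induction_on with
    | zero => simp
    | add u v hu hv => simp only [map_add, hu, hv]
    | tmul x y => simp [σh_inclAq]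
  · exact (ππ_rTensor (Q.ΔL x)).trans (congrArg _ (limit_ΔL hC hQ x))

theorem bracket_covariant_right (hC : IsClassical C) (hQ : IsQuantum Q) (x y : M k) :
    (inclA k).toLinearMap.lTensor (M k) (C.ΔR ((deformation k τ).bracket x y)) =
      (deformation k τ).tensorBracket ((inclA k).toLinearMap.lTensor (M k) (C.ΔR x))
        ((inclA k).toLinearMap.lTensor (M k) (C.ΔR y)) := by
  refine (deformation k τ).bracket_covariant (fun _ => X_smul_eq_zero k)
    ((Algebra.TensorProduct.map (AlgHom.id _ _) (inclAq k τ)).comp Q.ΔR) (fun x => ?_)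
    (fun x => (inclA k).toLinearMap.lTensor (M k) (C.ΔR x)) (fun x => ?_)
    (fun x y => (deformation k τ).tensorQuantizes_lTensor (ι := (inclAq k τ).toLinearMap)
      inclAq_even (Q.ΔR x) (Q.ΔR y)) x y
  · rw [AlgHom.comp_apply, AlgHom.comp_apply, ΔR_σh hQ]
    generalize Q.ΔR x = u
    induction u using TensorProduct.induction_on with
    | zero => simp
    | add u v hu hv => simp only [map_add, hu, hv]
    | tmul x y => simp [σh_inclAq]
  · exact (ππ_lTensor (Q.ΔR x)).trans (congrArg _ (limit_ΔR hC hQ x))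

theorem isGradedPoissonLie_bracket (hC : IsClassical C) (hQ : IsQuantum Q) :
    IsGradedPoissonLie C (deformation k τ).bracket where
  poisson := isGradedPoisson_bracket k τ
  covariant := by
    refine ⟨(deformation k τ).tensorBracket,
      fun _ _ x _ hy _ hz w => (deformation k τ).tensorBracket_of_mem x hy hz w, fun f g => ?_,
      bracket_covariant_left hC hQ, bracket_covariant_right hC hQ⟩
    obtain ⟨e, he⟩ := exists_bracket_A (τ := τ) f g
    -- Inside `M ⊗ M`, `Δ` is the restriction of `ΔL`, so compatibility on `A` is a case of left
    -- covariance.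
    have hΔ : ∀ f, TensorProduct.map (inclA k).toLinearMap (inclA k).toLinearMap (C.Δ f) =
        (inclA k).toLinearMap.rTensor (M k) (C.ΔL (inclA k f)) := fun f => by
      rw [C.ΔL_incl, ← LinearMap.comp_apply, LinearMap.rTensor_comp_lTensor]
    exact ⟨e, he, by rw [hΔ, hΔ, hΔ, he, bracket_covariant_left hC hQ]⟩

theorem isQuantization (hC : IsClassical C) (hQ : IsQuantum Q) :
    IsQuantization C (deformation k τ).bracket Q where
  free := inferInstance
  limit := ⟨redA k, redM k τ, isReduction_redA k, isReduction_redM k τ, redA_tAq k, π_gMq,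
    limit_Δ hC hQ, limit_ε hC hQ, limit_ΔL hC hQ, limit_ΔR hC hQ,
    fun _ _ _ hx _ hy => (deformation k τ).exists_divided_comm hx hy⟩

end Covariance

/-! ### Existence of the comultiplications -/

section Existence

variable (k : Type u) [Field k] [CharZero k] (τ : Kind)

theorem exists_isClassical :
    ∃ C : Comultiplications k (A k) (M k) (inclA k), IsClassical C := by
  -- Either type may be chosen here, as the classical algebra has both presentations.
  obtain ⟨C, hm, hR, hL⟩ :=
    exists_comultiplications (presents_A k) (presents_M k .I) (inclA k) (inclA_tA k)
  have hdet : tA k .a * tA k .d = 1 + tA k .b * tA k .c :=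
    sub_eq_iff_eq_add.1 ((slRels_one_iff k).1 (presents_A k).rel).2
  have hcomm := ((slRels_one_iff k).1 (presents_A k).rel).1
  have hlam : (oneParam k).lam = 2 := one_add_one_eq_two
  have hq : (oneParam k).q = 1 := rfl
  have hqi : (oneParam k).qi = 1 := rfl
  refine ⟨C, hm, hR, (hL 0).trans ?_, (hL 1).trans ?_, (hL 2).trans ?_⟩ <;>
  simp only [thetaTensor, Matrix.cons_val, hlam, hq, hqi, one_smul, mul_one, hdet, hcomm .b .a,
    hcomm .d .c, two_smul, add_assoc, θM]

theorem exists_isQuantum :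
    ∃ Q : Comultiplications k⟦X⟧ (Aq k) (Mq k τ) (inclAq k τ), IsQuantum Q := by
  obtain ⟨Q, hm, hR, hL⟩ :=
    exists_comultiplications (presents_Aq k) (presents_Mq k τ) (inclAq k τ) (inclAq_tAq k τ)
  exact ⟨Q, hm, hR, hL 0, hL 1, hL 2⟩

end Existence

end

end SLForms

end

theorem theorem3 (k : Type*) [Field k] [CharZero k] (τ : SLForms.Kind) :
    (∃ (C : SLForms.Comultiplications k (SLForms.A k) (SLForms.M k) (SLForms.inclA k))
        (br : SLForms.M k →ₗ[k] SLForms.M k →ₗ[k] SLForms.M k)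
        (Q : SLForms.Comultiplications k⟦X⟧ (SLForms.Aq k) (SLForms.Mq k τ)
          (SLForms.inclAq k τ)),
      SLForms.IsClassical C ∧
      SLForms.IsGradedPoissonLie C br ∧ SLForms.HasBracketValues τ br ∧
      (∀ br', SLForms.IsGradedPoisson br' → SLForms.HasBracketValues τ br' → br' = br) ∧
      SLForms.IsQuantum Q ∧
      SLForms.IsQuantization C br Q) ∧
    (∀ x : SLForms.MqGL k τ, Commute (SLForms.detq k (SLForms.tMqGL k τ)) x) ∧
    (∀ x : SLForms.Mq k τ, Commute (SLForms.detq k (SLForms.tMq k τ)) x) := by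
  obtain ⟨C, hC⟩ := SLForms.exists_isClassical k
  obtain ⟨Q, hQ⟩ := SLForms.exists_isQuantum k τ
  exact ⟨⟨C, (SLForms.deformation k τ).bracket, Q, hC, SLForms.isGradedPoissonLie_bracket hC hQ,
    SLForms.hasBracketValues k τ, fun _ h hv => SLForms.HasBracketValues.unique h
      (SLForms.isGradedPoisson_bracket k τ) hv (SLForms.hasBracketValues k τ), hQ,
    SLForms.isQuantization hC hQ⟩, SLForms.detq_central_MqGL k τ, SLForms.detq_central_Mq k τ⟩
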